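/- **Conventions.** Let $d\ge 3$, $n\ge 1$; states are not normalised. On $\mathbb C^d\otimes\mathbb C^d$ let $F=\sum_{ij}|ij\rangle\langle ji|$, $P=\frac1d\sum_{ij}|ii\rangle\langle jj|$, $Q=\mathbb 1-P$, $\tilde Q=Q/(d^2-1)$. The Werner states are $\rho_\beta=\mathbb 1+\beta F$, $-1\le\beta\le1$. A state $\rho$ is $n$-distillable if there are projections $A,B$ of the $n$-copy spaces of the two parties onto qubits ($AA^\dagger=BB^\dagger=\mathbb 1_2$) such that $(A\otimes B)\rho^{\otimes n}(A\otimes B)^\dagger$ has a partial transpose which is not positive semidefinite. "The Werner states are $n$-undistillable beyond the 1-distillability boundary" means that $\rho_\beta$ is not $n$-distillable for any $-\frac12\le\beta\le1$. The Schmidt number of a state is the smallest $k$ such that it is a mixture of pure states of Schmidt rank at most $k$. The $U_iU_i^*F$-twirl on $n$ pairs is the average over all $U_1\otimes U_1^*\otimes\cdots\otimes U_n\otimes U_n^*$ (Haar measure on $U(d)^n$) and over all permutations of the pairs. Let $B_k$ be the sum of all $\binom nk$ tensor products of $k$ factors $P$ and $n-k$ factors $\tilde Q$; the state with coordinates $(\tilde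 x_1,\dots,\tilde x_n)$ is $$\rho(\tilde x)=B_0+\sum_{k=1}^n \frac{\tilde x_k}{(d/2-1)^k}\,B_k .$$ **1. Reduction by twirling.** The $U_iU_i^*F$-invariant operators are exactly the linear combinations of $B_0,\dots,B_n$. If $\psi$ has Schmidt rank at most two, the twirl $\mathcal T(|\psi\rangle\langle\psi|)$ is positive semidefinite, invariant, has Schmidt number at most $2$, and $\langle\psi|(\rho_\beta^{T_B})^{\otimes n}|\psi\rangle=\mathrm{Tr}\bigl[\mathcal T(|\psi\rangle\langle\psi|)(\rho_\beta^{T_B})^{\otimes n}\bigr]$ for all real $\beta$. For $-1\le\beta\le 1$, $\rho_\beta$ is $n$-distillable if and only if $\mathrm{Tr}[\sigma(\rho_\beta^{T_B})^{\otimes n}]<0$ for some positive semidefinite $U_iU_i^*F$-invariant $\sigma$ of Schmidt number at most $2$. **2. One copy.** For $1\le k<d$ and $\alpha\ge-1$ the isotropic state $\mathbb 1+\alpha P$ has Schmidt number at most $k$ if and only if $\alpha\le\frac{d(kd-1)}{d-k}$. For $-1\le\beta\le 1$, $\rho_\beta$ is 1-distillable if and only if $\mathrm{Tr}[\rho_\beta^{T_B}(\mathbb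 1+\alpha P)]<0$ with $\alpha=\frac{d(2d-1)}{d-2}$, and if and only if $\beta<-\frac12$. **3. Two copies.** For $x,y\ge0$ let $\rho(x,y)=Q\otimes Q+x(Q\otimes P+P\otimes Q)+yP\otimes P$. It is separable (Schmidt number $1$) if and only if $d^2-2d(x-1)+(1-2x+y)\ge0$ and $d^2-(1-2x+y)\ge0$. The vectors $|00\rangle\otimes(|00\rangle+|11\rangle)$, $|01\rangle\otimes(|00\rangle+|11\rangle)$ and $\sum_{ij}|ii\rangle_A|jj\rangle_B+|i(i{+}1)\rangle_A|j(j{+}1)\rangle_B$ (addition modulo $d$; $A$ holds the first and $B$ the second halves of both pairs) have Schmidt rank two and twirl to positive multiples of $\rho(x,y)$ at, respectively, $$A=\Bigl(\tfrac{(3d-4)(d+1)}{2d-4},\tfrac{2(d+1)^2(d-1)}{d-2}\Bigr),\quad B=\Bigl(\tfrac{d^2-1}{d-2},0\Bigr),\quad C=\Bigl(0,\tfrac{2(d^2-1)^2}{d^2-2}\Bigr).$$ States in the convex hull of $A,B,C$ have Schmidt number at most $2$. States strictly above the line $CA$ have Schmidt number at least $3$. The Werner states are 2-undistillable beyond the 1-distillability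 boundary if and only if all states strictly to the right of the line $AB$ have Schmidt number at least $3$. Moreover, for any $E$ in the open segment $AB$ and any state $D$ (with nonnegative coordinates) strictly to the right of the line $AB$, this holds if and only if all states on the segment $ED$ other than $E$ have Schmidt number at least $3$. **4. $n$ copies.** For all $d\ge3$, $n\ge1$ there is $\varepsilon_0>0$ such that for all $0<\varepsilon<\varepsilon_0$: the Werner states are $n$-undistillable beyond the 1-distillability boundary if and only if for all $\delta>0$ the state with coordinates $$\tilde x_1=\tfrac1n+\varepsilon\bigl(1-\tfrac1n\bigr)+\delta,\qquad \tilde x_k=\varepsilon^{k-1}\Bigl(\tfrac kn+\varepsilon\bigl(1-\tfrac kn\bigr)\Bigr)\quad(2\le k\le n)$$ has Schmidt number at least $3$. (For $n\le2$ these are the coordinates $(\frac1n+\varepsilon(1-\frac1n)+\delta,\varepsilon,\dots,\varepsilon)$.) **5. The coordinates $(\frac1n+\varepsilon(1-\frac1n)+\delta,\varepsilon,\dots,\varepsilon)$.** (a) For all $d\ge3$, $n\ge1$: if the Werner states are $n$-undistillable beyond the 1-distillability boundary, then the state with these coordinates has Schmidt number at least $3$ for all $\varepsilon,\delta>0$.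 (b) There are numbers $D(n)$, with $D(n)=3$ for $n\le3$, such that for all $n\ge1$ and $d\ge\max(3,D(n))$ the equivalence of item 4 holds with these coordinates, for all sufficiently small $\varepsilon>0$. (c) For every $n\ge1$: the Werner states of all dimensions $d\ge3$ are $n$-undistillable beyond the 1-distillability boundary if and only if for every $d\ge3$ the state with these coordinates has Schmidt number at least $3$ for all sufficiently small $\varepsilon>0$ and all $\delta>0$. -/

import Mathlib

open MeasureTheory
open scoped Matrix Kronecker ComplexOrder

namespace Distill

noncomputable section

/-! ### Bipartite vectors and operators -/

/-- The partial transpose `X ^ {T_B}` of an operator on `A ⊗ B`. -/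
def partialTranspose {a b : Type*} (X : Matrix (a × b) (a × b) ℂ) : Matrix (a × b) (a × b) ℂ :=
  Matrix.of fun p q => X (p.1, q.2) (q.1, p.2)

/-- The Schmidt rank of a vector in `A ⊗ B`: the rank of its coefficient matrix. -/
def schmidtRank {a b : Type*} [Fintype b] (ψ : a × b → ℂ) : ℕ :=
  (Matrix.of fun i j => ψ (i, j)).rank

/-- The (unnormalised) projector `|ψ⟩⟨ψ|`. -/
def proj {a : Type*} (ψ : a → ℂ) : Matrix a a ℂ :=
  Matrix.vecMulVec ψ (star ψ)

/-- `ρ` is a mixture of pure states of Schmidt rank at most `k`. States are not normalised, so the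
weights of the mixture are absorbed in the vectors. -/
def IsMixtureOfSchmidtRank {a b : Type*} [Fintype b] (k : ℕ) (ρ : Matrix (a × b) (a × b) ℂ) :
    Prop :=
  ∃ (m : ℕ) (v : Fin m → a × b → ℂ), (∀ i, schmidtRank (v i) ≤ k) ∧ ρ = ∑ i, proj (v i)

/-- The Schmidt number of a (nonzero, positive semidefinite) operator: the smallest `k` such that
it is a mixture of pure states of Schmidt rank at most `k`. -/
def schmidtNumber {a b : Type*} [Fintype b] (ρ : Matrix (a × b) (a × b) ℂ) : ℕ :=
  sInf {k | IsMixtureOfSchmidtRank k ρ}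

/-! ### Several copies -/

/-- Basis labels for `n` copies of `ℂ^d ⊗ ℂ^d`: all labels of party `A`, then all of party `B`. -/
abbrev Idx (n d : ℕ) : Type := (Fin n → Fin d) × (Fin n → Fin d)

/-- The tensor product of operators `X i` acting on the `i`-th pair. -/
def tensorOp {n d : ℕ} (X : Fin n → Matrix (Fin d × Fin d) (Fin d × Fin d) ℂ) :
    Matrix (Idx n d) (Idx n d) ℂ :=
  Matrix.of fun p q => ∏ i, X i (p.1 i, p.2 i) (q.1 i, q.2 i)

/-- The tensor product of vectors `φ i` of the `i`-th pair. -/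
def tensorVec {n d : ℕ} (φ : Fin n → Fin d × Fin d → ℂ) : Idx n d → ℂ :=
  fun p => ∏ i, φ i (p.1 i, p.2 i)

/-- `ρ` is `n`-distillable: some projection of `n` copies onto a pair of qubits,
`(P ⊗ Q) ρ^{⊗ n} (P ⊗ Q)†`, is entangled, i.e. has a partial transpose that is not positive. -/
def NDistillable (n : ℕ) {d : ℕ} (ρ : Matrix (Fin d × Fin d) (Fin d × Fin d) ℂ) : Prop :=
  ∃ P Q : Matrix (Fin 2) (Fin n → Fin d) ℂ, P * Pᴴ = 1 ∧ Q * Qᴴ = 1 ∧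
    ¬ (partialTranspose
        ((P ⊗ₖ Q) * tensorOp (fun _ : Fin n => ρ) * (P ⊗ₖ Q)ᴴ)).PosSemidef

/-! ### Werner and isotropic states -/

/-- The flip operator `F = ∑ |ij⟩⟨ji|`. -/
def flip (d : ℕ) : Matrix (Fin d × Fin d) (Fin d × Fin d) ℂ :=
  Matrix.of fun p q => if p.1 = q.2 ∧ p.2 = q.1 then 1 else 0

/-- The (unnormalised) Werner state `1 + β F`. -/
def werner (d : ℕ) (β : ℝ) : Matrix (Fin d × Fin d) (Fin d × Fin d) ℂ :=
  1 + (β : ℂ) • flip d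

/-- The projector `P = (1/d) ∑ |ii⟩⟨jj|` onto the maximally entangled state. -/
def maxEnt (d : ℕ) : Matrix (Fin d × Fin d) (Fin d × Fin d) ℂ :=
  Matrix.of fun p q => if p.1 = p.2 ∧ q.1 = q.2 then (1 / (d : ℂ)) else 0

/-- `Q = 1 - P`. -/
def maxEntCompl (d : ℕ) : Matrix (Fin d × Fin d) (Fin d × Fin d) ℂ :=
  1 - maxEnt d

/-- `Q̃ = Q / (d² - 1)`. -/
def maxEntComplNormalized (d : ℕ) : Matrix (Fin d × Fin d) (Fin d × Fin d) ℂ :=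
  (1 / ((d : ℂ) ^ 2 - 1)) • maxEntCompl d

/-- The (unnormalised) isotropic state `1 + α P`. -/
def isotropic (d : ℕ) (α : ℝ) : Matrix (Fin d × Fin d) (Fin d × Fin d) ℂ :=
  1 + (α : ℂ) • maxEnt d

/-- The Werner states at and beyond the `1`-distillability boundary, `-1/2 ≤ β ≤ 1`, are all
`n`-undistillable. -/
def WernerUndistillable (n d : ℕ) : Prop :=
  ∀ β : ℝ, -1 / 2 ≤ β → β ≤ 1 → ¬ NDistillable n (werner d β)

/-! ### The symmetry group and its twirl -/

instance instMeasurableSpaceUnitary (d : ℕ) : MeasurableSpace (Matrix.unitaryGroup (Fin d) ℂ) :=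
  borel _

instance instBorelSpaceUnitary (d : ℕ) : BorelSpace (Matrix.unitaryGroup (Fin d) ℂ) :=
  ⟨rfl⟩

instance instCompactSpaceUnitary (d : ℕ) : CompactSpace (Matrix.unitaryGroup (Fin d) ℂ) := by
  refine isCompact_iff_compactSpace.mp
    (?_ : IsCompact ((Matrix.unitaryGroup (Fin d) ℂ : Submonoid (Matrix (Fin d) (Fin d) ℂ)) :
      Set (Matrix (Fin d) (Fin d) ℂ)))
  have hK : IsCompact (Set.pi Set.univ fun _ : Fin d => Set.pi Set.univ fun _ : Fin d =>
      Metric.closedBall (0 : ℂ) 1) :=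
    isCompact_univ_pi fun _ => isCompact_univ_pi fun _ => isCompact_closedBall 0 1
  refine IsCompact.of_isClosed_subset hK ?_ ?_
  · have h : ((Matrix.unitaryGroup (Fin d) ℂ : Submonoid (Matrix (Fin d) (Fin d) ℂ)) :
        Set (Matrix (Fin d) (Fin d) ℂ)) = {U | star U * U = 1} := by
      ext U
      exact Matrix.mem_unitaryGroup_iff'
    rw [h]
    exact isClosed_eq (by fun_prop) continuous_const
  · intro U hU i _ j _
    simpa using entry_norm_bound_of_unitary hU i j

/-- The Haar probability measure on `U(d)`. -/
def haarUnitary (d : ℕ) : Measure (Matrix.unitaryGroup (Fin d) ℂ) :=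
  Measure.haarMeasure ⊤

/-- `U ⊗ U*`, with `U*` the entrywise complex conjugate of `U`. -/
def localUnitary {d : ℕ} (U : Matrix.unitaryGroup (Fin d) ℂ) :
    Matrix (Fin d × Fin d) (Fin d × Fin d) ℂ :=
  (U : Matrix (Fin d) (Fin d) ℂ) ⊗ₖ ((U : Matrix (Fin d) (Fin d) ℂ).map star)

/-- Conjugation by `U₁ ⊗ U₁* ⊗ ⋯ ⊗ Uₙ ⊗ Uₙ*`. -/
def conjLocal {n d : ℕ} (U : Fin n → Matrix.unitaryGroup (Fin d) ℂ)
    (X : Matrix (Idx n d) (Idx n d) ℂ) : Matrix (Idx n d) (Idx n d) ℂ :=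
  tensorOp (fun i => localUnitary (U i)) * X * (tensorOp fun i => localUnitary (U i))ᴴ

/-- Permuting the `n` pairs. -/
def permutePairs {n d : ℕ} (σ : Equiv.Perm (Fin n)) (X : Matrix (Idx n d) (Idx n d) ℂ) :
    Matrix (Idx n d) (Idx n d) ℂ :=
  X.submatrix (fun p => (p.1 ∘ σ, p.2 ∘ σ)) (fun p => (p.1 ∘ σ, p.2 ∘ σ))

/-- `U_i U_i* F`-invariant operators. -/
def IsUUFInvariant {n d : ℕ} (X : Matrix (Idx n d) (Idx n d) ℂ) : Prop :=
  (∀ U : Fin n → Matrix.unitaryGroup (Fin d) ℂ, conjLocal U X = X) ∧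
    ∀ σ : Equiv.Perm (Fin n), permutePairs σ X = X

/-- The `U_i U_i* F`-twirl: the average over the local unitaries `U_i ⊗ U_i*` (Haar measure) and
over the permutations of the pairs, the integral being taken entrywise. -/
def twirl {n d : ℕ} (X : Matrix (Idx n d) (Idx n d) ℂ) : Matrix (Idx n d) (Idx n d) ℂ :=
  Matrix.of fun p q => (1 / (n.factorial : ℂ)) * ∑ σ : Equiv.Perm (Fin n),
    ∫ U, permutePairs σ (conjLocal U X) p q ∂(Measure.pi fun _ : Fin n => haarUnitary d)

/-! ### The invariant states -/

/-- The sum of all tensor products with `k` factors `P` and `n - k` factors `Q̃`. -/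
def levelOp (n d k : ℕ) : Matrix (Idx n d) (Idx n d) ℂ :=
  ∑ T ∈ (Finset.univ : Finset (Fin n)).powersetCard k,
    tensorOp fun i => if i ∈ T then maxEnt d else maxEntComplNormalized d

/-- The `U_i U_i* F`-invariant operator with normalised coordinates `x 1, …, x n`, i.e. with
coefficients `x k / (d/2 - 1)^k`, and with coefficient `1` of `Q̃^{⊗ n}`. -/
def invariantState (n d : ℕ) (x : ℕ → ℝ) : Matrix (Idx n d) (Idx n d) ℂ :=
  levelOp n d 0 +
    ∑ k ∈ Finset.Icc 1 n, ((x k / ((d : ℝ) / 2 - 1) ^ k : ℝ) : ℂ) • levelOp n d k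

/-- The coordinates `(1/n + ε(1 - 1/n) + δ, ε, …, ε)`. -/
def flatCoords (n : ℕ) (ε δ : ℝ) : ℕ → ℝ := fun k =>
  if k = 1 then 1 / (n : ℝ) + ε * (1 - 1 / (n : ℝ)) + δ else ε

/-- The coordinates `x₁ = 1/n + ε(1 - 1/n) + δ` and `x_k = ε^(k-1) (k/n + ε(1 - k/n))` for
`k ≥ 2`. -/
def interiorCoords (n : ℕ) (ε δ : ℝ) : ℕ → ℝ := fun k =>
  if k = 1 then 1 / (n : ℝ) + ε * (1 - 1 / (n : ℝ)) + δ
  else ε ^ (k - 1) * ((k : ℝ) / n + ε * (1 - (k : ℝ) / n))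

/-! ### Two copies -/

/-- `Q ⊗ Q + x (Q ⊗ P + P ⊗ Q) + y P ⊗ P` for the point `z = (x, y)`. -/
def twoCopyState (d : ℕ) (z : ℝ × ℝ) : Matrix (Idx 2 d) (Idx 2 d) ℂ :=
  tensorOp ![maxEntCompl d, maxEntCompl d] +
    (z.1 : ℂ) • (tensorOp ![maxEntCompl d, maxEnt d] + tensorOp ![maxEnt d, maxEntCompl d]) +
    (z.2 : ℂ) • tensorOp ![maxEnt d, maxEnt d]

/-- The point `A` of the `(x, y)`-plane. -/
def pointA (d : ℕ) : ℝ × ℝ :=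
  ((3 * d - 4) * (d + 1) / (2 * d - 4), 2 * (d + 1) ^ 2 * (d - 1) / (d - 2))

/-- The point `B` of the `(x, y)`-plane. -/
def pointB (d : ℕ) : ℝ × ℝ := (((d : ℝ) ^ 2 - 1) / (d - 2), 0)

/-- The point `C` of the `(x, y)`-plane. -/
def pointC (d : ℕ) : ℝ × ℝ := (0, 2 * ((d : ℝ) ^ 2 - 1) ^ 2 / ((d : ℝ) ^ 2 - 2))

/-- `z` lies strictly above the line through `C` and `A`. -/
def AboveCA (d : ℕ) (z : ℝ × ℝ) : Prop :=
  (pointC d).2 + ((pointA d).2 - (pointC d).2) / ((pointA d).1 - (pointC d).1) *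
    (z.1 - (pointC d).1) < z.2

/-- `z` lies strictly to the right of the line through `A` and `B`. -/
def RightOfAB (d : ℕ) (z : ℝ × ℝ) : Prop :=
  (pointB d).1 + ((pointA d).1 - (pointB d).1) / ((pointA d).2 - (pointB d).2) *
    (z.2 - (pointB d).2) < z.1

/-- The basis vector `|a b⟩` of `ℂ^d ⊗ ℂ^d`. -/
def ket {d : ℕ} (a b : ℕ) : Fin d × Fin d → ℂ := fun p =>
  if p.1.val = a ∧ p.2.val = b then 1 else 0

/-- `|00⟩ ⊗ (|00⟩ + |11⟩)`. -/
def psiA (d : ℕ) : Idx 2 d → ℂ := tensorVec ![ket 0 0, ket 0 0 + ket 1 1]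

/-- `|01⟩ ⊗ (|00⟩ + |11⟩)`. -/
def psiB (d : ℕ) : Idx 2 d → ℂ := tensorVec ![ket 0 1, ket 0 0 + ket 1 1]

/-- `∑ |ii⟩_A |jj⟩_B + |i(i+1)⟩_A |j(j+1)⟩_B`, with addition modulo `d`; party `A` holds the first
halves of both pairs and party `B` the second halves. -/
def psiC (d : ℕ) : Idx 2 d → ℂ := fun p =>
  (if p.1 1 = p.1 0 ∧ p.2 1 = p.2 0 then 1 else 0) +
    (if (p.1 1).val = ((p.1 0).val + 1) % d ∧ (p.2 1).val = ((p.2 0).val + 1) % d then 1 else 0)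

end

end Distill

/-!
The proof rests on one observation: an operator invariant under the `U_i U_i* F`-twirl is
determined by its expectation values in the witnesses `W(β) = ((1 + β F)^{T_B})^{⊗ n}`, that is by
its *enumerator* `β ↦ Tr[X W(β)]`, a polynomial of degree at most `n`
(`IsUUFInvariant.eq_of_trace_mul_witness`). On one pair, `(1 + β F)^{T_B} = 1 + β d P`. Since the
twirl preserves the expectation values of the witnesses (`trace_twirl_mul_witness`) and does not
increase Schmidt numbers (`isMixture_twirl_proj`), the invariant states of Schmidt number at most
`k` become a convex cone of polynomials (`IsMixtureEnumerator`), spanned by the polynomials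
`⟨ψ| W(β) |ψ⟩` of the vectors `ψ` of Schmidt rank at most `k`. To show that an invariant state has
Schmidt number at most `k` amounts to writing its enumerator as a positive combination of such
polynomials; apart from the vector of the point `C`, the ones used are tensor products of `|01⟩`
and `|00⟩ + ⋯ + |t-1,t-1⟩` (`pairVec`), and products of two local GHZ states (`ghzVec`).

A state is `n`-distillable if and only if `⟨ψ| W(β) |ψ⟩ < 0` for some `ψ` of Schmidt rank at most
two (`nDistillable_werner_iff`). Undistillability for all `β ≥ -1/2` is the statement at
`β = -1/2` (`wernerUndistillable_iff`): the cone lies in the half-space `p(-1/2) ≥ 0`. The cone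
touches the boundary of this half-space in the face of the polynomials `(1 + 2β) h(β)`, and as
soon as it contains `(1 + 2β) q_j` for polynomials `q_0, …, q_{n-1}` with `deg q_j = j`, this face
has full dimension. A cone with a point outside the half-space then contains a neighbourhood, on
the far side, of every interior point of the face. Hence undistillability can be tested along any
single ray that leaves an interior point of the face towards the far side
(`wernerUndistillable_iff_ray`).

The statements on two and on `n` copies are instances of this criterion. In the normalised
coordinates and with `z = (1 + dβ) / (d/2 - 1)`, the two families of states have the enumerators
`(1 + z) (1 + εz)^(n-1) + nδz` and `(1 + z) (1 - ε + ε (1 + z)^(n-1)) + nδz`, where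
`1 + z = d/(d-2) · (1 + 2β)`. The first is interior with `q_j = (1 + β)^j`. For the second one
takes the polynomials `q_k = (1 - 1/d) (1 + β^k) + (1 + β)^k / d` of the GHZ vectors; the
coefficients of `(1 + 2β)^(n-1)` solve a triangular system with off-diagonal part of size `1/d`,
and are positive in large dimension (`coeff_pos_of_triangular`). Undistillability in a large
dimension implies it in all smaller ones (`WernerUndistillable.of_le`), which gives the statement
about all dimensions.

The bounds from below on Schmidt numbers that do not concern distillability come from the overlap
with the maximally entangled vector (`dotProduct_omegaOp_le`) and, for separability, also from the
witness at `β = -1`, which is the partial transpose of a positive operator.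
-/

namespace Distill

/-! ### Vectors of bounded Schmidt rank and their mixtures -/

section Mixtures

variable {a b a' b' : Type*}

theorem schmidtRank_kronecker_mulVec_le [Fintype a] [Fintype b] [Fintype b']
    (A : Matrix a' a ℂ) (B : Matrix b' b ℂ) (ψ : a × b → ℂ) :
    schmidtRank ((A ⊗ₖ B) *ᵥ ψ) ≤ schmidtRank ψ := by
  have h : (Matrix.of fun i j => ((A ⊗ₖ B) *ᵥ ψ) (i, j)) =
      A * (Matrix.of fun i j => ψ (i, j)) * Bᵀ := by
    ext i j
    simp only [Matrix.of_apply, Matrix.mulVec, dotProduct, Matrix.kroneckerMap_apply,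
      Matrix.mul_apply, Matrix.transpose_apply, Fintype.sum_prod_type, Finset.sum_mul]
    rw [Finset.sum_comm]
    exact Finset.sum_congr rfl fun y _ => Finset.sum_congr rfl fun x _ => by ring
  unfold schmidtRank
  rw [h]
  exact (Matrix.rank_mul_le_left _ _).trans (Matrix.rank_mul_le_right _ _)

theorem schmidtRank_comp_le [Fintype b] [Fintype b'] (f : a' → a) (g : b' → b) (ψ : a × b → ℂ) :
    schmidtRank (fun p : a' × b' => ψ (f p.1, g p.2)) ≤ schmidtRank ψ :=
  Matrix.rank_submatrix_le (Matrix.of fun i j => ψ (i, j)) f g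

theorem schmidtRank_smul_le [Fintype b] (c : ℂ) (ψ : a × b → ℂ) :
    schmidtRank (c • ψ) ≤ schmidtRank ψ := by
  classical
  have h : (Matrix.of fun i j => (c • ψ) (i, j)) =
      (Matrix.of fun i j => ψ (i, j)) * (c • (1 : Matrix b b ℂ)) := by
    ext i j; simp
  unfold schmidtRank
  rw [h]
  exact Matrix.rank_mul_le_left _ _

/-- A sum of `k` product vectors has Schmidt rank at most `k`. -/
theorem schmidtRank_le_card_of_eq_sum [Fintype b] {s : Type*} [Fintype s] {ψ : a × b → ℂ}
    (u : s → a → ℂ) (v : s → b → ℂ) (h : ∀ i j, ψ (i, j) = ∑ r, u r i * v r j) :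
    schmidtRank ψ ≤ Fintype.card s := by
  have h' : (Matrix.of fun i j => ψ (i, j)) =
      (Matrix.of fun i r => u r i) * (Matrix.of fun r j => v r j) := by
    ext i j; simp [h, Matrix.mul_apply]
  unfold schmidtRank
  rw [h']
  exact (Matrix.rank_mul_le_left _ _).trans (Matrix.rank_le_card_width _)

/-- The Schmidt rank is at least two as soon as two basis vectors on each side are correlated. -/
theorem two_le_schmidtRank [Fintype b] {ψ : a × b → ℂ} (f : Fin 2 → a) (g : Fin 2 → b)
    (h : ∀ i j, ψ (f i, g j) = if i = j then 1 else 0) : 2 ≤ schmidtRank ψ := by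
  have h' : (Matrix.of fun i j => ψ (i, j)).submatrix f g = (1 : Matrix (Fin 2) (Fin 2) ℂ) := by
    ext i j; simp [h, Matrix.one_apply]
  have := Matrix.rank_submatrix_le (Matrix.of fun i j => ψ (i, j)) f g
  rw [h', Matrix.rank_one, Fintype.card_fin] at this
  exact this

theorem star_dotProduct_mulVec_eq_trace [Fintype a] (X : Matrix a a ℂ) (ψ : a → ℂ) :
    star ψ ⬝ᵥ (X *ᵥ ψ) = (proj ψ * X).trace := by
  unfold proj
  rw [Matrix.trace_mul_comm, Matrix.mul_vecMulVec, Matrix.trace_vecMulVec, dotProduct_comm]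

theorem proj_mulVec [Fintype a] (A : Matrix a' a ℂ) (ψ : a → ℂ) :
    proj (A *ᵥ ψ) = A * proj ψ * Aᴴ := by
  unfold proj
  rw [Matrix.mul_vecMulVec, Matrix.vecMulVec_mul, Matrix.star_mulVec]

theorem star_mulVec_dotProduct [Fintype a] [Fintype a'] (A : Matrix a' a ℂ) (X : Matrix a' a' ℂ)
    (ψ : a → ℂ) :
    star (A *ᵥ ψ) ⬝ᵥ (X *ᵥ (A *ᵥ ψ)) = star ψ ⬝ᵥ ((Aᴴ * X * A) *ᵥ ψ) := by
  rw [Matrix.star_mulVec, ← Matrix.dotProduct_mulVec, Matrix.mulVec_mulVec, Matrix.mulVec_mulVec,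
    Matrix.mul_assoc]

theorem proj_smul (c : ℂ) (ψ : a → ℂ) : proj (c • ψ) = (c * star c) • proj ψ := by
  ext i j
  simp [proj, Matrix.vecMulVec_apply]
  ring

theorem proj_posSemidef [Finite a] (ψ : a → ℂ) : (proj ψ).PosSemidef :=
  Matrix.posSemidef_vecMulVec_self_star ψ

theorem isMixture_sum_proj [Fintype b] {s : Type*} [Fintype s] {k : ℕ} (v : s → a × b → ℂ)
    (h : ∀ i, schmidtRank (v i) ≤ k) : IsMixtureOfSchmidtRank k (∑ i, proj (v i)) :=
  ⟨Fintype.card s, fun i => v ((Fintype.equivFin s).symm i), fun _ => h _,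
    (Equiv.sum_comp (Fintype.equivFin s).symm fun i => proj (v i)).symm⟩

theorem isMixture_proj [Fintype b] {k : ℕ} {ψ : a × b → ℂ} (h : schmidtRank ψ ≤ k) :
    IsMixtureOfSchmidtRank k (proj ψ) := by
  simpa using isMixture_sum_proj (s := Unit) (fun _ => ψ) fun _ => h

theorem isMixture_zero [Fintype b] {k : ℕ} :
    IsMixtureOfSchmidtRank k (0 : Matrix (a × b) (a × b) ℂ) :=
  ⟨0, fun i => i.elim0, fun i => i.elim0, by simp⟩

theorem IsMixtureOfSchmidtRank.mono [Fintype b] {k l : ℕ} {X : Matrix (a × b) (a × b) ℂ}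
    (h : IsMixtureOfSchmidtRank k X) (hkl : k ≤ l) : IsMixtureOfSchmidtRank l X := by
  obtain ⟨m, v, hv, rfl⟩ := h
  exact ⟨m, v, fun i => (hv i).trans hkl, rfl⟩

theorem IsMixtureOfSchmidtRank.add [Fintype b] {k : ℕ} {X Y : Matrix (a × b) (a × b) ℂ}
    (hX : IsMixtureOfSchmidtRank k X) (hY : IsMixtureOfSchmidtRank k Y) :
    IsMixtureOfSchmidtRank k (X + Y) := by
  obtain ⟨m, v, hv, rfl⟩ := hX
  obtain ⟨m', v', hv', rfl⟩ := hY
  have := isMixture_sum_proj (k := k) (Sum.elim v v') (by rintro (i | i) <;> simp [hv, hv'])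
  simpa using this

theorem IsMixtureOfSchmidtRank.smul [Fintype b] {k : ℕ} {X : Matrix (a × b) (a × b) ℂ}
    (hX : IsMixtureOfSchmidtRank k X) {c : ℝ} (hc : 0 ≤ c) :
    IsMixtureOfSchmidtRank k ((c : ℂ) • X) := by
  obtain ⟨m, v, hv, rfl⟩ := hX
  refine ⟨m, fun i => ((Real.sqrt c : ℝ) : ℂ) • v i,
    fun i => (schmidtRank_smul_le _ _).trans (hv i), ?_⟩
  have : ((Real.sqrt c : ℝ) : ℂ) * star ((Real.sqrt c : ℝ) : ℂ) = c := by
    rw [Complex.star_def, Complex.conj_ofReal, ← Complex.ofReal_mul, Real.mul_self_sqrt hc]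
  simp_rw [proj_smul, this, Finset.smul_sum]

theorem isMixture_sum [Fintype b] {k : ℕ} {s : Type*} (t : Finset s)
    (X : s → Matrix (a × b) (a × b) ℂ) (h : ∀ i ∈ t, IsMixtureOfSchmidtRank k (X i)) :
    IsMixtureOfSchmidtRank k (∑ i ∈ t, X i) :=
  Finset.sum_induction X (IsMixtureOfSchmidtRank k) (fun _ _ h h' => h.add h') isMixture_zero h

theorem IsMixtureOfSchmidtRank.submatrix [Fintype b] [Fintype b'] {k : ℕ}
    {X : Matrix (a × b) (a × b) ℂ} (hX : IsMixtureOfSchmidtRank k X) (f : a' → a) (g : b' → b) :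
    IsMixtureOfSchmidtRank k (X.submatrix (Prod.map f g) (Prod.map f g)) := by
  obtain ⟨m, v, hv, rfl⟩ := hX
  refine ⟨m, fun i p => v i (f p.1, g p.2),
    fun i => (schmidtRank_comp_le f g _).trans (hv i), ?_⟩
  ext p q
  simp only [Matrix.submatrix_apply, Matrix.sum_apply]
  rfl

theorem IsMixtureOfSchmidtRank.posSemidef [Finite a] [Fintype b] {k : ℕ}
    {X : Matrix (a × b) (a × b) ℂ} (hX : IsMixtureOfSchmidtRank k X) : X.PosSemidef := by
  obtain ⟨m, v, -, rfl⟩ := hX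
  exact Matrix.posSemidef_sum _ fun i _ => proj_posSemidef _

theorem exists_isMixture_of_posSemidef [Finite a] [Fintype b] {X : Matrix (a × b) (a × b) ℂ}
    (hX : X.PosSemidef) : ∃ k, IsMixtureOfSchmidtRank k X := by
  obtain ⟨m, v, rfl⟩ := Matrix.posSemidef_iff_eq_sum_vecMulVec.mp hX
  exact ⟨Fintype.card b, m, v, fun _ => Matrix.rank_le_card_width _, rfl⟩

theorem IsMixtureOfSchmidtRank.schmidtNumber_le [Fintype b] {k : ℕ}
    {X : Matrix (a × b) (a × b) ℂ} (hX : IsMixtureOfSchmidtRank k X) : schmidtNumber X ≤ k :=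
  Nat.sInf_le hX

/-- For positive semidefinite operators the infimum defining the Schmidt number is attained. -/
theorem schmidtNumber_le_iff [Finite a] [Fintype b] {k : ℕ} {X : Matrix (a × b) (a × b) ℂ}
    (hX : X.PosSemidef) : schmidtNumber X ≤ k ↔ IsMixtureOfSchmidtRank k X :=
  ⟨fun h => IsMixtureOfSchmidtRank.mono
    (Nat.sInf_mem (s := {k | IsMixtureOfSchmidtRank k X}) (exists_isMixture_of_posSemidef hX)) h,
    IsMixtureOfSchmidtRank.schmidtNumber_le⟩

/-- Expectation values bounded below on vectors of Schmidt rank at most `k` are so on mixtures. -/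
theorem IsMixtureOfSchmidtRank.trace_mul_nonneg [Fintype a] [Fintype b] {k : ℕ}
    {X Y : Matrix (a × b) (a × b) ℂ} (hX : IsMixtureOfSchmidtRank k X)
    (h : ∀ ψ : a × b → ℂ, schmidtRank ψ ≤ k → 0 ≤ (star ψ ⬝ᵥ (Y *ᵥ ψ)).re) :
    0 ≤ (X * Y).trace.re := by
  obtain ⟨m, v, hv, rfl⟩ := hX
  rw [Finset.sum_mul, Matrix.trace_sum, Complex.re_sum]
  exact Finset.sum_nonneg fun i _ => by
    rw [← star_dotProduct_mulVec_eq_trace]; exact h _ (hv i)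

end Mixtures

/-! ### Compressions onto the range of a matrix of bounded rank -/

section Frames

variable {ι : Type*} [Fintype ι]

theorem exists_finrank_eq_of_le {K V : Type*} [DivisionRing K] [AddCommGroup V] [Module K V]
    [FiniteDimensional K V] (W : Submodule K V) {k : ℕ} (hW : Module.finrank K W ≤ k)
    (hk : k ≤ Module.finrank K V) : ∃ W', W ≤ W' ∧ Module.finrank K W' = k := by
  induction k, hW using Nat.le_induction with
  | base => exact ⟨W, le_rfl, rfl⟩
  | succ k hk' ih =>
    obtain ⟨W', h1, h2⟩ := ih (by omega)
    obtain ⟨x, hx⟩ := W'.exists_of_finrank_lt (by omega)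
    have hx' : x ∉ W' := fun h => hx 1 one_ne_zero (by simpa using h)
    refine ⟨W' ⊔ K ∙ x, h1.trans le_sup_left, ?_⟩
    rw [Submodule.finrank_sup_span_singleton hx', h2]

/-- A matrix of rank at most `k` is fixed by `P† P` for a `k`-row co-isometry `P`, the rows of
which form an orthonormal basis of a `k`-dimensional space containing the range. -/
theorem exists_coisometry_of_rank_le {κ : Type*} [Fintype κ] {k : ℕ} (M : Matrix ι κ ℂ)
    (hM : M.rank ≤ k) (hk : k ≤ Fintype.card ι) :
    ∃ P : Matrix (Fin k) ι ℂ, P * Pᴴ = 1 ∧ Pᴴ * P * M = M := by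
  classical
  let e := (WithLp.linearEquiv 2 ℂ (ι → ℂ)).symm
  obtain ⟨W, hW, hWk⟩ := exists_finrank_eq_of_le (k := k)
    ((LinearMap.range M.mulVecLin).map e.toLinearMap)
    (by rw [LinearEquiv.finrank_map_eq]; exact hM) (by simpa using hk)
  let u : OrthonormalBasis (Fin k) ℂ W := (stdOrthonormalBasis ℂ W).reindex (finCongr hWk)
  let P : Matrix (Fin k) ι ℂ := Matrix.of fun s i => star ((u s : EuclideanSpace ℂ ι) i)
  refine ⟨P, ?_, ?_⟩
  · ext s t
    have h := orthonormal_iff_ite.mp u.orthonormal s t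
    rw [Submodule.coe_inner, PiLp.inner_apply] at h
    simp only [Matrix.mul_apply, Matrix.conjTranspose_apply, P, Matrix.of_apply, star_star,
      Matrix.one_apply]
    rw [← h]
    exact Finset.sum_congr rfl fun i _ => by simp [mul_comm]
  · ext i j
    have hmem : e (M.col j) ∈ W := by
      refine hW ⟨M.col j, ⟨Pi.single j 1, ?_⟩, rfl⟩
      simp
    have h := congrArg (fun w : W => (w : EuclideanSpace ℂ ι) i) (u.sum_repr' ⟨e (M.col j), hmem⟩)
    simp only [Submodule.coe_sum, Submodule.coe_smul, Submodule.coe_inner, PiLp.inner_apply] at h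
    rw [Matrix.mul_assoc]
    simp only [Matrix.mul_apply, Matrix.conjTranspose_apply, P, Matrix.of_apply, star_star]
    have h3 : (e (M.col j)) i = M i j := rfl
    rw [h3] at h
    rw [← h]
    simp only [WithLp.ofLp_sum, Finset.sum_apply, WithLp.ofLp_smul, Pi.smul_apply, smul_eq_mul]
    refine Finset.sum_congr rfl fun s _ => ?_
    rw [mul_comm]
    congr 1
    refine Finset.sum_congr rfl fun l _ => ?_
    have h4 : (e (M.col j)) l = M l j := rfl
    simp [h4, mul_comm]

/-- `∑ |ii⟩⟨jj|`, the unnormalised projector onto the maximally entangled vector. -/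
def omegaOp (ι : Type*) [DecidableEq ι] : Matrix (ι × ι) (ι × ι) ℂ :=
  Matrix.of fun p q => if p.1 = p.2 ∧ q.1 = q.2 then 1 else 0

theorem dotProduct_omegaOp_mulVec [DecidableEq ι] (ψ : ι × ι → ℂ) :
    star ψ ⬝ᵥ (omegaOp ι *ᵥ ψ) = star (∑ i, ψ (i, i)) * ∑ i, ψ (i, i) := by
  have h : ∀ p : ι × ι, (omegaOp ι *ᵥ ψ) p = if p.1 = p.2 then ∑ i, ψ (i, i) else 0 := by
    intro p
    simp only [omegaOp, Matrix.mulVec, dotProduct, Matrix.of_apply, Fintype.sum_prod_type]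
    split_ifs with hp <;> simp [hp]
  simp only [dotProduct, h, Fintype.sum_prod_type, Pi.star_apply, star_sum, Finset.sum_mul]
  simp

theorem normSq_sum_mul_le {s : Type*} [Fintype s] (f g : s → ℂ) :
    ‖∑ i, f i * g i‖ ^ 2 ≤ (∑ i, ‖f i‖ ^ 2) * ∑ i, ‖g i‖ ^ 2 := by
  have h1 : ‖∑ i, f i * g i‖ ≤ ∑ i, ‖f i‖ * ‖g i‖ :=
    (norm_sum_le _ _).trans (le_of_eq (by simp))
  exact (pow_le_pow_left₀ (norm_nonneg _) h1 2).trans (Finset.sum_mul_sq_le_sq_mul_sq _ _ _)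

/-- A vector of Schmidt rank at most `k` has overlap at most `k / card ι` with the maximally
entangled state: with `Π` a rank-`k` projector onto a space containing the range of the coefficient
matrix `M`, Cauchy–Schwarz gives `|tr M|² = |tr (Π M)|² ≤ tr Π ‖M‖²`. -/
theorem normSq_trace_le_of_schmidtRank_le {k : ℕ} (hk : k ≤ Fintype.card ι) (ψ : ι × ι → ℂ)
    (hψ : schmidtRank ψ ≤ k) : ‖∑ i, ψ (i, i)‖ ^ 2 ≤ k * ∑ p, ‖ψ p‖ ^ 2 := by
  set M : Matrix ι ι ℂ := Matrix.of fun i j => ψ (i, j) with hM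
  obtain ⟨P, hP, hPM⟩ := exists_coisometry_of_rank_le M hψ hk
  have h1 : ∑ i, ψ (i, i) = ∑ p : ι × ι, (Pᴴ * P) p.2 p.1 * ψ p := by
    calc ∑ i, ψ (i, i) = M.trace := rfl
      _ = (Pᴴ * P * M).trace := by rw [hPM]
      _ = _ := by
        simp only [Matrix.trace, Matrix.diag_apply, Matrix.mul_apply (M := Pᴴ * P),
          Fintype.sum_prod_type, hM, Matrix.of_apply]
        rw [Finset.sum_comm]
  have h2 : ∑ p : ι × ι, ‖(Pᴴ * P) p.2 p.1‖ ^ 2 = k := by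
    have h3 : ((∑ p : ι × ι, ‖(Pᴴ * P) p.2 p.1‖ ^ 2 : ℝ) : ℂ) = k := by
      calc ((∑ p : ι × ι, ‖(Pᴴ * P) p.2 p.1‖ ^ 2 : ℝ) : ℂ)
          = ((Pᴴ * P)ᴴ * (Pᴴ * P)).trace := by
            push_cast
            simp only [Matrix.trace, Matrix.diag_apply, Matrix.mul_apply (M := (Pᴴ * P)ᴴ),
              Fintype.sum_prod_type, Matrix.conjTranspose_apply]
            refine Finset.sum_congr rfl fun i _ => Finset.sum_congr rfl fun j _ => ?_
            rw [← Complex.conj_mul']; rfl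
        _ = (P * Pᴴ * (P * Pᴴ)).trace := by
            rw [Matrix.conjTranspose_mul, Matrix.conjTranspose_conjTranspose, Matrix.mul_assoc,
              Matrix.trace_mul_comm]
            simp only [Matrix.mul_assoc]
        _ = k := by rw [hP]; simp
    exact_mod_cast h3
  rw [h1, ← h2]
  exact normSq_sum_mul_le _ _

theorem star_dotProduct_self {s : Type*} [Fintype s] (ψ : s → ℂ) :
    star ψ ⬝ᵥ ψ = ((∑ p, ‖ψ p‖ ^ 2 : ℝ) : ℂ) := by
  push_cast
  exact Finset.sum_congr rfl fun p _ => Complex.conj_mul' _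

theorem dotProduct_omegaOp_le [DecidableEq ι] {k : ℕ} (hk : k ≤ Fintype.card ι) (ψ : ι × ι → ℂ)
    (hψ : schmidtRank ψ ≤ k) :
    (star ψ ⬝ᵥ (omegaOp ι *ᵥ ψ)).re ≤ k * (star ψ ⬝ᵥ ψ).re := by
  have := normSq_trace_le_of_schmidtRank_le hk ψ hψ
  rw [dotProduct_omegaOp_mulVec, star_dotProduct_self, Complex.ofReal_re, Complex.star_def,
    Complex.conj_mul']
  exact_mod_cast this

theorem IsMixtureOfSchmidtRank.trace_mul_omegaOp_le [DecidableEq ι] {k : ℕ}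
    (hk : k ≤ Fintype.card ι)
    {X : Matrix (ι × ι) (ι × ι) ℂ} (hX : IsMixtureOfSchmidtRank k X) :
    (X * omegaOp ι).trace.re ≤ k * X.trace.re := by
  have := hX.trace_mul_nonneg (Y := (k : ℂ) • 1 - omegaOp ι) fun ψ hψ => by
    have := dotProduct_omegaOp_le hk ψ hψ
    rw [Matrix.sub_mulVec, dotProduct_sub, Matrix.smul_mulVec, Matrix.one_mulVec, dotProduct_smul,
      Complex.sub_re, smul_eq_mul, ← Complex.ofReal_natCast,
      Complex.re_ofReal_mul]
    linarith
  rw [Matrix.mul_sub, Matrix.trace_sub, Matrix.mul_smul, Matrix.trace_smul, Matrix.mul_one,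
    Complex.sub_re, smul_eq_mul, ← Complex.ofReal_natCast,
      Complex.re_ofReal_mul] at this
  linarith

end Frames

/-! ### Tensor products over the copies -/

section Tensor

variable {n d : ℕ}

theorem sum_idx_prod (g : Fin n → Fin d × Fin d → ℂ) :
    ∑ p : Idx n d, ∏ i, g i (p.1 i, p.2 i) = ∏ i, ∑ x, g i x := by
  rw [Finset.prod_univ_sum, Fintype.piFinset_univ,
    ← Equiv.sum_comp (Equiv.arrowProdEquivProdArrow (Fin n) (fun _ => Fin d) (fun _ => Fin d))]
  rfl

theorem tensorOp_mul (X Y : Fin n → Matrix (Fin d × Fin d) (Fin d × Fin d) ℂ) :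
    tensorOp X * tensorOp Y = tensorOp fun i => X i * Y i := by
  ext p q
  simp only [tensorOp, Matrix.mul_apply, Matrix.of_apply, ← Finset.prod_mul_distrib]
  exact sum_idx_prod fun i x => X i (p.1 i, p.2 i) x * Y i x (q.1 i, q.2 i)

theorem tensorOp_conjTranspose (X : Fin n → Matrix (Fin d × Fin d) (Fin d × Fin d) ℂ) :
    (tensorOp X)ᴴ = tensorOp fun i => (X i)ᴴ := by
  ext p q
  simp [tensorOp]

theorem trace_tensorOp (X : Fin n → Matrix (Fin d × Fin d) (Fin d × Fin d) ℂ) :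
    (tensorOp X).trace = ∏ i, (X i).trace :=
  sum_idx_prod fun i x => X i x x

theorem tensorOp_one : tensorOp (fun _ : Fin n => (1 : Matrix (Fin d × Fin d) _ ℂ)) = 1 := by
  ext p q
  simp only [tensorOp, Matrix.of_apply, Matrix.one_apply, Prod.mk.injEq]
  simp [Finset.prod_ite_zero, Prod.ext_iff, funext_iff, forall_and]

theorem tensorOp_mulVec_tensorVec (X : Fin n → Matrix (Fin d × Fin d) (Fin d × Fin d) ℂ)
    (φ : Fin n → Fin d × Fin d → ℂ) :
    tensorOp X *ᵥ tensorVec φ = tensorVec fun i => X i *ᵥ φ i := by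
  ext p
  simp only [tensorOp, tensorVec, Matrix.mulVec, dotProduct, Matrix.of_apply,
    ← Finset.prod_mul_distrib]
  exact sum_idx_prod fun i x => X i (p.1 i, p.2 i) x * φ i x

theorem star_tensorVec_dotProduct (φ φ' : Fin n → Fin d × Fin d → ℂ) :
    star (tensorVec φ) ⬝ᵥ tensorVec φ' = ∏ i, star (φ i) ⬝ᵥ φ' i := by
  simp only [tensorVec, dotProduct, Pi.star_apply, star_prod, ← Finset.prod_mul_distrib]
  exact sum_idx_prod fun i x => star (φ i x) * φ' i x

/-- The tensor product, over the copies, of operators of a single party. -/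
def partyOp (A : Fin n → Matrix (Fin d) (Fin d) ℂ) : Matrix (Fin n → Fin d) (Fin n → Fin d) ℂ :=
  Matrix.of fun a b => ∏ i, A i (a i) (b i)

theorem tensorOp_kronecker (A B : Fin n → Matrix (Fin d) (Fin d) ℂ) :
    tensorOp (fun i => A i ⊗ₖ B i) = partyOp A ⊗ₖ partyOp B := by
  ext p q
  simp [tensorOp, partyOp, Finset.prod_mul_distrib]

theorem tensorOp_omegaOp :
    tensorOp (fun _ : Fin n => omegaOp (Fin d)) = omegaOp (Fin n → Fin d) := by
  ext p q
  simp only [tensorOp, omegaOp, Matrix.of_apply]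
  simp [Finset.prod_ite_zero, funext_iff, forall_and]

theorem tensorOp_congr {X Y : Fin n → Matrix (Fin d × Fin d) (Fin d × Fin d) ℂ}
    (h : ∀ i, X i = Y i) : tensorOp X = tensorOp Y := by rw [funext h]

/-- `tensorOp` is additive in each factor. -/
theorem tensorOp_update_add (X : Fin n → Matrix (Fin d × Fin d) (Fin d × Fin d) ℂ) (i : Fin n)
    (Y Z : Matrix (Fin d × Fin d) (Fin d × Fin d) ℂ) :
    tensorOp (Function.update X i (Y + Z)) =
      tensorOp (Function.update X i Y) + tensorOp (Function.update X i Z) := by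
  ext p q
  simp only [tensorOp, Matrix.of_apply, Matrix.add_apply]
  rw [← Finset.mul_prod_erase _ _ (Finset.mem_univ i), ← Finset.mul_prod_erase _ _
    (Finset.mem_univ i), ← Finset.mul_prod_erase Finset.univ (fun j => Function.update X i Z j _ _)
    (Finset.mem_univ i)]
  simp only [Function.update_self, Matrix.add_apply, add_mul]
  congr 2 <;>
  · refine Finset.prod_congr rfl fun j hj => ?_
    rw [Function.update_of_ne (Finset.ne_of_mem_erase hj),
      Function.update_of_ne (Finset.ne_of_mem_erase hj)]

theorem tensorOp_update_smul (X : Fin n → Matrix (Fin d × Fin d) (Fin d × Fin d) ℂ) (i : Fin n)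
    (c : ℂ) (Y : Matrix (Fin d × Fin d) (Fin d × Fin d) ℂ) :
    tensorOp (Function.update X i (c • Y)) = c • tensorOp (Function.update X i Y) := by
  ext p q
  simp only [tensorOp, Matrix.of_apply, Matrix.smul_apply]
  rw [← Finset.mul_prod_erase _ _ (Finset.mem_univ i), ← Finset.mul_prod_erase _ _
    (Finset.mem_univ i)]
  simp only [Function.update_self, Matrix.smul_apply, smul_eq_mul, mul_assoc]
  congr 2
  refine Finset.prod_congr rfl fun j hj => ?_
  rw [Function.update_of_ne (Finset.ne_of_mem_erase hj),
    Function.update_of_ne (Finset.ne_of_mem_erase hj)]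

/-! ### Permutations of the pairs -/

/-- The action of a permutation of the copies on basis labels. -/
def idxPerm (d : ℕ) (σ : Equiv.Perm (Fin n)) : Idx n d ≃ Idx n d where
  toFun p := (p.1 ∘ σ, p.2 ∘ σ)
  invFun p := (p.1 ∘ σ.symm, p.2 ∘ σ.symm)
  left_inv p := by simp [Function.comp_assoc]
  right_inv p := by simp [Function.comp_assoc]

theorem permutePairs_eq (σ : Equiv.Perm (Fin n)) (X : Matrix (Idx n d) (Idx n d) ℂ) :
    permutePairs σ X = X.submatrix (idxPerm d σ) (idxPerm d σ) := rfl

theorem permutePairs_mul (σ : Equiv.Perm (Fin n)) (X Y : Matrix (Idx n d) (Idx n d) ℂ) :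
    permutePairs σ (X * Y) = permutePairs σ X * permutePairs σ Y := by
  simp only [permutePairs_eq, Matrix.submatrix_mul_equiv]

theorem permutePairs_conjTranspose (σ : Equiv.Perm (Fin n)) (X : Matrix (Idx n d) (Idx n d) ℂ) :
    permutePairs σ Xᴴ = (permutePairs σ X)ᴴ := rfl

theorem trace_permutePairs (σ : Equiv.Perm (Fin n)) (X : Matrix (Idx n d) (Idx n d) ℂ) :
    (permutePairs σ X).trace = X.trace :=
  Equiv.sum_comp (idxPerm d σ) fun p => X p p

theorem permutePairs_tensorOp (σ : Equiv.Perm (Fin n))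
    (X : Fin n → Matrix (Fin d × Fin d) (Fin d × Fin d) ℂ) :
    permutePairs σ (tensorOp X) = tensorOp fun i => X (σ.symm i) := by
  ext p q
  simp only [permutePairs, tensorOp, Matrix.submatrix_apply, Matrix.of_apply, Function.comp_apply]
  refine (Equiv.prod_comp σ _).symm.trans (Finset.prod_congr rfl fun i _ => ?_) |>.symm
  simp

/-! ### Conjugation by local unitaries -/

theorem localUnitary_mul (U V : Matrix.unitaryGroup (Fin d) ℂ) :
    localUnitary (U * V) = localUnitary U * localUnitary V := by
  rw [localUnitary, localUnitary, localUnitary, ← Matrix.mul_kronecker_mul]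
  congr 1
  ext i j
  simp [Matrix.mul_apply]

theorem localUnitary_conjTranspose_mul (U : Matrix.unitaryGroup (Fin d) ℂ) :
    (localUnitary U)ᴴ * localUnitary U = 1 := by
  have h : (U : Matrix (Fin d) (Fin d) ℂ)ᴴ * U = 1 := Matrix.mem_unitaryGroup_iff'.mp U.2
  have h' : ((U : Matrix (Fin d) (Fin d) ℂ).map star)ᴴ * (U : Matrix (Fin d) (Fin d) ℂ).map star
      = 1 := by
    ext i j
    have := congrArg star (congrFun (congrFun h i) j)
    simpa [Matrix.mul_apply, Matrix.one_apply, apply_ite] using this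
  rw [localUnitary, Matrix.conjTranspose_kronecker, ← Matrix.mul_kronecker_mul, h, h',
    Matrix.one_kronecker_one]

/-- `U ⊗ U*` fixes the maximally entangled vector. -/
theorem localUnitary_mul_omegaOp (U : Matrix.unitaryGroup (Fin d) ℂ) :
    localUnitary U * omegaOp (Fin d) = omegaOp (Fin d) := by
  have h : (U : Matrix (Fin d) (Fin d) ℂ) * (U : Matrix (Fin d) (Fin d) ℂ)ᴴ = 1 :=
    Matrix.mem_unitaryGroup_iff.mp U.2
  ext p q
  have h' := congrFun (congrFun h p.1) p.2
  simp only [Matrix.mul_apply, Matrix.conjTranspose_apply] at h'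
  by_cases hq : q.1 = q.2
  · simpa [localUnitary, omegaOp, Matrix.mul_apply, Fintype.sum_prod_type, hq,
      Matrix.one_apply] using h'
  · simp [omegaOp, Matrix.mul_apply, hq]

theorem omegaOp_conjTranspose : (omegaOp (Fin d))ᴴ = omegaOp (Fin d) := by
  ext p q
  simp [omegaOp, apply_ite, and_comm]

theorem localUnitary_conj_omegaOp (U : Matrix.unitaryGroup (Fin d) ℂ) :
    localUnitary U * omegaOp (Fin d) * (localUnitary U)ᴴ = omegaOp (Fin d) := by
  rw [localUnitary_mul_omegaOp, ← omegaOp_conjTranspose, ← Matrix.conjTranspose_mul,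
    localUnitary_mul_omegaOp]

theorem localUnitary_mul_conjTranspose (U : Matrix.unitaryGroup (Fin d) ℂ) :
    localUnitary U * (localUnitary U)ᴴ = 1 :=
  mul_eq_one_comm.mp (localUnitary_conjTranspose_mul U)

theorem conjLocal_mul (U V : Fin n → Matrix.unitaryGroup (Fin d) ℂ)
    (X : Matrix (Idx n d) (Idx n d) ℂ) : conjLocal (U * V) X = conjLocal U (conjLocal V X) := by
  have : tensorOp (fun i => localUnitary ((U * V) i)) =
      tensorOp (fun i => localUnitary (U i)) * tensorOp fun i => localUnitary (V i) := by
    rw [tensorOp_mul]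
    exact tensorOp_congr fun i => localUnitary_mul _ _
  simp only [conjLocal, this, Matrix.conjTranspose_mul, Matrix.mul_assoc]

theorem conjLocal_tensorOp (U : Fin n → Matrix.unitaryGroup (Fin d) ℂ)
    (X : Fin n → Matrix (Fin d × Fin d) (Fin d × Fin d) ℂ) :
    conjLocal U (tensorOp X) =
      tensorOp fun i => localUnitary (U i) * X i * (localUnitary (U i))ᴴ := by
  rw [conjLocal, tensorOp_conjTranspose, tensorOp_mul, tensorOp_mul]

theorem tensorOp_localUnitary_conjTranspose_mul (U : Fin n → Matrix.unitaryGroup (Fin d) ℂ) :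
    (tensorOp fun i => localUnitary (U i))ᴴ * (tensorOp fun i => localUnitary (U i)) = 1 := by
  rw [tensorOp_conjTranspose, tensorOp_mul, ← tensorOp_one]
  exact tensorOp_congr fun i => localUnitary_conjTranspose_mul _

theorem trace_conjLocal (U : Fin n → Matrix.unitaryGroup (Fin d) ℂ)
    (X : Matrix (Idx n d) (Idx n d) ℂ) : (conjLocal U X).trace = X.trace := by
  rw [conjLocal, Matrix.mul_assoc, Matrix.trace_mul_comm, Matrix.mul_assoc,
    tensorOp_localUnitary_conjTranspose_mul, Matrix.mul_one]

theorem conjLocal_mul_conjLocal (U : Fin n → Matrix.unitaryGroup (Fin d) ℂ)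
    (X Y : Matrix (Idx n d) (Idx n d) ℂ) :
    conjLocal U X * conjLocal U Y = conjLocal U (X * Y) := by
  have h := tensorOp_localUnitary_conjTranspose_mul U
  simp only [conjLocal, Matrix.mul_assoc]
  rw [← Matrix.mul_assoc (tensorOp _)ᴴ (tensorOp _), h, Matrix.one_mul]

theorem permutePairs_conjLocal (σ : Equiv.Perm (Fin n))
    (U : Fin n → Matrix.unitaryGroup (Fin d) ℂ) (X : Matrix (Idx n d) (Idx n d) ℂ) :
    permutePairs σ (conjLocal U X) = conjLocal (fun i => U (σ.symm i)) (permutePairs σ X) := by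
  rw [conjLocal, conjLocal, permutePairs_mul, permutePairs_mul, permutePairs_conjTranspose,
    permutePairs_tensorOp]

theorem conjLocal_add (U : Fin n → Matrix.unitaryGroup (Fin d) ℂ)
    (X Y : Matrix (Idx n d) (Idx n d) ℂ) :
    conjLocal U (X + Y) = conjLocal U X + conjLocal U Y := by
  simp [conjLocal, Matrix.mul_add, Matrix.add_mul]

theorem conjLocal_smul (U : Fin n → Matrix.unitaryGroup (Fin d) ℂ) (c : ℂ)
    (X : Matrix (Idx n d) (Idx n d) ℂ) : conjLocal U (c • X) = c • conjLocal U X := by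
  simp [conjLocal]

theorem IsUUFInvariant.add {X Y : Matrix (Idx n d) (Idx n d) ℂ} (hX : IsUUFInvariant X)
    (hY : IsUUFInvariant Y) : IsUUFInvariant (X + Y) :=
  ⟨fun U => by rw [conjLocal_add, hX.1, hY.1],
    fun σ => (congrArg₂ (· + ·) (hX.2 σ) (hY.2 σ) : _)⟩

theorem IsUUFInvariant.smul {X : Matrix (Idx n d) (Idx n d) ℂ} (hX : IsUUFInvariant X) (c : ℂ) :
    IsUUFInvariant (c • X) :=
  ⟨fun U => by rw [conjLocal_smul, hX.1], fun σ => (congrArg (c • ·) (hX.2 σ) : _)⟩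

theorem isUUFInvariant_zero : IsUUFInvariant (0 : Matrix (Idx n d) (Idx n d) ℂ) :=
  ⟨fun U => by simp [conjLocal], fun _ => rfl⟩

theorem isUUFInvariant_sum {s : Type*} (t : Finset s) (X : s → Matrix (Idx n d) (Idx n d) ℂ)
    (h : ∀ i ∈ t, IsUUFInvariant (X i)) : IsUUFInvariant (∑ i ∈ t, X i) :=
  Finset.sum_induction X IsUUFInvariant (fun _ _ h h' => h.add h') isUUFInvariant_zero h

/-! ### The twirl -/

instance instSecondCountableUnitary (d : ℕ) :
    SecondCountableTopology (Matrix.unitaryGroup (Fin d) ℂ) :=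
  haveI : SecondCountableTopology (Matrix (Fin d) (Fin d) ℂ) :=
    inferInstanceAs (SecondCountableTopology (Fin d → Fin d → ℂ))
  TopologicalSpace.Subtype.secondCountableTopology
    {U : Matrix (Fin d) (Fin d) ℂ | U ∈ Matrix.unitaryGroup (Fin d) ℂ}

instance instIsProbabilityHaarUnitary (d : ℕ) : IsProbabilityMeasure (haarUnitary d) :=
  ⟨Measure.haarMeasure_self (K₀ := ⊤)⟩

instance instIsHaarUnitary (d : ℕ) : (haarUnitary d).IsMulLeftInvariant := by
  unfold haarUnitary
  infer_instance

theorem continuous_conjLocal (X : Matrix (Idx n d) (Idx n d) ℂ) :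
    Continuous fun U : Fin n → Matrix.unitaryGroup (Fin d) ℂ => conjLocal U X := by
  have h : ∀ i : Fin n, ∀ a b, Continuous fun U : Fin n → Matrix.unitaryGroup (Fin d) ℂ =>
      (U i : Matrix (Fin d) (Fin d) ℂ) a b := fun i a b =>
    (Continuous.subtype_val (continuous_apply i)).matrix_elem a b
  have h' : Continuous fun U : Fin n → Matrix.unitaryGroup (Fin d) ℂ =>
      tensorOp fun i => localUnitary (U i) := by
    refine continuous_matrix fun p q => ?_
    simp only [tensorOp, localUnitary, Matrix.of_apply, Matrix.kroneckerMap_apply,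
      Matrix.map_apply]
    exact continuous_finsetProd _ fun i _ => (h i _ _).mul (h i _ _).star
  exact (h'.matrix_mul continuous_const).matrix_mul h'.matrix_conjTranspose

theorem continuous_permutePairs_conjLocal (σ : Equiv.Perm (Fin n))
    (X : Matrix (Idx n d) (Idx n d) ℂ) :
    Continuous fun U : Fin n → Matrix.unitaryGroup (Fin d) ℂ => permutePairs σ (conjLocal U X) :=
  continuous_matrix fun _ _ => (continuous_conjLocal X).matrix_elem _ _

theorem integrable_of_continuous {E : Type*} [NormedAddCommGroup E] [SecondCountableTopology E]
    {f : (Fin n → Matrix.unitaryGroup (Fin d) ℂ) → E} (hf : Continuous f) :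
    Integrable f (Measure.pi fun _ : Fin n => haarUnitary d) := by
  borelize E
  exact hf.integrable_of_hasCompactSupport (HasCompactSupport.of_compactSpace f)

/-- The average over the local unitaries alone, followed by one permutation of the pairs. -/
noncomputable def haarTwirl (σ : Equiv.Perm (Fin n)) (X : Matrix (Idx n d) (Idx n d) ℂ) :
    Matrix (Idx n d) (Idx n d) ℂ :=
  Matrix.of fun p q =>
    ∫ U, permutePairs σ (conjLocal U X) p q ∂(Measure.pi fun _ : Fin n => haarUnitary d)

theorem twirl_eq (X : Matrix (Idx n d) (Idx n d) ℂ) :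
    twirl X = (1 / (n.factorial : ℂ)) • ∑ σ : Equiv.Perm (Fin n), haarTwirl σ X := by
  ext p q
  simp [twirl, haarTwirl, Matrix.sum_apply]

/-- Linear functionals may be exchanged with an entrywise integral. -/
theorem trace_integral_mul {G a : Type*} [MeasurableSpace G] [Fintype a] {μ : Measure G}
    {F : G → Matrix a a ℂ} (hF : ∀ p q, Integrable (fun U => F U p q) μ) (Y : Matrix a a ℂ) :
    ((Matrix.of fun p q => ∫ U, F U p q ∂μ) * Y).trace = ∫ U, (F U * Y).trace ∂μ := by
  simp only [Matrix.trace, Matrix.diag_apply, Matrix.mul_apply, Matrix.of_apply]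
  refine Eq.symm ((integral_finsetSum _ fun p _ => integrable_finsetSum _ fun q _ =>
    (hF p q).mul_const _).trans (Finset.sum_congr rfl fun p _ => ?_))
  refine (integral_finsetSum _ fun q _ => (hF p q).mul_const _).trans
    (Finset.sum_congr rfl fun q _ => ?_)
  exact integral_mul_const _ _

theorem mul_integral_mul {G a : Type*} [MeasurableSpace G] [Fintype a] [DecidableEq a]
    {μ : Measure G} {F : G → Matrix a a ℂ} (hF : ∀ p q, Integrable (fun U => F U p q) μ)
    (A B : Matrix a a ℂ) (p q : a) :
    (A * (Matrix.of fun p q => ∫ U, F U p q ∂μ) * B) p q = ∫ U, (A * F U * B) p q ∂μ := by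
  have key : ∀ Z : Matrix a a ℂ, (A * Z * B) p q = (Z * (B * Matrix.single q p 1 * A)).trace := by
    intro Z
    rw [← Matrix.mul_assoc, ← Matrix.mul_assoc, Matrix.trace_mul_comm, ← Matrix.mul_assoc,
      ← Matrix.mul_assoc, Matrix.trace_mul_single]
    simp
  rw [key, trace_integral_mul hF]
  simp only [← key]

theorem integrable_permutePairs_conjLocal (σ : Equiv.Perm (Fin n))
    (X : Matrix (Idx n d) (Idx n d) ℂ) (p q : Idx n d) :
    Integrable (fun U => permutePairs σ (conjLocal U X) p q)
      (Measure.pi fun _ : Fin n => haarUnitary d) :=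
  integrable_of_continuous ((continuous_permutePairs_conjLocal σ X).matrix_elem p q)

theorem trace_haarTwirl_mul_of_invariant (σ : Equiv.Perm (Fin n))
    (X : Matrix (Idx n d) (Idx n d) ℂ) {Y : Matrix (Idx n d) (Idx n d) ℂ}
    (hY : IsUUFInvariant Y) : (haarTwirl σ X * Y).trace = (X * Y).trace := by
  rw [haarTwirl, trace_integral_mul (integrable_permutePairs_conjLocal σ X)]
  have : ∀ U, (permutePairs σ (conjLocal U X) * Y).trace = (X * Y).trace := fun U => by
    conv_lhs => rw [← hY.2 σ, ← permutePairs_mul, trace_permutePairs, ← hY.1 U,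
      conjLocal_mul_conjLocal, trace_conjLocal]
  simp [this]

theorem trace_twirl_mul (X : Matrix (Idx n d) (Idx n d) ℂ) {Y : Matrix (Idx n d) (Idx n d) ℂ}
    (hY : IsUUFInvariant Y) : (twirl X * Y).trace = (X * Y).trace := by
  have : (n.factorial : ℂ) ≠ 0 := by exact_mod_cast n.factorial_ne_zero
  rw [twirl_eq, Matrix.smul_mul, Matrix.trace_smul, Finset.sum_mul, Matrix.trace_sum]
  simp [trace_haarTwirl_mul_of_invariant _ _ hY, Fintype.card_perm, this]

/-- The twirl is invariant, by left invariance of the Haar measure. -/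
theorem conjLocal_haarTwirl (V : Fin n → Matrix.unitaryGroup (Fin d) ℂ) (σ : Equiv.Perm (Fin n))
    (X : Matrix (Idx n d) (Idx n d) ℂ) : conjLocal V (haarTwirl σ X) = haarTwirl σ X := by
  ext p q
  rw [conjLocal, haarTwirl, mul_integral_mul (integrable_permutePairs_conjLocal σ X)]
  have : ∀ U, conjLocal V (permutePairs σ (conjLocal U X)) =
      permutePairs σ (conjLocal ((fun i => V (σ i)) * U) X) := fun U => by
    rw [conjLocal_mul, permutePairs_conjLocal (U := fun i => V (σ i))]
    simp
  refine (integral_congr_ae (Filter.Eventually.of_forall fun U =>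
    congrFun (congrFun (this U) p) q)).trans ?_
  exact integral_mul_left_eq_self
    (fun U : Fin n → Matrix.unitaryGroup (Fin d) ℂ => permutePairs σ (conjLocal U X) p q) _

theorem isUUFInvariant_twirl (X : Matrix (Idx n d) (Idx n d) ℂ) : IsUUFInvariant (twirl X) := by
  rw [twirl_eq]
  constructor
  · intro U
    rw [conjLocal_smul]
    congr 1
    refine Eq.trans ?_ (Finset.sum_congr rfl fun σ _ => conjLocal_haarTwirl U σ X)
    simp only [conjLocal, Finset.mul_sum, Finset.sum_mul]
  · intro τ
    have : permutePairs τ ((1 / (n.factorial : ℂ)) • ∑ σ : Equiv.Perm (Fin n), haarTwirl σ X) =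
        (1 / (n.factorial : ℂ)) • ∑ σ : Equiv.Perm (Fin n), haarTwirl (τ * σ) X := by
      ext p q
      simp only [permutePairs, Matrix.submatrix_apply, Matrix.smul_apply, Matrix.sum_apply]
      rfl
    rw [this]
    congr 1
    exact Equiv.sum_comp (Equiv.mulLeft τ) fun σ => haarTwirl σ X

end Tensor

/-! ### Twirls of projectors as finite mixtures -/

/-- In finite dimension the convex hull of a compact set is compact: by Carathéodory it is the
image of a compact set of weights and points. -/
theorem isCompact_convexHull_of_finiteDimensional {E : Type*} [NormedAddCommGroup E]
    [NormedSpace ℝ E] [FiniteDimensional ℝ E] {K : Set E} (hK : IsCompact K) :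
    IsCompact (convexHull ℝ K) := by
  let N := Module.finrank ℝ E + 1
  let f : (Fin N → ℝ) × (Fin N → E) → E := fun x => ∑ i, x.1 i • x.2 i
  have hf : Continuous f := by fun_prop
  have himage : convexHull ℝ K = f '' (stdSimplex ℝ (Fin N) ×ˢ Set.pi Set.univ fun _ => K) := by
    apply Set.Subset.antisymm
    · intro x hx
      obtain ⟨ι, _, z, w, hz, hai, hw, hw1, rfl⟩ := eq_pos_convex_span_of_mem_convexHull hx
      have hcard : Fintype.card ι ≤ N := by
        refine hai.card_le_finrank_succ.trans ?_
        exact Nat.succ_le_succ (Submodule.finrank_le _)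
      let e : ι ↪ Fin N := (Fintype.equivFin ι).toEmbedding.trans (Fin.castLEEmb hcard)
      have hne : Nonempty ι := by
        by_contra h
        rw [not_nonempty_iff] at h
        simp at hw1
      refine ⟨(Function.extend e w fun _ => 0, Function.extend e z fun _ => z hne.some),
        ⟨⟨?_, ?_⟩, ?_⟩, ?_⟩
      · intro j
        by_cases hj : ∃ i, e i = j
        · obtain ⟨i, rfl⟩ := hj
          exact (hw i).le.trans_eq (e.injective.extend_apply w (fun _ => 0) i).symm
        · exact (Function.extend_apply' w (fun _ => 0) j hj).ge
      · exact (Fintype.sum_of_injective e e.injective w _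
          (fun j hj => Function.extend_apply' w (fun _ => 0) j hj)
          fun i => (e.injective.extend_apply w (fun _ => 0) i).symm).symm.trans hw1
      · intro j _
        by_cases hj : ∃ i, e i = j
        · obtain ⟨i, rfl⟩ := hj
          simp only [e.injective.extend_apply]
          exact hz ⟨i, rfl⟩
        · simp only [Function.extend_apply' _ _ _ hj]
          exact hz ⟨_, rfl⟩
      · refine (Fintype.sum_of_injective e e.injective _ _ (fun j hj => ?_) fun i => ?_).symm
        · simp [Function.extend_apply' w (fun _ => 0) j (by simpa using hj)]
        · simp [e.injective.extend_apply]
    · rintro _ ⟨⟨w, z⟩, ⟨⟨hw, hw1⟩, hz⟩, rfl⟩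
      exact (convex_convexHull ℝ K).sum_mem (fun i _ => hw i) hw1
        fun i _ => subset_convexHull ℝ K (hz i trivial)
  rw [himage]
  exact ((isCompact_stdSimplex ℝ (Fin N)).prod (isCompact_univ_pi fun _ => hK)).image hf

section TwirlMixture

variable {n d : ℕ}

theorem conjLocal_proj (U : Fin n → Matrix.unitaryGroup (Fin d) ℂ) (ψ : Idx n d → ℂ) :
    conjLocal U (proj ψ) = proj (tensorOp (fun i => localUnitary (U i)) *ᵥ ψ) :=
  (proj_mulVec _ _).symm

theorem isMixture_permutePairs_conjLocal_proj {k : ℕ} {ψ : Idx n d → ℂ}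
    (hψ : schmidtRank ψ ≤ k) (σ : Equiv.Perm (Fin n))
    (U : Fin n → Matrix.unitaryGroup (Fin d) ℂ) :
    IsMixtureOfSchmidtRank k (permutePairs σ (conjLocal U (proj ψ))) := by
  refine IsMixtureOfSchmidtRank.submatrix (f := fun a => a ∘ σ) (g := fun a => a ∘ σ) ?_
  rw [conjLocal_proj]
  refine isMixture_proj (le_trans ?_ hψ)
  simp only [localUnitary, tensorOp_kronecker]
  exact schmidtRank_kronecker_mulVec_le _ _ _

/-- The Haar average lies in the convex hull of the orbit, which is compact, so that the average is
a finite mixture. -/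
theorem isMixture_haarTwirl_proj {k : ℕ} {ψ : Idx n d → ℂ} (hψ : schmidtRank ψ ≤ k)
    (σ : Equiv.Perm (Fin n)) : IsMixtureOfSchmidtRank k (haarTwirl σ (proj ψ)) := by
  let F : (Fin n → Matrix.unitaryGroup (Fin d) ℂ) → (Idx n d → Idx n d → ℂ) :=
    fun U => permutePairs σ (conjLocal U (proj ψ))
  have hF : Continuous F := continuous_permutePairs_conjLocal σ (proj ψ)
  have hK : IsCompact (convexHull ℝ (Set.range F)) :=
    isCompact_convexHull_of_finiteDimensional (isCompact_range hF)
  have hmem := (convex_convexHull ℝ (Set.range F)).integral_mem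
    (μ := Measure.pi fun _ : Fin n => haarUnitary d) hK.isClosed
    (Filter.Eventually.of_forall fun U => subset_convexHull ℝ _ ⟨U, rfl⟩)
    (integrable_of_continuous hF)
  have hconv : Convex ℝ {X : Idx n d → Idx n d → ℂ | IsMixtureOfSchmidtRank k (Matrix.of X)} := by
    intro X hX Y hY s t hs ht _
    have h := (IsMixtureOfSchmidtRank.smul hX hs).add (IsMixtureOfSchmidtRank.smul hY ht)
    rwa [show (s : ℂ) • Matrix.of X + (t : ℂ) • Matrix.of Y = Matrix.of (s • X + t • Y) by
      ext p q; simp] at h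
  have hsub := convexHull_min (s := Set.range F) (by
    rintro _ ⟨U, rfl⟩
    exact isMixture_permutePairs_conjLocal_proj hψ σ U) hconv
  have hmix : IsMixtureOfSchmidtRank k (Matrix.of _) := hsub hmem
  convert hmix using 1
  ext p q
  simp only [haarTwirl, Matrix.of_apply]
  have hF' : ∀ p, Continuous fun U => F U p := fun p => (continuous_apply p).comp hF
  have h1 := eval_integral (μ := Measure.pi fun _ : Fin n => haarUnitary d)
    (fun p => integrable_of_continuous (hF' p)) p
  have h2 := eval_integral (μ := Measure.pi fun _ : Fin n => haarUnitary d)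
    (fun q => integrable_of_continuous ((continuous_apply q).comp (hF' p))) q
  exact ((congrFun h1 q).trans h2).symm

theorem isMixture_twirl_proj {k : ℕ} {ψ : Idx n d → ℂ} (hψ : schmidtRank ψ ≤ k) :
    IsMixtureOfSchmidtRank k (twirl (proj ψ)) := by
  rw [twirl_eq, show (1 / (n.factorial : ℂ)) = ((1 / (n.factorial : ℝ) : ℝ) : ℂ) by push_cast; rfl]
  exact (isMixture_sum _ _ fun σ _ => isMixture_haarTwirl_proj hψ σ).smul (by positivity)

end TwirlMixture

/-! ### The commutant of `U ⊗ U*` -/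

section OneSlot

variable {d : ℕ}

theorem maxEnt_eq_smul (d : ℕ) : maxEnt d = (1 / (d : ℂ)) • omegaOp (Fin d) := by
  ext p q
  simp [maxEnt, omegaOp]

theorem omegaOp_eq_smul (hd : 3 ≤ d) : omegaOp (Fin d) = (d : ℂ) • maxEnt d := by
  have : (d : ℂ) ≠ 0 := by exact_mod_cast (by omega : d ≠ 0)
  rw [maxEnt_eq_smul, smul_smul, mul_one_div_cancel this, one_smul]

theorem diagonal_mem_unitaryGroup {u : Fin d → ℂ} (hu : ∀ i, u i * star (u i) = 1) :
    Matrix.diagonal u ∈ Matrix.unitaryGroup (Fin d) ℂ := by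
  rw [Matrix.mem_unitaryGroup_iff, Matrix.star_eq_conjTranspose, Matrix.diagonal_conjTranspose,
    Matrix.diagonal_mul_diagonal, ← Matrix.diagonal_one]
  congr 1
  ext i
  simpa using hu i

theorem submatrix_one_mem_unitaryGroup (π : Equiv.Perm (Fin d)) :
    (1 : Matrix (Fin d) (Fin d) ℂ).submatrix π id ∈ Matrix.unitaryGroup (Fin d) ℂ := by
  rw [Matrix.mem_unitaryGroup_iff, Matrix.star_eq_conjTranspose]
  ext i j
  simp [Matrix.mul_apply, Matrix.one_apply]

/-- The reflection `1 - (2/d) J`, with `J` the all-ones matrix, has no zero entry when `d ≥ 3`. -/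
theorem reflection_mem_unitaryGroup (hd : 3 ≤ d) :
    (1 : Matrix (Fin d) (Fin d) ℂ) - Matrix.of (fun _ _ => ((2 / d : ℝ) : ℂ)) ∈
      Matrix.unitaryGroup (Fin d) ℂ := by
  have : (d : ℂ) ≠ 0 := by exact_mod_cast (by omega : d ≠ 0)
  set J : Matrix (Fin d) (Fin d) ℂ := Matrix.of (fun _ _ => ((2 / d : ℝ) : ℂ)) with hJ
  have hJ1 : Jᴴ = J := by
    ext i j
    simp [J]
  have hJ2 : J * J = J + J := by
    ext i j
    simp [J, Matrix.mul_apply]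
    field_simp
    norm_num
  rw [Matrix.mem_unitaryGroup_iff, Matrix.star_eq_conjTranspose, Matrix.conjTranspose_sub,
    Matrix.conjTranspose_one, hJ1, Matrix.mul_sub, Matrix.sub_mul, Matrix.sub_mul, hJ2]
  simp

variable {Y : Matrix (Fin d × Fin d) (Fin d × Fin d) ℂ}

theorem eq_zero_of_diagonal_invariant
    (hY : ∀ U : Matrix.unitaryGroup (Fin d) ℂ, localUnitary U * Y * (localUnitary U)ᴴ = Y)
    (i j k l : Fin d) (h1 : ¬(i = k ∧ j = l)) (h2 : ¬(i = j ∧ k = l)) : Y (i, j) (k, l) = 0 := by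
  -- the phase `I` at a single level `m`
  let u : Fin d → Fin d → ℂ := fun m x => if x = m then Complex.I else 1
  have key : ∀ m, u m i * star (u m j) * Y (i, j) (k, l) * (star (u m k) * u m l) =
      Y (i, j) (k, l) := fun m => by
    have h := hY ⟨_, diagonal_mem_unitaryGroup (u := u m) fun x => by
      by_cases hx : x = m <;> simp [u, hx]⟩
    have hL : localUnitary ⟨_, diagonal_mem_unitaryGroup (u := u m) fun x => by
        by_cases hx : x = m <;> simp [u, hx]⟩ =
        Matrix.diagonal fun p : Fin d × Fin d => u m p.1 * star (u m p.2) := by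
      simp only [localUnitary]
      rw [Matrix.diagonal_map (star_zero ℂ), Matrix.diagonal_kronecker_diagonal]
    rw [hL, Matrix.diagonal_conjTranspose] at h
    have h' := congrFun (congrFun h (i, j)) (k, l)
    rw [Matrix.mul_diagonal, Matrix.diagonal_mul] at h'
    simpa using h'
  have hz : ∀ z y : ℂ, z ≠ 1 → z * y = y → y = 0 := fun z y hz h => by
    have : (z - 1) * y = 0 := by rw [sub_mul, h]; ring
    exact (mul_eq_zero.mp this).resolve_left (sub_ne_zero.mpr hz)
  have hI : (Complex.I : ℂ) ≠ 1 := fun h => by simpa using congrArg Complex.re h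
  have hI' : -(Complex.I : ℂ) ≠ 1 := fun h => by simpa using congrArg Complex.re h
  have hI2 : (-1 : ℂ) ≠ 1 := by norm_num
  by_cases hij : i = j
  · subst hij
    have hkl : k ≠ l := fun h => h2 ⟨rfl, h⟩
    refine hz (-Complex.I) _ hI' ?_
    refine Eq.trans ?_ (key k)
    by_cases hik : i = k <;> simp [u, hik, hkl.symm] <;> ring
  · by_cases hik : i = k
    · subst hik
      have hjl : j ≠ l := fun h => h1 ⟨rfl, h⟩
      refine hz (-Complex.I) _ hI' ?_
      refine Eq.trans ?_ (key j)
      simp [u, hij, hjl.symm]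
    · by_cases hli : l = i
      · refine hz (-1) _ hI2 ?_
        refine Eq.trans ?_ (key i)
        simp only [u, hli, if_true, if_neg (Ne.symm hij), if_neg (Ne.symm hik), star_one]
        linear_combination (-Y (i, j) (k, i)) * Complex.I_mul_I
      · refine hz Complex.I _ hI ?_
        refine Eq.trans ?_ (key i)
        simp [u, hli, Ne.symm hij, Ne.symm hik]

theorem apply_perm_of_invariant
    (hY : ∀ U : Matrix.unitaryGroup (Fin d) ℂ, localUnitary U * Y * (localUnitary U)ᴴ = Y)
    (π : Equiv.Perm (Fin d)) (i j k l : Fin d) : Y (π i, π j) (π k, π l) = Y (i, j) (k, l) := by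
  have h := hY ⟨_, submatrix_one_mem_unitaryGroup π⟩
  have hL : localUnitary ⟨_, submatrix_one_mem_unitaryGroup π⟩ =
      (1 : Matrix (Fin d × Fin d) (Fin d × Fin d) ℂ).submatrix (Prod.map π π) id := by
    ext p q
    simp only [localUnitary, Matrix.kroneckerMap_apply, Matrix.map_apply, Matrix.submatrix_apply,
      Matrix.one_apply, id, Prod.ext_iff, Prod.map_fst, Prod.map_snd]
    split_ifs <;> simp_all
  rw [hL] at h
  have h' := congrFun (congrFun h (i, j)) (k, l)
  rw [← h']
  simp [Matrix.mul_apply, Matrix.one_apply]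

theorem exists_perm_apply_eq {α : Type*} [DecidableEq α] {i j i' j' : α} (h : i ≠ j)
    (h' : i' ≠ j') : ∃ π : Equiv.Perm α, π i = i' ∧ π j = j' := by
  refine ⟨Equiv.swap (Equiv.swap i i' j) j' * Equiv.swap i i', ?_, by simp⟩
  have h1 : Equiv.swap i i' j ≠ i' := fun e => h (by
    have := congrArg (Equiv.swap i i') e
    simpa using this.symm)
  simp [Equiv.swap_apply_of_ne_of_ne h1.symm h']

/-- An operator commuting with all `U ⊗ U*` is a combination of `1` and `Ω`: diagonal unitaries
leave three types of entries, permutation matrices make them constant on each type, and a reflection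
without zero entries relates the three constants. -/
theorem exists_eq_of_localUnitary_invariant (hd : 3 ≤ d)
    (hY : ∀ U : Matrix.unitaryGroup (Fin d) ℂ, localUnitary U * Y * (localUnitary U)ᴴ = Y) :
    ∃ b a : ℂ, Y = b • 1 + a • omegaOp (Fin d) := by
  let e0 : Fin d := ⟨0, by omega⟩
  let e1 : Fin d := ⟨1, by omega⟩
  have h01 : e0 ≠ e1 := by simp [e0, e1]
  let b := Y (e0, e1) (e0, e1)
  let a := Y (e0, e0) (e1, e1)
  let c := Y (e0, e0) (e0, e0)
  let D : Matrix (Fin d × Fin d) (Fin d × Fin d) ℂ :=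
    Matrix.diagonal fun p => if p.1 = p.2 then 1 else 0
  have hform : Y = b • 1 + a • omegaOp (Fin d) + (c - a - b) • D := by
    ext ⟨i, j⟩ ⟨k, l⟩
    by_cases h1 : i = k ∧ j = l
    · obtain ⟨rfl, rfl⟩ := h1
      by_cases hij : i = j
      · subst hij
        have := apply_perm_of_invariant hY (Equiv.swap e0 i) e0 e0 e0 e0
        rw [Equiv.swap_apply_left] at this
        rw [this]
        simp [D, omegaOp, c]
        ring
      · obtain ⟨π, hi, hj⟩ := exists_perm_apply_eq h01 hij
        have := apply_perm_of_invariant hY π e0 e1 e0 e1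
        rw [hi, hj] at this
        rw [this]
        simp [D, omegaOp, hij, b]
    · by_cases h2 : i = j ∧ k = l
      · obtain ⟨rfl, rfl⟩ := h2
        have hik : i ≠ k := fun h => h1 ⟨h, h⟩
        obtain ⟨π, hi, hj⟩ := exists_perm_apply_eq h01 hik
        have := apply_perm_of_invariant hY π e0 e0 e1 e1
        rw [hi, hj] at this
        rw [this]
        simp [D, omegaOp, hik, a]
      · rw [eq_zero_of_diagonal_invariant hY i j k l h1 h2]
        simp [D, omegaOp, h1, h2]
  have hc : c - a - b = 0 := by
    let U : Matrix.unitaryGroup (Fin d) ℂ := ⟨_, reflection_mem_unitaryGroup hd⟩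
    have hU := hY U
    rw [hform] at hU
    simp only [Matrix.mul_add, Matrix.add_mul, Matrix.mul_smul, Matrix.smul_mul,
      localUnitary_conj_omegaOp, Matrix.mul_one, localUnitary_mul_conjTranspose] at hU
    have hD := add_left_cancel hU
    have h := congrFun (congrFun hD (e0, e1)) (e0, e1)
    have hentry : (localUnitary U * D * (localUnitary U)ᴴ) (e0, e1) (e0, e1) =
        ((∑ m, Complex.normSq ((U : Matrix (Fin d) (Fin d) ℂ) e0 m) *
          Complex.normSq ((U : Matrix (Fin d) (Fin d) ℂ) e1 m) : ℝ) : ℂ) := by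
      rw [Matrix.mul_apply]
      simp only [D, Matrix.mul_diagonal, Matrix.conjTranspose_apply, Fintype.sum_prod_type,
        localUnitary, Matrix.kroneckerMap_apply, Matrix.map_apply, mul_ite, mul_one, mul_zero,
        ite_mul, zero_mul, Finset.sum_ite_eq, Finset.mem_univ, if_true]
      push_cast
      refine Finset.sum_congr rfl fun m _ => ?_
      rw [Complex.normSq_eq_conj_mul_self, Complex.normSq_eq_conj_mul_self]
      simp only [Complex.star_def, map_mul, Complex.conj_conj]
      ring
    have hpos : 0 < ∑ m, Complex.normSq ((U : Matrix (Fin d) (Fin d) ℂ) e0 m) *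
          Complex.normSq ((U : Matrix (Fin d) (Fin d) ℂ) e1 m) := by
      have hd' : (3 : ℝ) ≤ d := by exact_mod_cast hd
      refine lt_of_lt_of_le ?_ (Finset.single_le_sum (fun m _ =>
        mul_nonneg (Complex.normSq_nonneg _) (Complex.normSq_nonneg _)) (Finset.mem_univ e0))
      refine mul_pos ?_ ?_ <;> rw [Complex.normSq_pos]
      · have : (1 : ℂ) - ((2 / d : ℝ) : ℂ) ≠ 0 := by
          rw [← Complex.ofReal_one, ← Complex.ofReal_sub, Complex.ofReal_ne_zero]
          have : (2 / d : ℝ) < 1 := by rw [div_lt_one] <;> linarith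
          linarith
        simpa [U] using this
      · have : ((2 / d : ℝ) : ℂ) ≠ 0 := by
          rw [Complex.ofReal_ne_zero]
          positivity
        simpa [U, Matrix.one_apply, h01.symm] using this
    rw [Matrix.smul_apply, hentry, Matrix.smul_apply] at h
    have hD0 : D (e0, e1) (e0, e1) = 0 := by simp [D, h01]
    rw [hD0, smul_zero, smul_eq_mul] at h
    exact (mul_eq_zero.mp h).resolve_right (by exact_mod_cast hpos.ne')
  refine ⟨b, a, ?_⟩
  rw [hc, zero_smul, add_zero] at hform
  exact hform

theorem maxEnt_mul_self (hd : 3 ≤ d) : maxEnt d * maxEnt d = maxEnt d := by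
  have : (d : ℂ) ≠ 0 := by exact_mod_cast (by omega : d ≠ 0)
  ext p q
  by_cases hp : p.1 = p.2 <;> by_cases hq : q.1 = q.2 <;>
    simp [maxEnt, Matrix.mul_apply, Fintype.sum_prod_type, hp, hq]
  field_simp

theorem trace_maxEnt (hd : 3 ≤ d) : (maxEnt d).trace = 1 := by
  have : (d : ℂ) ≠ 0 := by exact_mod_cast (by omega : d ≠ 0)
  simp [maxEnt, Matrix.trace, Fintype.sum_prod_type, this]

theorem maxEnt_mul_maxEntCompl (hd : 3 ≤ d) : maxEnt d * maxEntCompl d = 0 := by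
  rw [maxEntCompl, Matrix.mul_sub, maxEnt_mul_self hd, Matrix.mul_one, sub_self]

theorem maxEntCompl_mul_maxEnt (hd : 3 ≤ d) : maxEntCompl d * maxEnt d = 0 := by
  rw [maxEntCompl, Matrix.sub_mul, maxEnt_mul_self hd, Matrix.one_mul, sub_self]

theorem maxEntCompl_mul_self (hd : 3 ≤ d) : maxEntCompl d * maxEntCompl d = maxEntCompl d := by
  conv_lhs => rw [maxEntCompl, Matrix.sub_mul, Matrix.one_mul, ← maxEntCompl,
    maxEnt_mul_maxEntCompl hd, sub_zero]

theorem trace_maxEntCompl (hd : 3 ≤ d) : (maxEntCompl d).trace = (d : ℂ) ^ 2 - 1 := by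
  rw [maxEntCompl, Matrix.trace_sub, trace_maxEnt hd]
  simp [sq]

theorem sq_sub_one_ne_zero (hd : 3 ≤ d) : (d : ℂ) ^ 2 - 1 ≠ 0 := by
  have h : (3 : ℝ) ≤ d := by exact_mod_cast hd
  have : (d : ℝ) ^ 2 - 1 ≠ 0 := by nlinarith
  exact_mod_cast this

theorem localUnitary_conj_maxEnt (U : Matrix.unitaryGroup (Fin d) ℂ) :
    localUnitary U * maxEnt d * (localUnitary U)ᴴ = maxEnt d := by
  rw [maxEnt_eq_smul, Matrix.mul_smul, Matrix.smul_mul, localUnitary_conj_omegaOp]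

theorem localUnitary_conj_maxEntCompl (U : Matrix.unitaryGroup (Fin d) ℂ) :
    localUnitary U * maxEntCompl d * (localUnitary U)ᴴ = maxEntCompl d := by
  rw [maxEntCompl, Matrix.mul_sub, Matrix.sub_mul, localUnitary_conj_maxEnt, Matrix.mul_one,
    localUnitary_mul_conjTranspose]

/-- The one-pair twirl is `Z ↦ tr(P Z) P + tr(Q Z) Q̃`. -/
theorem eq_of_localUnitary_invariant (hd : 3 ≤ d)
    (hY : ∀ U : Matrix.unitaryGroup (Fin d) ℂ, localUnitary U * Y * (localUnitary U)ᴴ = Y) :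
    Y = (Y * maxEnt d).trace • maxEnt d + (Y * maxEntCompl d).trace • maxEntComplNormalized d := by
  obtain ⟨b, a, rfl⟩ := exists_eq_of_localUnitary_invariant hd hY
  have h1 : b • 1 + a • omegaOp (Fin d) = (b + a * d) • maxEnt d + b • maxEntCompl d := by
    rw [maxEntCompl, omegaOp_eq_smul hd, smul_sub, add_smul, smul_smul]
    abel
  rw [h1]
  simp only [Matrix.add_mul, Matrix.smul_mul, maxEnt_mul_self hd, maxEntCompl_mul_maxEnt hd,
    maxEnt_mul_maxEntCompl hd, maxEntCompl_mul_self hd, Matrix.trace_add, Matrix.trace_smul,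
    trace_maxEnt hd, trace_maxEntCompl hd, smul_zero, Matrix.trace_zero, maxEntComplNormalized,
    smul_smul, smul_eq_mul]
  have := sq_sub_one_ne_zero hd
  congr 2
  · ring
  · field_simp
    ring

theorem integrable_of_continuous_unitary {f : Matrix.unitaryGroup (Fin d) ℂ → ℂ}
    (hf : Continuous f) : Integrable f (haarUnitary d) :=
  hf.integrable_of_hasCompactSupport (HasCompactSupport.of_compactSpace f)

theorem continuous_localUnitary :
    Continuous fun U : Matrix.unitaryGroup (Fin d) ℂ => localUnitary U := by
  have h : ∀ a b, Continuous fun U : Matrix.unitaryGroup (Fin d) ℂ =>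
      (U : Matrix (Fin d) (Fin d) ℂ) a b := fun a b => continuous_subtype_val.matrix_elem a b
  refine continuous_matrix fun p q => ?_
  simp only [localUnitary, Matrix.kroneckerMap_apply, Matrix.map_apply]
  exact (h _ _).mul (h _ _).star

theorem integral_localUnitary_conj (hd : 3 ≤ d) (Z : Matrix (Fin d × Fin d) (Fin d × Fin d) ℂ)
    (p q : Fin d × Fin d) :
    ∫ U, (localUnitary U * Z * (localUnitary U)ᴴ) p q ∂(haarUnitary d) =
      (Z * maxEnt d).trace * maxEnt d p q +
        (Z * maxEntCompl d).trace * maxEntComplNormalized d p q := by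
  let G : Matrix (Fin d × Fin d) (Fin d × Fin d) ℂ :=
    Matrix.of fun p q => ∫ U, (localUnitary U * Z * (localUnitary U)ᴴ) p q ∂(haarUnitary d)
  have hint : ∀ p q, Integrable (fun U => (localUnitary U * Z * (localUnitary U)ᴴ) p q)
      (haarUnitary d) := fun p q => integrable_of_continuous_unitary
    (((continuous_localUnitary.matrix_mul continuous_const).matrix_mul
      continuous_localUnitary.matrix_conjTranspose).matrix_elem p q)
  have hinv : ∀ V : Matrix.unitaryGroup (Fin d) ℂ,
      localUnitary V * G * (localUnitary V)ᴴ = G := fun V => by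
    ext p q
    rw [mul_integral_mul hint]
    refine Eq.trans ?_ (integral_mul_left_eq_self
      (fun U => (localUnitary U * Z * (localUnitary U)ᴴ) p q) V)
    simp only [localUnitary_mul, Matrix.conjTranspose_mul, Matrix.mul_assoc]
  have htr : ∀ Y : Matrix (Fin d × Fin d) (Fin d × Fin d) ℂ,
      (∀ U : Matrix.unitaryGroup (Fin d) ℂ, localUnitary U * Y * (localUnitary U)ᴴ = Y) →
      (G * Y).trace = (Z * Y).trace := fun Y hY => by
    rw [trace_integral_mul hint]
    have : ∀ U : Matrix.unitaryGroup (Fin d) ℂ,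
        (localUnitary U * Z * (localUnitary U)ᴴ * Y).trace = (Z * Y).trace := fun U => by
      conv_lhs => rw [← hY U]
      have h := localUnitary_conjTranspose_mul U
      calc _ = (localUnitary U * (Z * ((localUnitary U)ᴴ * localUnitary U) * Y) *
            (localUnitary U)ᴴ).trace := by simp only [Matrix.mul_assoc]
        _ = _ := by rw [h, Matrix.mul_one, Matrix.trace_mul_comm, ← Matrix.mul_assoc, h,
            Matrix.one_mul]
    simp [this]
  have h := congrFun (congrFun (eq_of_localUnitary_invariant hd hinv) p) q
  rw [htr _ localUnitary_conj_maxEnt, htr _ localUnitary_conj_maxEntCompl] at h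
  exact h

end OneSlot

/-! ### The invariant operators -/

section Invariant

variable {n d : ℕ}

/-- The tensor product with `P` on the pairs in `T` and `Q̃` on the others. -/
noncomputable def levelTerm (d : ℕ) (T : Finset (Fin n)) : Matrix (Idx n d) (Idx n d) ℂ :=
  tensorOp fun i => if i ∈ T then maxEnt d else maxEntComplNormalized d

theorem levelOp_eq_sum (k : ℕ) :
    levelOp n d k = ∑ T ∈ (Finset.univ : Finset (Fin n)).powersetCard k, levelTerm d T := rfl

theorem permutePairs_ite (σ : Equiv.Perm (Fin n)) (T : Finset (Fin n))
    (A B : Matrix (Fin d × Fin d) (Fin d × Fin d) ℂ) :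
    permutePairs σ (tensorOp fun i => if i ∈ T then A else B) =
      tensorOp fun i => if i ∈ T.map σ.toEmbedding then A else B := by
  rw [permutePairs_tensorOp]
  refine tensorOp_congr fun i => if_congr ?_ rfl rfl
  rw [Finset.mem_map_equiv]

theorem isUUFInvariant_levelOp (k : ℕ) : IsUUFInvariant (levelOp n d k) := by
  constructor
  · intro U
    simp only [levelOp_eq_sum, conjLocal, Finset.mul_sum, Finset.sum_mul]
    refine Finset.sum_congr rfl fun T _ => ?_
    rw [levelTerm, ← conjLocal, conjLocal_tensorOp]
    refine tensorOp_congr fun i => ?_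
    split_ifs
    · exact localUnitary_conj_maxEnt _
    · rw [maxEntComplNormalized, Matrix.mul_smul, Matrix.smul_mul, localUnitary_conj_maxEntCompl]
  · intro σ
    have : permutePairs σ (levelOp n d k) =
        ∑ T ∈ (Finset.univ : Finset (Fin n)).powersetCard k, permutePairs σ (levelTerm d T) := by
      ext p q
      simp only [levelOp_eq_sum, permutePairs, Matrix.submatrix_apply, Matrix.sum_apply]
    rw [this, levelOp_eq_sum]
    refine Finset.sum_equiv (Equiv.finsetCongr σ) (fun T => ?_) fun T _ => permutePairs_ite σ T _ _
    simp [Finset.mem_powersetCard]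

theorem exists_perm_map_eq {T T' : Finset (Fin n)} (h : T.card = T'.card) :
    ∃ σ : Equiv.Perm (Fin n), T.map σ.toEmbedding = T' := by
  refine ⟨(Finset.equivOfCardEq h).extendSubtype, ?_⟩
  refine Finset.eq_of_subset_of_card_le (fun x hx => ?_) (by simp [h])
  obtain ⟨y, hy, rfl⟩ := Finset.mem_map.mp hx
  exact Equiv.extendSubtype_mem _ y hy

/-- An invariant operator equals its own average over the local unitaries, which factorises into
one-pair averages. -/
theorem eq_sum_levelTerm_of_invariant (hd : 3 ≤ d) {X : Matrix (Idx n d) (Idx n d) ℂ}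
    (hX : ∀ U : Fin n → Matrix.unitaryGroup (Fin d) ℂ, conjLocal U X = X) :
    X = ∑ T : Finset (Fin n),
      (X * tensorOp fun i => if i ∈ T then maxEnt d else maxEntCompl d).trace • levelTerm d T := by
  ext p q
  have hexp : ∀ U : Fin n → Matrix.unitaryGroup (Fin d) ℂ, X p q = ∑ s, ∑ r,
      X r s * ∏ i, (localUnitary (U i) (p.1 i, p.2 i) (r.1 i, r.2 i) *
        star (localUnitary (U i) (q.1 i, q.2 i) (s.1 i, s.2 i))) := fun U => by
    conv_lhs => rw [← hX U]
    simp only [conjLocal, Matrix.mul_apply, Finset.sum_mul, tensorOp, Matrix.conjTranspose_apply,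
      Matrix.of_apply, Finset.prod_mul_distrib, star_prod]
    exact Finset.sum_congr rfl fun s _ => Finset.sum_congr rfl fun r _ => by ring
  have hone : ∀ a b x y : Fin d × Fin d,
      ∫ U, localUnitary U a x * star (localUnitary U b y) ∂(haarUnitary d) =
        maxEnt d y x * maxEnt d a b + maxEntCompl d y x * maxEntComplNormalized d a b := by
    intro a b x y
    have h := integral_localUnitary_conj hd (Matrix.single x y 1) a b
    have e : ∀ Z : Matrix (Fin d × Fin d) (Fin d × Fin d) ℂ,
        (Matrix.single x y (1 : ℂ) * Z).trace = Z y x := fun Z => by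
      rw [Matrix.trace_mul_comm, Matrix.trace_mul_single]; simp
    rw [e, e] at h
    rw [← h]
    refine integral_congr_ae (Filter.Eventually.of_forall fun U => ?_)
    simp [Matrix.mul_apply, Matrix.single_apply, ite_and]
  have hcont : ∀ r s : Idx n d, Continuous fun U : Fin n → Matrix.unitaryGroup (Fin d) ℂ =>
      X r s * ∏ i, (localUnitary (U i) (p.1 i, p.2 i) (r.1 i, r.2 i) *
        star (localUnitary (U i) (q.1 i, q.2 i) (s.1 i, s.2 i))) := fun r s =>
    continuous_const.mul (continuous_finsetProd _ fun i _ =>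
      ((continuous_localUnitary.comp (continuous_apply i)).matrix_elem _ _).mul
        ((continuous_localUnitary.comp (continuous_apply i)).matrix_elem _ _).star)
  have hint : X p q = ∑ s, ∑ r, X r s * ∏ i,
      (maxEnt d (s.1 i, s.2 i) (r.1 i, r.2 i) * maxEnt d (p.1 i, p.2 i) (q.1 i, q.2 i) +
        maxEntCompl d (s.1 i, s.2 i) (r.1 i, r.2 i) *
          maxEntComplNormalized d (p.1 i, p.2 i) (q.1 i, q.2 i)) := by
    calc X p q = ∫ _U, X p q ∂(Measure.pi fun _ : Fin n => haarUnitary d) := by simp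
      _ = _ := by
        rw [integral_congr_ae (Filter.Eventually.of_forall hexp),
          integral_finsetSum _ fun s _ => integrable_finsetSum _ fun r _ =>
            integrable_of_continuous (hcont r s)]
        refine Finset.sum_congr rfl fun s _ => ?_
        rw [integral_finsetSum _ fun r _ => integrable_of_continuous (hcont r s)]
        refine Finset.sum_congr rfl fun r _ => ?_
        rw [integral_const_mul, integral_fintype_prod_eq_prod (𝕜 := ℂ)
          (fun i (U : Matrix.unitaryGroup (Fin d) ℂ) =>
            localUnitary U (p.1 i, p.2 i) (r.1 i, r.2 i) *
              star (localUnitary U (q.1 i, q.2 i) (s.1 i, s.2 i)))]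
        simp only [hone]
  rw [hint]
  simp only [Matrix.sum_apply, Matrix.smul_apply, smul_eq_mul, Matrix.trace, Matrix.diag_apply,
    Matrix.mul_apply, Finset.sum_mul]
  rw [Finset.sum_comm' (t' := Finset.univ) (s' := fun _ => Finset.univ) (by simp)]
  simp only [Finset.prod_add, Finset.powerset_univ, Finset.mul_sum, Finset.prod_mul_distrib]
  simp_rw [Finset.sum_comm (s := (Finset.univ : Finset (Idx n d)))
    (t := (Finset.univ : Finset (Finset (Fin n))))]
  refine Finset.sum_congr rfl fun T _ => Finset.sum_congr rfl fun r _ =>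
    Finset.sum_congr rfl fun s _ => ?_
  have hsplit : ∀ f g : Fin n → ℂ, (∏ i ∈ T, f i) * ∏ i ∈ Finset.univ \ T, g i =
      ∏ i, if i ∈ T then f i else g i := fun f g => by
    rw [Finset.prod_ite, Finset.filter_mem_eq_inter, Finset.univ_inter,
      Finset.filter_notMem_eq_sdiff]
  have hterm : ∀ (A B : Matrix (Fin d × Fin d) (Fin d × Fin d) ℂ) (x y : Idx n d),
      (tensorOp fun i => if i ∈ T then A else B) x y =
      (∏ i ∈ T, A (x.1 i, x.2 i) (y.1 i, y.2 i)) *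
        ∏ i ∈ Finset.univ \ T, B (x.1 i, x.2 i) (y.1 i, y.2 i) := fun A B x y => by
    rw [hsplit]
    simp only [tensorOp, Matrix.of_apply]
    exact Finset.prod_congr rfl fun i _ => by split_ifs <;> rfl
  rw [levelTerm, hterm, hterm]
  ring

/-- The invariant operators are the combinations of the `levelOp n d k`. -/
theorem isUUFInvariant_iff (hd : 3 ≤ d) (X : Matrix (Idx n d) (Idx n d) ℂ) : IsUUFInvariant X ↔
    ∃ c : ℕ → ℂ, X = ∑ k ∈ Finset.range (n + 1), c k • levelOp n d k := by
  constructor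
  · intro hX
    let w : Finset (Fin n) → ℂ := fun T =>
      (X * tensorOp fun i => if i ∈ T then maxEnt d else maxEntCompl d).trace
    have hw : ∀ T T', T.card = T'.card → w T = w T' := fun T T' h => by
      obtain ⟨σ, rfl⟩ := exists_perm_map_eq h
      simp only [w]
      rw [← permutePairs_ite]
      conv_rhs => rw [← hX.2 σ, ← permutePairs_mul, trace_permutePairs]
    have hc : ∀ k, ∃ c, ∀ T ∈ (Finset.univ : Finset (Fin n)).powersetCard k, w T = c := fun k => by
      by_cases h : ∃ T : Finset (Fin n), T.card = k
      · obtain ⟨T₀, rfl⟩ := h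
        exact ⟨w T₀, fun T hT => hw _ _ (Finset.mem_powersetCard.mp hT).2⟩
      · exact ⟨0, fun T hT => (h ⟨T, (Finset.mem_powersetCard.mp hT).2⟩).elim⟩
    choose c hc using hc
    refine ⟨c, ?_⟩
    conv_lhs => rw [eq_sum_levelTerm_of_invariant hd hX.1, ← Finset.powerset_univ,
      Finset.sum_powerset, Finset.card_univ, Fintype.card_fin]
    refine Finset.sum_congr rfl fun k _ => ?_
    rw [levelOp_eq_sum, Finset.smul_sum]
    exact Finset.sum_congr rfl fun T hT => by rw [← hc k T hT]
  · rintro ⟨c, rfl⟩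
    exact isUUFInvariant_sum _ _ fun k _ => (isUUFInvariant_levelOp k).smul _

/-! ### Expectation values of `(1 + β F)^{T_B}` -/

theorem partialTranspose_werner (β : ℝ) :
    partialTranspose (werner d β) = 1 + (β : ℂ) • omegaOp (Fin d) := by
  ext p q
  simp only [partialTranspose, werner, flip, omegaOp, Matrix.of_apply, Matrix.add_apply,
    Matrix.smul_apply, Matrix.one_apply, Prod.ext_iff]
  congr 1
  · exact if_congr (and_congr Iff.rfl eq_comm) rfl rfl
  · congr 1
    exact if_congr (and_congr Iff.rfl eq_comm) rfl rfl

/-- The witness `((1 + β F)^{T_B})^{⊗ n}`. -/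
abbrev witness (n d : ℕ) (β : ℝ) : Matrix (Idx n d) (Idx n d) ℂ :=
  tensorOp fun _ : Fin n => partialTranspose (werner d β)

theorem isUUFInvariant_witness (β : ℝ) : IsUUFInvariant (witness n d β) := by
  refine ⟨fun U => ?_, fun σ => permutePairs_tensorOp _ _⟩
  rw [witness, conjLocal_tensorOp]
  refine tensorOp_congr fun i => ?_
  rw [partialTranspose_werner, Matrix.mul_add, Matrix.add_mul, Matrix.mul_one,
    localUnitary_mul_conjTranspose, Matrix.mul_smul, Matrix.smul_mul, localUnitary_conj_omegaOp]

theorem trace_twirl_mul_witness (X : Matrix (Idx n d) (Idx n d) ℂ) (β : ℝ) :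
    (twirl X * witness n d β).trace = (X * witness n d β).trace :=
  trace_twirl_mul X (isUUFInvariant_witness β)

theorem trace_maxEnt_mul_werner (hd : 3 ≤ d) (β : ℝ) :
    (maxEnt d * partialTranspose (werner d β)).trace = 1 + d * β := by
  rw [partialTranspose_werner, omegaOp_eq_smul hd, Matrix.mul_add, Matrix.mul_smul,
    Matrix.mul_smul, maxEnt_mul_self hd, Matrix.mul_one, Matrix.trace_add, Matrix.trace_smul,
    Matrix.trace_smul, trace_maxEnt hd]
  simp [mul_comm]

theorem trace_maxEntCompl_mul_werner (hd : 3 ≤ d) (β : ℝ) :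
    (maxEntCompl d * partialTranspose (werner d β)).trace = (d : ℂ) ^ 2 - 1 := by
  rw [partialTranspose_werner, omegaOp_eq_smul hd, Matrix.mul_add, Matrix.mul_smul,
    Matrix.mul_smul, maxEntCompl_mul_maxEnt hd, Matrix.mul_one, Matrix.trace_add,
    trace_maxEntCompl hd]
  simp

theorem trace_levelOp_mul_witness (hd : 3 ≤ d) (k : ℕ) (β : ℝ) :
    (levelOp n d k * witness n d β).trace = (n.choose k : ℂ) * (1 + d * β) ^ k := by
  have h := sq_sub_one_ne_zero hd
  have hT : ∀ T ∈ (Finset.univ : Finset (Fin n)).powersetCard k,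
      (levelTerm d T * witness n d β).trace = (1 + d * β) ^ k := fun T hT => by
    have : ∀ i, ((if i ∈ T then maxEnt d else maxEntComplNormalized d) *
        partialTranspose (werner d β)).trace = if i ∈ T then 1 + (d : ℂ) * β else 1 := fun i => by
      split_ifs
      · exact trace_maxEnt_mul_werner hd β
      · rw [maxEntComplNormalized, Matrix.smul_mul, Matrix.trace_smul,
          trace_maxEntCompl_mul_werner hd, smul_eq_mul, one_div_mul_cancel h]
    rw [levelTerm, witness, tensorOp_mul, trace_tensorOp, Finset.prod_congr rfl fun i _ => this i,
      Finset.prod_ite_mem, Finset.univ_inter, Finset.prod_const, (Finset.mem_powersetCard.mp hT).2]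
  rw [levelOp_eq_sum, Finset.sum_mul, Matrix.trace_sum, Finset.sum_congr rfl hT]
  simp

/-- Invariant operators are determined by their expectation values in the witnesses. -/
theorem IsUUFInvariant.eq_of_trace_mul_witness (hd : 3 ≤ d) {X Y : Matrix (Idx n d) (Idx n d) ℂ}
    (hX : IsUUFInvariant X) (hY : IsUUFInvariant Y)
    (h : ∀ β : ℝ, (X * witness n d β).trace = (Y * witness n d β).trace) : X = Y := by
  have hd0 : (d : ℝ) ≠ 0 := by exact_mod_cast (by omega : d ≠ 0)
  obtain ⟨c, hc⟩ := (isUUFInvariant_iff hd (X - Y)).mp (by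
    simpa [sub_eq_add_neg] using hX.add (hY.smul (-1)))
  let p : Polynomial ℂ := ∑ k ∈ Finset.range (n + 1), Polynomial.monomial k (c k * n.choose k)
  have hp : p = 0 := by
    apply Polynomial.eq_zero_of_infinite_isRoot
    refine Set.Infinite.mono (s := Set.range fun t : ℝ => (t : ℂ)) ?_
      (Set.infinite_range_of_injective Complex.ofReal_injective)
    rintro _ ⟨t, rfl⟩
    have h0 : ((X - Y) * witness n d ((t - 1) / d)).trace = 0 := by
      rw [Matrix.sub_mul, Matrix.trace_sub, h, sub_self]
    rw [hc, Finset.sum_mul, Matrix.trace_sum] at h0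
    simp only [Set.mem_ofPred_eq, Polynomial.IsRoot.def, p, Polynomial.eval_finsetSum,
      Polynomial.eval_monomial]
    rw [← h0]
    refine Finset.sum_congr rfl fun k _ => ?_
    rw [Matrix.smul_mul, Matrix.trace_smul, trace_levelOp_mul_witness hd, smul_eq_mul]
    have : (1 : ℂ) + d * ((t - 1) / d : ℝ) = t := by
      rw [← Complex.ofReal_natCast, ← Complex.ofReal_mul, mul_div_cancel₀ _ hd0]
      push_cast; ring
    rw [this]
    ring
  have hck : ∀ k ∈ Finset.range (n + 1), c k = 0 := fun k hk => by
    have h1 := congrArg (fun q => Polynomial.coeff q k) hp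
    simp only [p, Polynomial.finsetSum_coeff, Polynomial.coeff_monomial, Finset.sum_ite_eq', hk,
      if_true, Polynomial.coeff_zero] at h1
    refine (mul_eq_zero.mp h1).resolve_right ?_
    exact_mod_cast (Nat.choose_pos (Nat.lt_succ_iff.mp (Finset.mem_range.mp hk))).ne'
  rw [← sub_eq_zero, hc]
  exact Finset.sum_eq_zero fun k hk => by rw [hck k hk, zero_smul]

end Invariant

/-! ### Operators with nonnegative expectation values on vectors of bounded Schmidt rank -/

section Nonneg

variable {a b a' b' : Type*} [Fintype a] [Fintype b] [Fintype a'] [Fintype b']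

/-- `Y` has nonnegative expectation values in all vectors of Schmidt rank at most `k`. -/
def NonnegOnSchmidtRank (k : ℕ) (Y : Matrix (a × b) (a × b) ℂ) : Prop :=
  ∀ ψ : a × b → ℂ, schmidtRank ψ ≤ k → 0 ≤ (star ψ ⬝ᵥ (Y *ᵥ ψ)).re

theorem NonnegOnSchmidtRank.add {k : ℕ} {Y Z : Matrix (a × b) (a × b) ℂ}
    (hY : NonnegOnSchmidtRank k Y) (hZ : NonnegOnSchmidtRank k Z) :
    NonnegOnSchmidtRank k (Y + Z) := fun ψ hψ => by
  rw [Matrix.add_mulVec, dotProduct_add, Complex.add_re]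
  exact add_nonneg (hY ψ hψ) (hZ ψ hψ)

theorem NonnegOnSchmidtRank.smul {k : ℕ} {Y : Matrix (a × b) (a × b) ℂ}
    (hY : NonnegOnSchmidtRank k Y) {c : ℝ} (hc : 0 ≤ c) :
    NonnegOnSchmidtRank k ((c : ℂ) • Y) := fun ψ hψ => by
  rw [Matrix.smul_mulVec, dotProduct_smul, smul_eq_mul, Complex.re_ofReal_mul]
  exact mul_nonneg hc (hY ψ hψ)

/-- Local operators do not increase the Schmidt rank. -/
theorem NonnegOnSchmidtRank.conj_kronecker {k : ℕ} {Y : Matrix (a' × b') (a' × b') ℂ}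
    (hY : NonnegOnSchmidtRank k Y) (A : Matrix a' a ℂ) (B : Matrix b' b ℂ) :
    NonnegOnSchmidtRank k ((A ⊗ₖ B)ᴴ * Y * (A ⊗ₖ B)) := fun ψ hψ => by
  rw [← star_mulVec_dotProduct]
  exact hY _ ((schmidtRank_kronecker_mulVec_le A B ψ).trans hψ)

theorem NonnegOnSchmidtRank.submatrix [DecidableEq a'] [DecidableEq b'] {k : ℕ}
    {Y : Matrix (a' × b') (a' × b') ℂ}
    (hY : NonnegOnSchmidtRank k Y) (f : a → a') (g : b → b') :
    NonnegOnSchmidtRank k (Y.submatrix (Prod.map f g) (Prod.map f g)) := by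
  have := hY.conj_kronecker ((1 : Matrix a' a' ℂ).submatrix id f)
    ((1 : Matrix b' b' ℂ).submatrix id g)
  convert this using 1
  ext p q
  simp only [Matrix.mul_apply, Matrix.conjTranspose_apply, Matrix.kroneckerMap_apply,
    Matrix.submatrix_apply, Matrix.one_apply, Fintype.sum_prod_type, id, Prod.map, ← ite_and,
    mul_ite, mul_one, mul_zero, apply_ite star, star_one, star_zero, ite_mul, one_mul, zero_mul]
  simp [ite_and]

theorem exists_eq_mul_of_schmidtRank_le_one [Nonempty a] {ψ : a × b → ℂ}
    (hψ : schmidtRank ψ ≤ 1) : ∃ (u : a → ℂ) (v : b → ℂ), ∀ i j, ψ (i, j) = u i * v j := by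
  obtain ⟨P, -, hP⟩ := exists_coisometry_of_rank_le _ hψ Fintype.card_pos
  refine ⟨fun i => Pᴴ i 0, fun j => (P * Matrix.of fun i j => ψ (i, j)) 0 j, fun i j => ?_⟩
  have h := congrFun (congrFun hP i) j
  rw [Matrix.mul_assoc, Matrix.mul_apply] at h
  simpa using h.symm

theorem schmidtRank_mul_le (φ : a × b → ℂ) (f : a → ℂ) (g : b → ℂ) :
    schmidtRank (fun p => φ p * (f p.1 * g p.2)) ≤ schmidtRank φ := by
  classical
  have h := schmidtRank_kronecker_mulVec_le (Matrix.diagonal f) (Matrix.diagonal g) φ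
  convert h using 2
  ext p
  rw [Matrix.diagonal_kronecker_diagonal, Matrix.mulVec_diagonal, mul_comm]

end Nonneg

section Product

variable {n d : ℕ}

theorem dotProduct_werner (β : ℝ) (φ : Fin d × Fin d → ℂ) :
    star φ ⬝ᵥ (partialTranspose (werner d β) *ᵥ φ) =
      ((∑ p, ‖φ p‖ ^ 2 + β * ‖∑ i, φ (i, i)‖ ^ 2 : ℝ) : ℂ) := by
  rw [partialTranspose_werner, Matrix.add_mulVec, Matrix.one_mulVec, dotProduct_add,
    Matrix.smul_mulVec, dotProduct_smul, dotProduct_omegaOp_mulVec, star_dotProduct_self,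
    Complex.star_def, Complex.conj_mul']
  push_cast
  rfl

theorem tensorVec_dotProduct_witness (β : ℝ) (φ : Fin n → Fin d × Fin d → ℂ) :
    star (tensorVec φ) ⬝ᵥ (witness n d β *ᵥ tensorVec φ) =
      ((∏ i, (∑ p, ‖φ i p‖ ^ 2 + β * ‖∑ j, φ i (j, j)‖ ^ 2) : ℝ) : ℂ) := by
  rw [witness, tensorOp_mulVec_tensorVec, star_tensorVec_dotProduct]
  simp only [dotProduct_werner]
  push_cast
  rfl

theorem trace_twirl_proj_mul_witness (ψ : Idx n d → ℂ) (β : ℝ) :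
    (twirl (proj ψ) * witness n d β).trace = star ψ ⬝ᵥ (witness n d β *ᵥ ψ) := by
  rw [trace_twirl_mul_witness, star_dotProduct_mulVec_eq_trace]

theorem ket_eq {x y : ℕ} (hx : x < d) (hy : y < d) :
    (ket x y : Fin d × Fin d → ℂ) = Pi.single ((⟨x, hx⟩, ⟨y, hy⟩) : Fin d × Fin d) 1 := by
  ext p
  simp [ket, Pi.single_apply, Prod.ext_iff, Fin.ext_iff]

end Product

/-! ### Distillability in terms of vectors of Schmidt rank two -/

section Distillability

variable {n d : ℕ}

theorem partialTranspose_conj {a b a' b' : Type*} [Fintype a] [Fintype b]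
    (P : Matrix a' a ℂ) (Q : Matrix b' b ℂ) (R : Matrix (a × b) (a × b) ℂ) :
    partialTranspose ((P ⊗ₖ Q) * R * (P ⊗ₖ Q)ᴴ) =
      (P ⊗ₖ Q.map star) * partialTranspose R * (P ⊗ₖ Q.map star)ᴴ := by
  ext ⟨i, j⟩ ⟨k, l⟩
  simp only [partialTranspose, Matrix.of_apply, Matrix.mul_apply, Matrix.conjTranspose_apply,
    Matrix.kroneckerMap_apply, Matrix.map_apply, Fintype.sum_prod_type, Finset.sum_mul, star_mul',
    star_star]
  refine Finset.sum_congr rfl fun x _ => ?_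
  rw [Finset.sum_comm]
  conv_rhs => rw [Finset.sum_comm]
  refine Finset.sum_congr rfl fun y _ => ?_
  rw [Finset.sum_comm]
  exact Finset.sum_congr rfl fun z _ => Finset.sum_congr rfl fun w _ => by ring

theorem witness_isHermitian (β : ℝ) : (witness n d β).IsHermitian := by
  rw [Matrix.IsHermitian, witness, tensorOp_conjTranspose]
  refine tensorOp_congr fun i => ?_
  rw [partialTranspose_werner, Matrix.conjTranspose_add, Matrix.conjTranspose_one,
    Matrix.conjTranspose_smul, omegaOp_conjTranspose, Complex.star_def, Complex.conj_ofReal]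

theorem not_posSemidef_iff {a : Type*} [Fintype a] {H : Matrix a a ℂ} (hH : H.IsHermitian) :
    ¬H.PosSemidef ↔ ∃ φ : a → ℂ, (star φ ⬝ᵥ (H *ᵥ φ)).re < 0 := by
  rw [Matrix.posSemidef_iff_dotProduct_mulVec]
  constructor
  · intro h
    by_contra! h'
    refine h ⟨hH, fun φ => ?_⟩
    rw [Complex.nonneg_iff]
    exact ⟨h' φ, (hH.im_star_dotProduct_mulVec_self φ).symm⟩
  · rintro ⟨φ, hφ⟩ ⟨-, h⟩
    exact absurd (Complex.nonneg_iff.mp (h φ)).1 (not_le.mpr hφ)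

theorem two_le_card_configurations (hd : 3 ≤ d) (hn : 1 ≤ n) :
    2 ≤ Fintype.card (Fin n → Fin d) := by
  rw [Fintype.card_fun, Fintype.card_fin, Fintype.card_fin]
  exact le_trans (by omega) (Nat.le_self_pow (by omega) d)

/-- Projecting both parties onto qubits amounts to testing the partial transpose on vectors of
Schmidt rank at most two. -/
theorem nDistillable_werner_iff (hd : 3 ≤ d) (hn : 1 ≤ n) (β : ℝ) :
    NDistillable n (werner d β) ↔
      ∃ ψ : Idx n d → ℂ, schmidtRank ψ ≤ 2 ∧ (star ψ ⬝ᵥ (witness n d β *ᵥ ψ)).re < 0 := by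
  have hcard := two_le_card_configurations hd hn
  have hpt : partialTranspose (tensorOp fun _ : Fin n => werner d β) = witness n d β := rfl
  constructor
  · rintro ⟨P, Q, -, -, h⟩
    rw [partialTranspose_conj, hpt, not_posSemidef_iff
      (Matrix.isHermitian_mul_mul_conjTranspose _ (witness_isHermitian β))] at h
    obtain ⟨φ, hφ⟩ := h
    refine ⟨(Pᴴ ⊗ₖ (Q.map star)ᴴ) *ᵥ φ, ?_, ?_⟩
    · refine (schmidtRank_kronecker_mulVec_le _ _ _).trans ?_
      exact (Matrix.rank_le_card_width _).trans (by simp)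
    · rw [star_mulVec_dotProduct]
      simpa only [Matrix.conjTranspose_kronecker, Matrix.conjTranspose_conjTranspose] using hφ
  · rintro ⟨ψ, hψ, hneg⟩
    set M : Matrix (Fin n → Fin d) (Fin n → Fin d) ℂ := Matrix.of fun i j => ψ (i, j) with hM
    obtain ⟨P, hP, hPM⟩ := exists_coisometry_of_rank_le M hψ hcard
    obtain ⟨Q, hQ, hQM⟩ := exists_coisometry_of_rank_le Mᴴ
      (by rw [Matrix.rank_conjTranspose]; exact hψ) hcard
    have hMQ : M * (Qᴴ * Q) = M := by
      have := congrArg Matrix.conjTranspose hQM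
      simpa [Matrix.conjTranspose_mul, Matrix.mul_assoc] using this
    refine ⟨P, Q, hP, hQ, ?_⟩
    rw [partialTranspose_conj, hpt, not_posSemidef_iff
      (Matrix.isHermitian_mul_mul_conjTranspose _ (witness_isHermitian β))]
    refine ⟨fun p => (P * M * Qᴴ) p.1 p.2, ?_⟩
    have hψ' : ψ = (P ⊗ₖ Q.map star)ᴴ *ᵥ fun p => (P * M * Qᴴ) p.1 p.2 := by
      ext ⟨i, j⟩
      have h := congrFun (congrFun (show Pᴴ * (P * M * Qᴴ) * Q = M by
        calc Pᴴ * (P * M * Qᴴ) * Q = (Pᴴ * P * M) * (Qᴴ * Q) := by simp only [Matrix.mul_assoc]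
          _ = M := by rw [hPM, hMQ]) i) j
      refine Eq.trans h.symm ?_
      generalize P * M * Qᴴ = N
      simp only [Matrix.mulVec, dotProduct, Matrix.conjTranspose_apply, Matrix.kroneckerMap_apply,
        Matrix.map_apply, Fintype.sum_prod_type, star_mul', star_star, Matrix.mul_apply,
        Finset.sum_mul]
      rw [Finset.sum_comm]
      exact Finset.sum_congr rfl fun x _ => Finset.sum_congr rfl fun y _ => by ring
    rw [hψ', star_mulVec_dotProduct, Matrix.conjTranspose_conjTranspose] at hneg
    exact hneg

/-- `1 + Ω = 1 + d P` is a mixture of product vectors, as it is proportional to the twirl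
of `|00⟩`. -/
theorem isMixture_one_add_omegaOp (hd : 3 ≤ d) :
    IsMixtureOfSchmidtRank 1 (1 + omegaOp (Fin d)) := by
  let φ : Fin 1 → Fin d × Fin d → ℂ := fun _ => ket 0 0
  have hφ : schmidtRank (tensorVec φ) ≤ 1 := by
    refine schmidtRank_le_card_of_eq_sum (s := Unit)
      (fun _ a => if (a 0).val = 0 then 1 else 0) (fun _ b => if (b 0).val = 0 then 1 else 0) ?_
    intro i j
    simp [tensorVec, φ, ket, ite_and]
    split_ifs <;> rfl
  have htr : ∀ β : ℝ, (twirl (proj (tensorVec φ)) * witness 1 d β).trace = 1 + β := fun β => by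
    rw [trace_twirl_proj_mul_witness, tensorVec_dotProduct_witness]
    simp only [φ, ket_eq (show 0 < d by omega) (show 0 < d by omega)]
    simp [Pi.single_apply, apply_ite]
  have heq : witness 1 d 1 = (((d : ℝ) ^ 2 + d : ℝ) : ℂ) • twirl (proj (tensorVec φ)) := by
    refine (isUUFInvariant_witness 1).eq_of_trace_mul_witness hd
      ((isUUFInvariant_twirl _).smul _) fun β => ?_
    rw [Matrix.smul_mul, Matrix.trace_smul, htr, witness, tensorOp_mul, trace_tensorOp]
    simp only [Finset.univ_unique, Finset.prod_singleton]
    have h1 : partialTranspose (werner d 1) = maxEntCompl d + (1 + d : ℂ) • maxEnt d := by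
      rw [partialTranspose_werner, omegaOp_eq_smul hd, maxEntCompl, add_smul]
      simp only [Complex.ofReal_one, one_smul]
      abel
    rw [h1, Matrix.add_mul, Matrix.trace_add, trace_maxEntCompl_mul_werner hd, Matrix.smul_mul,
      Matrix.trace_smul, trace_maxEnt_mul_werner hd]
    push_cast
    simp only [smul_eq_mul]
    ring
  have hmix := ((isMixture_twirl_proj hφ).smul (c := (d : ℝ) ^ 2 + d) (by positivity))
  rw [← heq] at hmix
  convert hmix.submatrix (fun x : Fin d => fun _ : Fin 1 => x) (fun x : Fin d => fun _ : Fin 1 => x)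
    using 1
  ext p q
  simp [witness, tensorOp, partialTranspose_werner, Matrix.one_apply, Prod.ext_iff]

/-- In a factor of a tensor product, `(1 + γ F)^{T_B}` may be replaced by a product projector
`|uv⟩⟨uv|`: it is `K† (1 + γ F)^{T_B} K` for the local operator `K = |01⟩⟨uv|`. -/
theorem NonnegOnSchmidtRank.update_proj (hd : 3 ≤ d) {k : ℕ}
    {Y : Fin n → Matrix (Fin d × Fin d) (Fin d × Fin d) ℂ} {i : Fin n} {γ : ℝ}
    (hYi : Y i = partialTranspose (werner d γ)) (hY : NonnegOnSchmidtRank k (tensorOp Y))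
    {ψ : Fin d × Fin d → ℂ} (hψ : schmidtRank ψ ≤ 1) :
    NonnegOnSchmidtRank k (tensorOp (Function.update Y i (proj ψ))) := by
  have : NeZero d := ⟨by omega⟩
  obtain ⟨u, v, huv⟩ := exists_eq_mul_of_schmidtRank_le_one hψ
  let e0 : Fin d := ⟨0, by omega⟩
  let e1 : Fin d := ⟨1, by omega⟩
  have h01 : e0 ≠ e1 := by simp [e0, e1]
  let A : Matrix (Fin d) (Fin d) ℂ := Matrix.vecMulVec (Pi.single e0 1) (star u)
  let B : Matrix (Fin d) (Fin d) ℂ := Matrix.vecMulVec (Pi.single e1 1) (star v)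
  have hΩ : omegaOp (Fin d) * (A ⊗ₖ B) = 0 := by
    ext p q
    simp only [omegaOp, Matrix.mul_apply, Matrix.of_apply, Matrix.kroneckerMap_apply,
      Fintype.sum_prod_type, A, B, Matrix.vecMulVec_apply, Pi.single_apply, Matrix.zero_apply]
    refine Finset.sum_eq_zero fun x _ => Finset.sum_eq_zero fun y _ => ?_
    by_cases hx : x = e0 <;> by_cases hy : y = e1 <;> simp [hx, hy, h01]
  have hK : (A ⊗ₖ B)ᴴ * partialTranspose (werner d γ) * (A ⊗ₖ B) = proj ψ := by
    rw [partialTranspose_werner, Matrix.mul_assoc, Matrix.add_mul, Matrix.smul_mul, hΩ, smul_zero,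
      add_zero, Matrix.one_mul, Matrix.conjTranspose_kronecker, ← Matrix.mul_kronecker_mul]
    ext ⟨p, p'⟩ ⟨q, q'⟩
    simp [A, B, proj, Matrix.mul_apply, Matrix.vecMulVec_apply, Pi.single_apply, huv]
    ring
  let A' : Fin n → Matrix (Fin d) (Fin d) ℂ := Function.update (fun _ => 1) i A
  let B' : Fin n → Matrix (Fin d) (Fin d) ℂ := Function.update (fun _ => 1) i B
  have h := hY.conj_kronecker (partyOp A') (partyOp B')
  rw [← tensorOp_kronecker, tensorOp_conjTranspose, tensorOp_mul, tensorOp_mul] at h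
  convert h using 2
  ext1 j
  by_cases hj : j = i
  · subst hj
    simp only [Function.update_self, A', B', hYi, hK]
  · simp [Function.update_of_ne hj, A', B']

/-- Nonnegativity at `β = -1/2` implies nonnegativity for `-1/2 ≤ β ≤ 1`, one copy after the other,
since `(1 + β F)^{T_B}` is a nonnegative combination of `(1 - F/2)^{T_B}` and of the separable
`(1 + F)^{T_B} = 1 + Ω`. -/
theorem nonnegOnSchmidtRank_witness_of_le (hd : 3 ≤ d) {k : ℕ}
    (h : NonnegOnSchmidtRank k (witness n d (-1 / 2))) {β : ℝ} (h1 : -1 / 2 ≤ β) (h2 : β ≤ 1) :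
    NonnegOnSchmidtRank k (witness n d β) := by
  let Y : Finset (Fin n) → Fin n → Matrix (Fin d × Fin d) (Fin d × Fin d) ℂ := fun T i =>
    if i ∈ T then partialTranspose (werner d β) else partialTranspose (werner d (-1 / 2))
  suffices H : ∀ T, NonnegOnSchmidtRank k (tensorOp (Y T)) by simpa [Y] using H Finset.univ
  intro T
  induction T using Finset.induction_on with
  | empty => simpa [Y] using h
  | insert i T hi ih =>
    have hYi : Y T i = partialTranspose (werner d (-1 / 2)) := by simp [Y, hi]
    have hins : Y (insert i T) = Function.update (Y T) i
        ((((1 - β) * (2 / 3) : ℝ) : ℂ) • partialTranspose (werner d (-1 / 2)) +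
          (((β + 1 / 2) * (2 / 3) : ℝ) : ℂ) • (1 + omegaOp (Fin d))) := by
      ext1 j
      by_cases hj : j = i
      · subst hj
        simp only [Y, Function.update_self, Finset.mem_insert_self, if_true,
          partialTranspose_werner, smul_add, smul_smul]
        push_cast
        module
      · simp [Y, hj]
    have hsep :
        NonnegOnSchmidtRank k (tensorOp (Function.update (Y T) i (1 + omegaOp (Fin d)))) := by
      obtain ⟨m, v, hv, hsum⟩ := isMixture_one_add_omegaOp hd
      rw [hsum]
      refine Finset.sum_induction (fun j => proj (v j))
        (fun Z => NonnegOnSchmidtRank k (tensorOp (Function.update (Y T) i Z)))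
        (fun Z Z' hZ hZ' => ?_) ?_ fun j _ => ih.update_proj hd hYi (hv j)
      · rw [tensorOp_update_add]
        exact hZ.add hZ'
      · have : tensorOp (Function.update (Y T) i 0) = 0 := by
          simpa using tensorOp_update_smul (Y T) i 0 0
        rw [this]
        intro ψ _
        simp
    rw [hins, tensorOp_update_add, tensorOp_update_smul, tensorOp_update_smul, ← hYi,
      Function.update_eq_self]
    exact (ih.smul (by linarith)).add (hsep.smul (by linarith))

theorem wernerUndistillable_iff (hd : 3 ≤ d) (hn : 1 ≤ n) :
    WernerUndistillable n d ↔ NonnegOnSchmidtRank 2 (witness n d (-1 / 2)) := by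
  constructor
  · intro h ψ hψ
    by_contra! hneg
    exact h (-1 / 2) le_rfl (by norm_num) ((nDistillable_werner_iff hd hn _).mpr ⟨ψ, hψ, hneg⟩)
  · intro h β h1 h2 hdist
    obtain ⟨ψ, hψ, hneg⟩ := (nDistillable_werner_iff hd hn β).mp hdist
    exact absurd (nonnegOnSchmidtRank_witness_of_le hd h h1 h2 ψ hψ) (not_le.mpr hneg)

/-- Restricting the witness to a subspace of each party gives the witness in lower dimension. -/
theorem WernerUndistillable.of_le {d' : ℕ} (hd : 3 ≤ d) (hn : 1 ≤ n) (hdd' : d ≤ d')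
    (h : WernerUndistillable n d') : WernerUndistillable n d := by
  rw [wernerUndistillable_iff (hd.trans hdd') hn] at h
  rw [wernerUndistillable_iff hd hn]
  convert h.submatrix (fun x : Fin n → Fin d => Fin.castLE hdd' ∘ x)
    (fun x : Fin n → Fin d => Fin.castLE hdd' ∘ x) using 1
  ext p q
  simp [witness, tensorOp, partialTranspose_werner, omegaOp, Matrix.one_apply, Prod.ext_iff]

end Distillability

/-! ### The enumerator polynomials of invariant mixtures -/

section MixturePoly

open Polynomial

variable {n d : ℕ}

/-- `p` is the enumerator `β ↦ Tr[X ((1 + β F)^{T_B})^{⊗ n}]` of an invariant mixture `X` of pure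
states of Schmidt rank at most `k`. Such an `X` is determined by `p`, so that these polynomials form
a faithful picture of the cone of invariant states of Schmidt number at most `k`. -/
def IsMixtureEnumerator (k n d : ℕ) (p : ℝ[X]) : Prop :=
  ∃ X : Matrix (Idx n d) (Idx n d) ℂ, IsMixtureOfSchmidtRank k X ∧ IsUUFInvariant X ∧
    ∀ β : ℝ, (X * witness n d β).trace = ((p.eval β : ℝ) : ℂ)

theorem IsMixtureEnumerator.add {k : ℕ} {p q : ℝ[X]} (hp : IsMixtureEnumerator k n d p)
    (hq : IsMixtureEnumerator k n d q) : IsMixtureEnumerator k n d (p + q) := by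
  obtain ⟨X, hX1, hX2, hX3⟩ := hp
  obtain ⟨Y, hY1, hY2, hY3⟩ := hq
  refine ⟨X + Y, hX1.add hY1, hX2.add hY2, fun β => ?_⟩
  rw [Matrix.add_mul, Matrix.trace_add, hX3, hY3, eval_add]
  push_cast
  rfl

theorem IsMixtureEnumerator.smul {k : ℕ} {p : ℝ[X]} (hp : IsMixtureEnumerator k n d p) {c : ℝ}
    (hc : 0 ≤ c) : IsMixtureEnumerator k n d (c • p) := by
  obtain ⟨X, hX1, hX2, hX3⟩ := hp
  refine ⟨(c : ℂ) • X, hX1.smul hc, hX2.smul _, fun β => ?_⟩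
  rw [Matrix.smul_mul, Matrix.trace_smul, hX3, eval_smul, smul_eq_mul, smul_eq_mul]
  push_cast
  rfl

theorem isMixtureEnumerator_sum {k : ℕ} {s : Type*} (t : Finset s) (p : s → ℝ[X])
    (h : ∀ i ∈ t, IsMixtureEnumerator k n d (p i)) : IsMixtureEnumerator k n d (∑ i ∈ t, p i) :=
  Finset.sum_induction p (IsMixtureEnumerator k n d) (fun _ _ h h' => h.add h')
    ⟨0, isMixture_zero, isUUFInvariant_zero, fun β => by simp⟩ h

theorem isMixtureEnumerator_of_vector {k : ℕ} {p : ℝ[X]} {ψ : Idx n d → ℂ}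
    (hψ : schmidtRank ψ ≤ k)
    (h : ∀ β : ℝ, star ψ ⬝ᵥ (witness n d β *ᵥ ψ) = ((p.eval β : ℝ) : ℂ)) :
    IsMixtureEnumerator k n d p :=
  ⟨twirl (proj ψ), isMixture_twirl_proj hψ, isUUFInvariant_twirl _, fun β => by
    rw [trace_twirl_proj_mul_witness, h]⟩

/-- Membership of an invariant operator in the cone can be read off its enumerator. -/
theorem IsMixtureEnumerator.isMixture (hd : 3 ≤ d) {k : ℕ} {p : ℝ[X]}
    (hp : IsMixtureEnumerator k n d p) {Y : Matrix (Idx n d) (Idx n d) ℂ} (hY : IsUUFInvariant Y)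
    (h : ∀ β : ℝ, (Y * witness n d β).trace = ((p.eval β : ℝ) : ℂ)) :
    IsMixtureOfSchmidtRank k Y := by
  obtain ⟨X, hX1, hX2, hX3⟩ := hp
  rwa [hY.eq_of_trace_mul_witness hd hX2 fun β => by rw [h, hX3]]

theorem polynomial_eq_of_eval_eq {p q : ℝ[X]} (h : ∀ β : ℝ, p.eval β = q.eval β) : p = q :=
  Polynomial.funext h

theorem exists_enumerator (hd : 3 ≤ d) {X : Matrix (Idx n d) (Idx n d) ℂ} (hX : X.IsHermitian)
    (hinv : IsUUFInvariant X) :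
    ∃ p : ℝ[X], p.natDegree ≤ n ∧ ∀ β : ℝ, (X * witness n d β).trace = ((p.eval β : ℝ) : ℂ) := by
  obtain ⟨c, hc⟩ := (isUUFInvariant_iff hd X).mp hinv
  refine ⟨∑ k ∈ Finset.range (n + 1),
    C ((c k).re * n.choose k) * (1 + C (d : ℝ) * Polynomial.X) ^ k, ?_, fun β => ?_⟩
  · refine natDegree_sum_le_of_forall_le _ _ fun k hk => ?_
    refine (natDegree_C_mul_le _ _).trans (natDegree_pow_le_of_le k (m := 1) ?_ |>.trans ?_)
    · refine natDegree_add_le_of_degree_le (by simp) ((natDegree_C_mul_le _ _).trans ?_)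
      simp
    · have := Finset.mem_range.mp hk
      omega
  · have hval : (X * witness n d β).trace =
        ∑ k ∈ Finset.range (n + 1), c k * (((n.choose k : ℝ) * (1 + d * β) ^ k : ℝ) : ℂ) := by
      rw [hc, Finset.sum_mul, Matrix.trace_sum]
      refine Finset.sum_congr rfl fun k _ => ?_
      rw [Matrix.smul_mul, Matrix.trace_smul, trace_levelOp_mul_witness hd, smul_eq_mul]
      push_cast
      rfl
    have hreal : star (X * witness n d β).trace = (X * witness n d β).trace := by
      rw [← Matrix.trace_conjTranspose, Matrix.conjTranspose_mul, hX.eq,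
        (witness_isHermitian β).eq, Matrix.trace_mul_comm]
    rw [← Complex.conj_eq_iff_re.mp hreal, hval, Complex.re_sum]
    congr 1
    rw [eval_finsetSum]
    refine Finset.sum_congr rfl fun k _ => ?_
    rw [Complex.re_mul_ofReal]
    simp
    ring

theorem IsMixtureEnumerator.natDegree_le (hd : 3 ≤ d) {k : ℕ} {p : ℝ[X]}
    (hp : IsMixtureEnumerator k n d p) : p.natDegree ≤ n := by
  obtain ⟨X, hX1, hX2, hX3⟩ := hp
  obtain ⟨q, hq, hq'⟩ := exists_enumerator hd hX1.posSemidef.isHermitian hX2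
  rwa [polynomial_eq_of_eval_eq (p := p) (q := q) fun β => by
    exact_mod_cast (hX3 β).symm.trans (hq' β)]

theorem exists_enumerator_neg_of_not_undistillable (hd : 3 ≤ d) (hn : 1 ≤ n)
    (h : ¬WernerUndistillable n d) :
    ∃ p : ℝ[X], IsMixtureEnumerator 2 n d p ∧ p.eval (-1 / 2) < 0 := by
  rw [wernerUndistillable_iff hd hn, NonnegOnSchmidtRank] at h
  push Not at h
  obtain ⟨ψ, hψ, hneg⟩ := h
  obtain ⟨p, -, hp⟩ := exists_enumerator (n := n) hd
    (isMixture_twirl_proj hψ).posSemidef.isHermitian (isUUFInvariant_twirl _)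
  refine ⟨p, ⟨_, isMixture_twirl_proj hψ, isUUFInvariant_twirl _, hp⟩, ?_⟩
  have := hp (-1 / 2)
  rw [trace_twirl_proj_mul_witness] at this
  rw [this] at hneg
  exact_mod_cast hneg

theorem three_le_schmidtNumber_of_not_isMixture {a b : Type*} [Finite a] [Fintype b]
    {X : Matrix (a × b) (a × b) ℂ} (hX : X.PosSemidef) :
    3 ≤ schmidtNumber X ↔ ¬IsMixtureOfSchmidtRank 2 X := by
  rw [← schmidtNumber_le_iff hX]
  omega

/-- If the Werner states are undistillable, the witness at `β = -1/2` detects Schmidt number at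
least three. -/
theorem WernerUndistillable.three_le_schmidtNumber (hd : 3 ≤ d) (hn : 1 ≤ n)
    (h : WernerUndistillable n d) {Y : Matrix (Idx n d) (Idx n d) ℂ} (hY : Y.PosSemidef)
    (hneg : (Y * witness n d (-1 / 2)).trace.re < 0) : 3 ≤ schmidtNumber Y := by
  rw [three_le_schmidtNumber_of_not_isMixture hY]
  intro hmix
  exact absurd (hmix.trace_mul_nonneg ((wernerUndistillable_iff hd hn).mp h)) (not_le.mpr hneg)

/-- Polynomials `q j` of degree `j` span. -/
theorem exists_sum_smul_eq {q : ℕ → ℝ[X]} (hq : ∀ j, (q j).degree = j) (m : ℕ) (h : ℝ[X])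
    (hh : h.degree < m) : ∃ b : ℕ → ℝ, h = ∑ j ∈ Finset.range m, b j • q j := by
  induction m generalizing h with
  | zero =>
    refine ⟨0, ?_⟩
    have : h.degree < 0 := by simpa using hh
    rw [degree_eq_bot.mp (Nat.WithBot.lt_zero_iff.mp this)]
    simp
  | succ m ih =>
    have hm : (q m).coeff m ≠ 0 := by
      have := leadingCoeff_ne_zero.mpr (show q m ≠ 0 by rw [← degree_ne_bot, hq]; simp)
      rwa [leadingCoeff, natDegree_eq_of_degree_eq_some (hq m)] at this
    let t := h.coeff m / (q m).coeff m
    obtain ⟨b, hb⟩ := ih (h - t • q m) (by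
      rw [degree_lt_iff_coeff_zero]
      intro k hk
      rcases hk.eq_or_lt with rfl | hlt
      · simp [t, hm]
      · have h1 : h.coeff k = 0 := (degree_lt_iff_coeff_zero h (m + 1)).mp hh k hlt
        have h2 : (q m).coeff k = 0 := coeff_eq_zero_of_degree_lt (by
          rw [hq]; exact_mod_cast hlt)
        simp [h1, h2])
    refine ⟨Function.update b m t, ?_⟩
    rw [Finset.sum_range_succ, Function.update_self, Finset.sum_congr rfl fun j hj => by
      rw [Function.update_of_ne (Finset.mem_range.mp hj).ne], ← hb]
    ring

/-- The polynomials `(1 + 2β) ∑ λ_j q_j` with all `λ_j > 0` lie in the relative interior of the face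
of the cone on which the witness at `β = -1/2` vanishes. If the cone also contains a point on which
the witness is negative, it contains a neighbourhood of such a point on the negative side. -/
theorem isMixtureEnumerator_add_smul (hd : 3 ≤ d) {q : ℕ → ℝ[X]}
    (hq : ∀ j, (q j).degree = j)
    (hmem : ∀ j < n, IsMixtureEnumerator 2 n d ((1 + 2 * X) * q j)) {w : ℕ → ℝ}
    (hw : ∀ j < n, 0 < w j) {s e : ℝ[X]} (hs : IsMixtureEnumerator 2 n d s)
    (hs' : s.eval (-1 / 2) < 0) (he : e.natDegree ≤ n) (he' : e.eval (-1 / 2) < 0) :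
    ∃ δ₀ : ℝ, 0 < δ₀ ∧ ∀ δ, 0 < δ → δ < δ₀ →
      IsMixtureEnumerator 2 n d ((1 + 2 * X) * ∑ j ∈ Finset.range n, w j • q j + δ • e) := by
  let a := e.eval (-1 / 2) / s.eval (-1 / 2)
  have ha : 0 < a := div_pos_of_neg_of_neg he' hs'
  obtain ⟨h, hh⟩ : X - C (-1 / 2 : ℝ) ∣ e - a • s := by
    rw [dvd_iff_isRoot, IsRoot.def, eval_sub, eval_smul, smul_eq_mul,
      div_mul_cancel₀ _ hs'.ne, sub_self]
  have hdeg : h.degree < n := by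
    by_cases h0 : h = 0
    · rw [h0, degree_zero]
      exact WithBot.bot_lt_coe _
    have h1 : (e - a • s).natDegree ≤ n :=
      (natDegree_sub_le _ _).trans (max_le he ((natDegree_smul_le _ _).trans (hs.natDegree_le hd)))
    rw [hh, natDegree_mul (X_sub_C_ne_zero _) h0, natDegree_X_sub_C] at h1
    rw [degree_eq_natDegree h0]
    exact_mod_cast (by omega : h.natDegree < n)
  obtain ⟨b, hb⟩ := exists_sum_smul_eq hq n h hdeg
  have hfac : (1 + 2 * X : ℝ[X]) = C 2 * (X - C (-1 / 2 : ℝ)) := by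
    rw [mul_sub, ← C_mul, show (2 : ℝ) * (-1 / 2) = -1 by norm_num, C_neg, C_1,
      show (C (2 : ℝ) : ℝ[X]) = 2 from rfl]
    ring
  have he2 : e = a • s + (1 + 2 * X) * ∑ j ∈ Finset.range n, (b j / 2) • q j := by
    have : ∑ j ∈ Finset.range n, (b j / 2) • q j = C (1 / 2 : ℝ) * h := by
      rw [hb, Finset.mul_sum]
      refine Finset.sum_congr rfl fun j _ => ?_
      rw [← smul_eq_C_mul, smul_smul]
      congr 1
      ring
    rw [this, hfac]
    have h2 : (C 2 * C (1 / 2) : ℝ[X]) = 1 := by rw [← C_mul]; norm_num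
    calc e = a • s + (e - a • s) := by ring
      _ = a • s + (C 2 * C (1 / 2)) * ((X - C (-1 / 2 : ℝ)) * h) := by rw [h2, one_mul, ← hh]
      _ = _ := by ring
  -- the weight of `q j` at `δ` is `w j + δ b_j / 2`, which is positive for small `δ`
  have hev : ∀ᶠ δ in nhds (0 : ℝ), ∀ j ∈ Finset.range n, 0 < w j + δ * (b j / 2) := by
    rw [Filter.eventually_all_finset]
    intro j hj
    have hc : Continuous fun δ : ℝ => w j + δ * (b j / 2) := by fun_prop
    exact hc.tendsto 0 (lt_mem_nhds (by simpa using hw j (Finset.mem_range.mp hj)))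
  obtain ⟨δ₀, hδ₀, hball⟩ := Metric.eventually_nhds_iff.mp hev
  refine ⟨δ₀, hδ₀, fun δ hδ hlt => ?_⟩
  have hpos := hball (y := δ) (by rwa [Real.dist_eq, sub_zero, abs_of_pos hδ])
  have heq : (1 + 2 * X) * ∑ j ∈ Finset.range n, w j • q j + δ • e =
      (δ * a) • s + ∑ j ∈ Finset.range n, (w j + δ * (b j / 2)) • ((1 + 2 * X) * q j) := by
    conv_lhs => rw [he2]
    simp only [smul_add, smul_smul, add_smul, Finset.sum_add_distrib, Finset.mul_sum,
      Finset.smul_sum, mul_smul_comm]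
    abel
  rw [heq]
  exact (hs.smul (mul_pos hδ ha).le).add
    (isMixtureEnumerator_sum _ _ fun j hj => (hmem j (Finset.mem_range.mp hj)).smul (hpos j hj).le)

/-- The criterion behind all the equivalences: along a ray leaving an interior point of the face
towards the negative side of the witness, Schmidt number at least three is equivalent to
undistillability. -/
theorem wernerUndistillable_iff_ray (hd : 3 ≤ d) (hn : 1 ≤ n) {q : ℕ → ℝ[X]}
    (hq : ∀ j, (q j).degree = j)
    (hmem : ∀ j < n, IsMixtureEnumerator 2 n d ((1 + 2 * X) * q j)) {w : ℕ → ℝ}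
    (hw : ∀ j < n, 0 < w j) {e : ℝ[X]} (he : e.natDegree ≤ n) (he' : e.eval (-1 / 2) < 0)
    {Y : ℝ → Matrix (Idx n d) (Idx n d) ℂ} {δ₁ : ℝ} (hδ₁ : 0 < δ₁)
    (hYpos : ∀ δ, 0 < δ → δ < δ₁ → (Y δ).PosSemidef)
    (hYinv : ∀ δ, 0 < δ → δ < δ₁ → IsUUFInvariant (Y δ))
    (hY : ∀ δ β : ℝ, 0 < δ → δ < δ₁ → (Y δ * witness n d β).trace =
      ((((1 + 2 * X) * ∑ j ∈ Finset.range n, w j • q j + δ • e).eval β : ℝ) : ℂ)) :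
    WernerUndistillable n d ↔ ∀ δ, 0 < δ → δ < δ₁ → 3 ≤ schmidtNumber (Y δ) := by
  constructor
  · intro h δ hδ hlt
    refine h.three_le_schmidtNumber hd hn (hYpos δ hδ hlt) ?_
    rw [hY δ _ hδ hlt, Complex.ofReal_re, eval_add, eval_mul, eval_smul]
    have : (1 + 2 * X : ℝ[X]).eval (-1 / 2) = 0 := by
      simp only [eval_add, eval_one, eval_mul, eval_ofNat, eval_X]; norm_num
    rw [this, zero_mul, zero_add, smul_eq_mul]
    exact mul_neg_of_pos_of_neg hδ he'
  · intro h
    by_contra hnot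
    obtain ⟨s, hs, hs'⟩ := exists_enumerator_neg_of_not_undistillable hd hn hnot
    obtain ⟨δ₀, hδ₀, H⟩ := isMixtureEnumerator_add_smul hd hq hmem hw hs hs' he he'
    have hm : 0 < min δ₀ δ₁ := lt_min hδ₀ hδ₁
    have h0 : min δ₀ δ₁ / 2 < min δ₀ δ₁ := half_lt_self hm
    have hlt0 := h0.trans_le (min_le_left _ _)
    have hlt1 := h0.trans_le (min_le_right _ _)
    have hm2 := half_pos hm
    refine absurd ((H _ hm2 hlt0).isMixture hd (hYinv _ hm2 hlt1) fun β => hY _ β hm2 hlt1) ?_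
    rw [← three_le_schmidtNumber_of_not_isMixture (hYpos _ hm2 hlt1)]
    exact h _ hm2 hlt1

end MixturePoly

/-! ### Vectors of small Schmidt rank and their enumerators -/

section Vectors

variable {n d : ℕ}

/-- The vector `|00⟩ + ⋯ + |k-1,k-1⟩`. -/
def pairSum (d k : ℕ) : Fin d × Fin d → ℂ := fun p => if p.1 = p.2 ∧ p.1.val < k then 1 else 0

theorem schmidtRank_pairSum_le (k : ℕ) : schmidtRank (pairSum d k) ≤ k := by
  have := schmidtRank_le_card_of_eq_sum (s := Fin k) (ψ := pairSum d k)
    (fun r i => if i.val = r.val then 1 else 0) (fun r i => if i.val = r.val then 1 else 0) ?_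
  · simpa using this
  · intro i j
    by_cases hi : i.val < k
    · rw [Finset.sum_eq_single ⟨i.val, hi⟩]
      · simp [pairSum, hi, Fin.ext_iff, eq_comm]
      · intro r _ hr
        rw [if_neg fun h => hr (Fin.ext h.symm), zero_mul]
      · simp
    · rw [Finset.sum_eq_zero]
      · simp [pairSum, hi]
      · intro r _
        rw [if_neg fun h : i.val = r.val => hi (h ▸ r.2), zero_mul]

theorem card_filter_val_lt {k : ℕ} (hk : k ≤ d) :
    (Finset.univ.filter fun i : Fin d => i.val < k).card = k := by
  rw [Fin.card_filter_val_lt, min_eq_right hk]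

theorem pairSum_norm {k : ℕ} (hk : k ≤ d) : ∑ p, ‖pairSum d k p‖ ^ 2 = k := by
  have h : ∀ p : Fin d × Fin d, ‖pairSum d k p‖ ^ 2 =
      if p.1 = p.2 then (if p.1.val < k then (1 : ℝ) else 0) else 0 := fun p => by
    by_cases h1 : p.1 = p.2 <;> by_cases h2 : p.2.val < k <;> simp [pairSum, h1, h2]
  simp only [h, Fintype.sum_prod_type, Finset.sum_ite_eq, Finset.mem_univ, if_true,
    Finset.sum_boole, card_filter_val_lt hk]

theorem pairSum_trace {k : ℕ} (hk : k ≤ d) : ‖∑ j, pairSum d k (j, j)‖ ^ 2 = (k : ℝ) ^ 2 := by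
  simp [pairSum, card_filter_val_lt hk]

/-- The vector `|00⟩ + ⋯ + |t-1,t-1⟩` if `t ≠ 0`, and the vector `|01⟩` if `t = 0`. -/
def pairVec (d t : ℕ) : Fin d × Fin d → ℂ := if t = 0 then ket 0 1 else pairSum d t

theorem ket_apply_eq_mul (x y : ℕ) (i j : Fin d) :
    (ket x y : Fin d × Fin d → ℂ) (i, j) =
      (if i.val = x then 1 else 0) * if j.val = y then 1 else 0 := by
  by_cases h1 : i.val = x <;> by_cases h2 : j.val = y <;> simp [ket, h1, h2]

theorem pairVec_apply_eq_mul {t : ℕ} (ht : t ≤ 1) (i j : Fin d) :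
    pairVec d t (i, j) = (if i.val = 0 then 1 else 0) * if j.val = 1 - t then 1 else 0 := by
  obtain rfl | rfl : t = 0 ∨ t = 1 := by omega
  · exact ket_apply_eq_mul 0 1 i j
  · rw [pairVec, if_neg one_ne_zero, pairSum]
    by_cases h1 : i.val = 0 <;> by_cases h2 : j.val = 0 <;> simp [h1, h2, Fin.ext_iff, eq_comm]

theorem schmidtRank_pairVec_le (t : ℕ) : schmidtRank (pairVec d t) ≤ max 1 t := by
  rcases Nat.eq_zero_or_pos t with rfl | ht
  · simpa using schmidtRank_le_card_of_eq_sum (s := Unit)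
      (fun _ i : _ => if i.val = 0 then (1 : ℂ) else 0)
      (fun _ j : _ => if j.val = 1 - 0 then (1 : ℂ) else 0)
      fun i j => by simpa using pairVec_apply_eq_mul (d := d) zero_le_one i j
  · rw [pairVec, if_neg ht.ne']
    exact (schmidtRank_pairSum_le t).trans (le_max_right _ _)

theorem pairVec_norm (hd : 2 ≤ d) {t : ℕ} (ht : t ≤ d) :
    ∑ p, ‖pairVec d t p‖ ^ 2 = ((max 1 t : ℕ) : ℝ) := by
  rcases Nat.eq_zero_or_pos t with rfl | h
  · rw [pairVec, if_pos rfl, ket_eq (show 0 < d by omega) (show 1 < d by omega)]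
    simp [Pi.single_apply, apply_ite]
  · rw [pairVec, if_neg h.ne', pairSum_norm ht, max_eq_right h]

theorem pairVec_trace {t : ℕ} (ht : t ≤ d) : ‖∑ j, pairVec d t (j, j)‖ ^ 2 = (t : ℝ) ^ 2 := by
  rcases Nat.eq_zero_or_pos t with rfl | h
  · have : ∀ j : Fin d, pairVec d 0 (j, j) = 0 := fun j => by
      rw [pairVec_apply_eq_mul zero_le_one]
      split_ifs <;> first | omega | simp
    simp [this]
  · rw [pairVec, if_neg h.ne', pairSum_trace ht]

/-- A tensor product in which all pairs but one are in product states has the Schmidt rank of the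
remaining one at most. -/
theorem schmidtRank_tensorVec_le {η : Fin n → Fin d × Fin d → ℂ} (i₀ : Fin n)
    (u v : Fin n → Fin d → ℂ) (h : ∀ i ≠ i₀, ∀ x y, η i (x, y) = u i x * v i y) :
    schmidtRank (tensorVec η) ≤ schmidtRank (η i₀) := by
  refine le_trans ?_ (schmidtRank_comp_le (fun a : Fin n → Fin d => a i₀)
    (fun b : Fin n → Fin d => b i₀) (η i₀))
  have heq : tensorVec η = fun p : Idx n d => η i₀ (p.1 i₀, p.2 i₀) *
      ((∏ i ∈ Finset.univ.erase i₀, u i (p.1 i)) * ∏ i ∈ Finset.univ.erase i₀, v i (p.2 i)) := by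
    ext p
    have h1 : tensorVec η p = ∏ i, η i (p.1 i, p.2 i) := rfl
    have h2 := Finset.mul_prod_erase Finset.univ (fun i => η i (p.1 i, p.2 i))
      (Finset.mem_univ i₀)
    have h3 : ∏ i ∈ Finset.univ.erase i₀, η i (p.1 i, p.2 i) =
        (∏ i ∈ Finset.univ.erase i₀, u i (p.1 i)) * ∏ i ∈ Finset.univ.erase i₀, v i (p.2 i) := by
      rw [← Finset.prod_mul_distrib]
      exact Finset.prod_congr rfl fun i hi => h i (Finset.ne_of_mem_erase hi) _ _
    rw [h1, ← h2, h3]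
  rw [heq]
  exact schmidtRank_mul_le (fun p : Idx n d => η i₀ (p.1 i₀, p.2 i₀))
    (fun a => ∏ i ∈ Finset.univ.erase i₀, u i (a i))
    (fun b => ∏ i ∈ Finset.univ.erase i₀, v i (b i))

theorem schmidtRank_tensorVec_pairVec_le (t : Fin n → ℕ) (i₀ : Fin n)
    (h : ∀ i ≠ i₀, t i ≤ 1) :
    schmidtRank (tensorVec fun i => pairVec d (t i)) ≤ max 1 (t i₀) :=
  (schmidtRank_tensorVec_le (η := fun i => pairVec d (t i)) i₀
    (fun _ x => if x.val = 0 then 1 else 0) (fun i y => if y.val = 1 - t i then 1 else 0)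
    fun i hi x y => pairVec_apply_eq_mul (h i hi) x y).trans (schmidtRank_pairVec_le _)

theorem tensorVec_pairVec_dotProduct_witness (hd : 2 ≤ d) {t : Fin n → ℕ} (h : ∀ i, t i ≤ d)
    (β : ℝ) :
    star (tensorVec fun i => pairVec d (t i)) ⬝ᵥ
        (witness n d β *ᵥ tensorVec fun i => pairVec d (t i)) =
      ((∏ i, (((max 1 (t i) : ℕ) : ℝ) + β * (t i : ℝ) ^ 2) : ℝ) : ℂ) := by
  simp only [tensorVec_dotProduct_witness, pairVec_norm hd (h _), pairVec_trace (h _)]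

open Polynomial in
theorem isMixtureEnumerator_pairVec (hd : 2 ≤ d) {k : ℕ} (hk : 1 ≤ k) {t : Fin n → ℕ}
    (h : ∀ i, t i ≤ d) (i₀ : Fin n) (h₀ : t i₀ ≤ k) (h₁ : ∀ i ≠ i₀, t i ≤ 1) :
    IsMixtureEnumerator k n d
      (∏ i, (C ((max 1 (t i) : ℕ) : ℝ) + C ((t i : ℝ) ^ 2) * X)) := by
  refine isMixtureEnumerator_of_vector
    ((schmidtRank_tensorVec_pairVec_le t i₀ h₁).trans (max_le hk h₀)) fun β => ?_
  rw [tensorVec_pairVec_dotProduct_witness hd h, eval_prod]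
  simp only [eval_add, eval_mul, eval_C, eval_X, mul_comm β]

open Polynomial in
/-- The vectors `(|00⟩ + |11⟩) ⊗ |00⟩^{⊗ j} ⊗ |01⟩^{⊗ (n - 1 - j)}` have enumerators
`2 (1 + 2β) (1 + β)^j`. -/
theorem isMixtureEnumerator_one_add_X_pow (hd : 3 ≤ d) {j : ℕ} (hj : j < n) :
    IsMixtureEnumerator 2 n d ((1 + 2 * X) * (1 + X) ^ j) := by
  obtain ⟨m, rfl⟩ : ∃ m, n = m + 1 := ⟨n - 1, by omega⟩
  have h := isMixtureEnumerator_pairVec (n := m + 1) (d := d) (k := 2) (by omega) one_le_two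
    (t := Fin.cons 2 fun i : Fin m => if i.val < j then 1 else 0)
    (fun i => by
      cases i using Fin.cases
      · exact (by omega : 2 ≤ d)
      · rw [Fin.cons_succ]
        split_ifs <;> omega) 0 le_rfl
    (fun i hi => by
      cases i using Fin.cases
      · exact absurd rfl hi
      · rw [Fin.cons_succ]
        split_ifs <;> omega)
  convert h.smul (c := 1 / 2) (by norm_num) using 1
  rw [Fin.prod_univ_succ]
  simp only [Fin.cons_zero, Fin.cons_succ]
  have h1 : ∀ i : Fin m, (C ((max 1 (if i.val < j then 1 else 0) : ℕ) : ℝ) +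
      C (((if i.val < j then 1 else 0 : ℕ) : ℝ) ^ 2) * X) = if i.val < j then 1 + X else 1 :=
    fun i => by split_ifs <;> simp
  rw [Finset.prod_congr rfl fun i _ => h1 i, Finset.prod_ite, Finset.prod_const, Finset.prod_const,
    one_pow, mul_one, card_filter_val_lt (by omega), ← smul_mul_assoc]
  congr 1
  have h2 : ((2 : ℝ) ^ 2) = 2 * 2 := by norm_num
  rw [smul_eq_C_mul, max_eq_right one_le_two, Nat.cast_ofNat, h2, mul_add, ← mul_assoc, ← C_mul,
    ← C_mul]
  norm_num
  rfl

open Polynomial in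
theorem degree_one_add_X_pow (j : ℕ) : ((1 + X : ℝ[X]) ^ j).degree = j := by
  rw [add_comm, ← C_1, degree_pow, degree_X_add_C, nsmul_one]

/-- The product vector in which party `A` and party `B` each hold the unnormalised GHZ state
`∑ |x…x⟩` on the pairs in `S`, with the other pairs in the states `η i`. -/
def ghzVec (S : Finset (Fin n)) (η : Fin n → Fin d × Fin d → ℂ) : Idx n d → ℂ :=
  ∑ s : Fin d × Fin d, tensorVec fun i => if i ∈ S then Pi.single s 1 else η i

theorem schmidtRank_ghzVec_le (S : Finset (Fin n)) (η : Fin n → Fin d × Fin d → ℂ) :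
    schmidtRank (ghzVec S η) ≤
      schmidtRank (tensorVec fun i => if i ∈ S then (fun _ => 1) else η i) := by
  convert schmidtRank_mul_le (tensorVec fun i => if i ∈ S then (fun _ => 1) else η i)
    (fun a => ∑ x, ∏ i, if i ∈ S then (if a i = x then (1 : ℂ) else 0) else 1)
    (fun b => ∑ y, ∏ i, if i ∈ S then (if b i = y then (1 : ℂ) else 0) else 1) using 2
  ext p
  rw [Finset.sum_mul_sum, ghzVec, Finset.sum_apply, Fintype.sum_prod_type, Finset.mul_sum]
  refine Finset.sum_congr rfl fun x _ => ?_
  rw [Finset.mul_sum]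
  refine Finset.sum_congr rfl fun y _ => ?_
  simp only [tensorVec, ← Finset.prod_mul_distrib]
  refine Finset.prod_congr rfl fun i _ => ?_
  by_cases hi : i ∈ S
  · by_cases h1 : p.1 i = x <;> by_cases h2 : p.2 i = y <;>
      simp [hi, h1, h2]
  · simp [hi]

theorem single_dotProduct_werner (β : ℝ) (s t : Fin d × Fin d) :
    star (Pi.single s 1 : Fin d × Fin d → ℂ) ⬝ᵥ
        (partialTranspose (werner d β) *ᵥ (Pi.single t 1 : Fin d × Fin d → ℂ)) =
      (((if s = t then 1 else 0) + β * (if s.1 = s.2 ∧ t.1 = t.2 then 1 else 0) : ℝ) : ℂ) := by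
  rw [Matrix.mulVec_single_one, partialTranspose_werner, ← Pi.single_star, single_dotProduct]
  simp only [omegaOp, Matrix.col_apply, Matrix.add_apply, Matrix.one_apply, Matrix.smul_apply,
    Matrix.of_apply, star_one, one_mul, smul_eq_mul]
  split_ifs <;> simp

theorem sum_dotProduct_witness {s : Type*} [Fintype s] (β : ℝ)
    (φ : s → Fin n → Fin d × Fin d → ℂ) :
    star (∑ x, tensorVec (φ x)) ⬝ᵥ (witness n d β *ᵥ ∑ x, tensorVec (φ x)) =
      ∑ x, ∑ y, ∏ i, star (φ x i) ⬝ᵥ (partialTranspose (werner d β) *ᵥ φ y i) := by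
  rw [star_sum, sum_dotProduct]
  refine Finset.sum_congr rfl fun x _ => ?_
  rw [Matrix.mulVec_sum, dotProduct_sum]
  refine Finset.sum_congr rfl fun y _ => ?_
  rw [witness, tensorOp_mulVec_tensorVec, star_tensorVec_dotProduct]

theorem sum_sum_ghz {k : ℕ} (hk : k ≠ 0) (β : ℝ) :
    ∑ s : Fin d × Fin d, ∑ t : Fin d × Fin d,
      ((if s = t then 1 else 0) + β * (if s.1 = s.2 ∧ t.1 = t.2 then 1 else 0)) ^ k =
      ((d : ℝ) ^ 2 - d) * (1 + β ^ k) + d * (1 + β) ^ k := by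
  have h : ∀ s t : Fin d × Fin d,
      ((if s = t then 1 else 0) + β * (if s.1 = s.2 ∧ t.1 = t.2 then 1 else 0)) ^ k =
      (if s = t then 1 else 0) + (if s.1 = s.2 then (if t.1 = t.2 then
        (β ^ k + if s.1 = t.1 then (1 + β) ^ k - 1 - β ^ k else 0) else 0) else 0) := fun s t => by
    obtain ⟨x, y⟩ := s
    obtain ⟨x', y'⟩ := t
    simp only [Prod.mk.injEq]
    by_cases h1 : x = y
    · by_cases h2 : x' = y'
      · subst h1 h2
        by_cases h3 : x = x' <;> simp [h3]
      · have h3 : ¬(x = x' ∧ y = y') := by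
          rintro ⟨rfl, rfl⟩
          exact h2 h1
        simp [h1, h2, hk]
    · by_cases h3 : x = x' ∧ y = y'
      · obtain ⟨rfl, rfl⟩ := h3
        simp [h1]
      · simp [h1, h3, hk]
  simp only [h]
  simp [Finset.sum_add_distrib, Fintype.sum_prod_type]
  ring

theorem ghzVec_dotProduct_witness (β : ℝ) {S : Finset (Fin n)} (hS : S.card ≠ 0)
    (η : Fin n → Fin d × Fin d → ℂ) :
    star (ghzVec S η) ⬝ᵥ (witness n d β *ᵥ ghzVec S η) =
      (((((d : ℝ) ^ 2 - d) * (1 + β ^ S.card) + d * (1 + β) ^ S.card) *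
        ∏ i ∈ Sᶜ, (∑ p, ‖η i p‖ ^ 2 + β * ‖∑ j, η i (j, j)‖ ^ 2) : ℝ) : ℂ) := by
  rw [ghzVec, sum_dotProduct_witness, ← sum_sum_ghz hS]
  push_cast
  rw [Finset.sum_mul]
  refine Finset.sum_congr rfl fun s _ => ?_
  rw [Finset.sum_mul]
  refine Finset.sum_congr rfl fun t _ => ?_
  rw [← Finset.prod_mul_prod_compl S, ← Finset.prod_const]
  congr 1
  · refine Finset.prod_congr rfl fun i hi => ?_
    simp only [hi, if_true, single_dotProduct_werner]
    push_cast
    simp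
  · refine Finset.prod_congr rfl fun i hi => ?_
    simp only [Finset.mem_compl.mp hi, if_false, dotProduct_werner]
    push_cast
    rfl

theorem schmidtRank_ghzVec_pairVec_le (S : Finset (Fin n)) (t : Fin n → ℕ) (i₀ : Fin n)
    (h : ∀ i ≠ i₀, t i ≤ 1) :
    schmidtRank (ghzVec S fun i => pairVec d (t i)) ≤ max 1 (t i₀) := by
  refine (schmidtRank_ghzVec_le S _).trans ((schmidtRank_tensorVec_le i₀
    (fun i x => if i ∈ S then 1 else if x.val = 0 then 1 else 0)
    (fun i y => if i ∈ S then 1 else if y.val = 1 - t i then 1 else 0) fun i hi x y => ?_).trans ?_)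
  · by_cases hS : i ∈ S
    · simp [hS]
    · simp only [hS, if_false]
      exact pairVec_apply_eq_mul (h i hi) x y
  · split_ifs
    · refine le_trans ?_ (le_max_left _ _)
      simpa using schmidtRank_le_card_of_eq_sum (s := Unit) (ψ := fun _ : Fin d × Fin d => (1 : ℂ))
        (fun _ _ => 1) (fun _ _ => 1) (by simp)
    · exact schmidtRank_pairVec_le _

open Polynomial in
theorem isMixtureEnumerator_ghzVec (hd : 2 ≤ d) {k : ℕ} (hk : 1 ≤ k) {S : Finset (Fin n)}
    (hS : S.card ≠ 0) {t : Fin n → ℕ} (h : ∀ i, t i ≤ d) (i₀ : Fin n) (h₀ : t i₀ ≤ k)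
    (h₁ : ∀ i ≠ i₀, t i ≤ 1) :
    IsMixtureEnumerator k n d ((C ((d : ℝ) ^ 2 - d) * (1 + X ^ S.card) +
      C (d : ℝ) * (1 + X) ^ S.card) *
        ∏ i ∈ Sᶜ, (C ((max 1 (t i) : ℕ) : ℝ) + C ((t i : ℝ) ^ 2) * X)) := by
  refine isMixtureEnumerator_of_vector
    ((schmidtRank_ghzVec_pairVec_le S t i₀ h₁).trans (max_le hk h₀)) fun β => ?_
  rw [ghzVec_dotProduct_witness β hS, eval_mul, eval_prod]
  simp only [pairVec_norm hd (h _), pairVec_trace (h _), eval_add, eval_mul, eval_C, eval_X,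
    eval_pow, eval_one, mul_comm β]

end Vectors

/-! ### Positivity and enumerators of the invariant families -/

section States

variable {n d : ℕ}

theorem posSemidef_tensorOp {Y : Fin n → Matrix (Fin d × Fin d) (Fin d × Fin d) ℂ}
    (hY : ∀ i, (Y i).PosSemidef) : (tensorOp Y).PosSemidef := by
  have h : ∀ i, ∃ Z, Y i = Zᴴ * Z := fun i => by
    open scoped MatrixOrder in
    exact CStarAlgebra.nonneg_iff_eq_star_mul_self.mp (hY i).nonneg
  choose Z hZ using h
  rw [tensorOp_congr hZ, ← tensorOp_mul, ← tensorOp_conjTranspose]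
  exact Matrix.posSemidef_conjTranspose_mul_self _

theorem posSemidef_smul {a : Type*} [Fintype a] {X : Matrix a a ℂ} (hX : X.PosSemidef) {c : ℝ}
    (hc : 0 ≤ c) : ((c : ℂ) • X).PosSemidef :=
  hX.smul (Complex.zero_le_real.mpr hc)

theorem posSemidef_maxEnt (hd : 3 ≤ d) : (maxEnt d).PosSemidef := by
  have h : (maxEnt d)ᴴ = maxEnt d := by
    rw [maxEnt_eq_smul, Matrix.conjTranspose_smul, omegaOp_conjTranspose]
    simp
  have := Matrix.posSemidef_conjTranspose_mul_self (maxEnt d)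
  rwa [h, maxEnt_mul_self hd] at this

theorem posSemidef_maxEntCompl (hd : 3 ≤ d) : (maxEntCompl d).PosSemidef := by
  have h : (maxEntCompl d)ᴴ = maxEntCompl d := by
    rw [maxEntCompl, Matrix.conjTranspose_sub, Matrix.conjTranspose_one,
      (posSemidef_maxEnt hd).isHermitian.eq]
  have := Matrix.posSemidef_conjTranspose_mul_self (maxEntCompl d)
  rwa [h, maxEntCompl_mul_self hd] at this

theorem nat_cast_ge_three (hd : 3 ≤ d) : (3 : ℝ) ≤ d := by exact_mod_cast hd

theorem posSemidef_maxEntComplNormalized (hd : 3 ≤ d) : (maxEntComplNormalized d).PosSemidef := by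
  have h3 := nat_cast_ge_three hd
  have h : (1 / ((d : ℂ) ^ 2 - 1)) = ((1 / ((d : ℝ) ^ 2 - 1) : ℝ) : ℂ) := by push_cast; rfl
  rw [maxEntComplNormalized, h]
  exact posSemidef_smul (posSemidef_maxEntCompl hd) (one_div_nonneg.mpr (by nlinarith))

theorem posSemidef_levelOp (hd : 3 ≤ d) (k : ℕ) : (levelOp n d k).PosSemidef := by
  refine Matrix.posSemidef_sum _ fun T _ => posSemidef_tensorOp fun i => ?_
  split_ifs
  exacts [posSemidef_maxEnt hd, posSemidef_maxEntComplNormalized hd]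

theorem isUUFInvariant_invariantState (x : ℕ → ℝ) : IsUUFInvariant (invariantState n d x) :=
  (isUUFInvariant_levelOp 0).add
    (isUUFInvariant_sum _ _ fun k _ => (isUUFInvariant_levelOp k).smul _)

theorem posSemidef_invariantState (hd : 3 ≤ d) {x : ℕ → ℝ} (hx : ∀ k, 1 ≤ k → k ≤ n → 0 ≤ x k) :
    (invariantState n d x).PosSemidef := by
  have h3 := nat_cast_ge_three hd
  refine (posSemidef_levelOp hd 0).add (Matrix.posSemidef_sum _ fun k hk => ?_)
  obtain ⟨h1, h2⟩ := Finset.mem_Icc.mp hk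
  exact posSemidef_smul (posSemidef_levelOp hd k)
    (div_nonneg (hx k h1 h2) (pow_nonneg (by linarith) _))

theorem trace_invariantState_mul_witness (hd : 3 ≤ d) (x : ℕ → ℝ) (β : ℝ) :
    (invariantState n d x * witness n d β).trace =
      ((1 + ∑ k ∈ Finset.Icc 1 n,
        n.choose k * x k * ((1 + d * β) / ((d : ℝ) / 2 - 1)) ^ k : ℝ) : ℂ) := by
  rw [invariantState, Matrix.add_mul, Matrix.trace_add, trace_levelOp_mul_witness hd,
    Finset.sum_mul, Matrix.trace_sum]
  push_cast
  congr 1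
  · simp
  · refine Finset.sum_congr rfl fun k _ => ?_
    rw [Matrix.smul_mul, Matrix.trace_smul, trace_levelOp_mul_witness hd, smul_eq_mul, div_pow]
    ring

theorem twoCopyState_eq (hd : 3 ≤ d) (z : ℝ × ℝ) :
    twoCopyState d z = (((d : ℂ) ^ 2 - 1) ^ 2) • levelOp 2 d 0 +
      ((z.1 : ℂ) * ((d : ℂ) ^ 2 - 1)) • levelOp 2 d 1 + (z.2 : ℂ) • levelOp 2 d 2 := by
  have h := sq_sub_one_ne_zero hd
  have h2 : (Finset.univ : Finset (Fin 2)).powersetCard 2 = {Finset.univ} := by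
    decide
  have h1 : (Finset.univ : Finset (Fin 2)).powersetCard 1 = {{0}, {1}} := by decide
  have h01 : ({0} : Finset (Fin 2)) ≠ {1} := by decide
  have hQ : maxEntCompl d = ((d : ℂ) ^ 2 - 1) • maxEntComplNormalized d := by
    rw [maxEntComplNormalized, smul_smul, mul_one_div_cancel h, one_smul]
  rw [levelOp, levelOp, levelOp, h1, h2, Finset.sum_pair h01]
  simp only [Finset.powersetCard_zero, Finset.sum_singleton]
  rw [twoCopyState, hQ]
  ext p q
  simp [tensorOp, Fin.prod_univ_two]
  ring

theorem isUUFInvariant_twoCopyState (hd : 3 ≤ d) (z : ℝ × ℝ) :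
    IsUUFInvariant (twoCopyState d z) := by
  rw [twoCopyState_eq hd]
  exact (((isUUFInvariant_levelOp 0).smul _).add ((isUUFInvariant_levelOp 1).smul _)).add
    ((isUUFInvariant_levelOp 2).smul _)

theorem posSemidef_twoCopyState (hd : 3 ≤ d) {z : ℝ × ℝ} (h1 : 0 ≤ z.1) (h2 : 0 ≤ z.2) :
    (twoCopyState d z).PosSemidef := by
  have hP := posSemidef_maxEnt hd
  have hQ := posSemidef_maxEntCompl hd
  have h : ∀ {X Y : Matrix (Fin d × Fin d) (Fin d × Fin d) ℂ}, X.PosSemidef → Y.PosSemidef →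
      (tensorOp ![X, Y]).PosSemidef := fun hX hY =>
    posSemidef_tensorOp fun i => by fin_cases i; exacts [hX, hY]
  exact ((h hQ hQ).add (posSemidef_smul ((h hQ hP).add (h hP hQ)) h1)).add
    (posSemidef_smul (h hP hP) h2)

theorem trace_tensorOp_two_mul (X Y Z : Matrix (Fin d × Fin d) (Fin d × Fin d) ℂ) :
    (tensorOp ![X, Y] * tensorOp fun _ => Z).trace = (X * Z).trace * (Y * Z).trace := by
  rw [tensorOp_mul, trace_tensorOp, Fin.prod_univ_two]
  rfl

theorem trace_twoCopyState_mul (z : ℝ × ℝ) (Z : Matrix (Fin d × Fin d) (Fin d × Fin d) ℂ) :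
    (twoCopyState d z * tensorOp fun _ => Z).trace = (maxEntCompl d * Z).trace ^ 2 +
      2 * z.1 * (maxEntCompl d * Z).trace * (maxEnt d * Z).trace +
        z.2 * (maxEnt d * Z).trace ^ 2 := by
  simp only [twoCopyState, Matrix.add_mul, Matrix.smul_mul, Matrix.trace_add, Matrix.trace_smul,
    trace_tensorOp_two_mul, smul_eq_mul]
  ring

theorem trace_twoCopyState_mul_witness (hd : 3 ≤ d) (z : ℝ × ℝ) (β : ℝ) :
    (twoCopyState d z * witness 2 d β).trace =
      ((((d : ℝ) ^ 2 - 1) ^ 2 + 2 * z.1 * ((d : ℝ) ^ 2 - 1) * (1 + d * β) +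
        z.2 * (1 + d * β) ^ 2 : ℝ) : ℂ) := by
  rw [witness, trace_twoCopyState_mul, trace_maxEntCompl_mul_werner hd, trace_maxEnt_mul_werner hd]
  push_cast
  rfl

theorem trace_maxEnt_mul_omegaOp (hd : 3 ≤ d) : (maxEnt d * omegaOp (Fin d)).trace = d := by
  rw [omegaOp_eq_smul hd, Matrix.mul_smul, maxEnt_mul_self hd, Matrix.trace_smul, trace_maxEnt hd]
  simp

theorem trace_maxEntCompl_mul_omegaOp (hd : 3 ≤ d) :
    (maxEntCompl d * omegaOp (Fin d)).trace = 0 := by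
  rw [omegaOp_eq_smul hd, Matrix.mul_smul, maxEntCompl_mul_maxEnt hd]
  simp

theorem witness_zero : witness n d 0 = 1 := by
  rw [witness, ← tensorOp_one]
  exact tensorOp_congr fun i => by rw [partialTranspose_werner]; simp

/-- The bound on the overlap with the maximally entangled state, for the two-copy states. -/
theorem twoCopyState_overlap_le (hd : 3 ≤ d) {z : ℝ × ℝ} {k : ℕ} (hk : k ≤ 2)
    (h : IsMixtureOfSchmidtRank k (twoCopyState d z)) :
    d ^ 2 * z.2 ≤ k * (((d : ℝ) ^ 2 - 1) ^ 2 + 2 * z.1 * ((d : ℝ) ^ 2 - 1) + z.2) := by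
  have h1 := h.trace_mul_omegaOp_le (hk.trans (two_le_card_configurations hd (by norm_num)))
  have htr := trace_twoCopyState_mul_witness hd z 0
  rw [witness_zero, Matrix.mul_one] at htr
  rw [htr, ← tensorOp_omegaOp, trace_twoCopyState_mul, trace_maxEnt_mul_omegaOp hd,
    trace_maxEntCompl_mul_omegaOp hd] at h1
  have h2 : ((0 : ℂ) ^ 2 + 2 * z.1 * 0 * d + z.2 * (d : ℂ) ^ 2).re = z.2 * (d : ℝ) ^ 2 := by
    rw [← Complex.ofReal_re (z.2 * (d : ℝ) ^ 2)]
    push_cast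
    congr 1
    ring
  rw [h2, Complex.ofReal_re] at h1
  simp only [mul_zero, add_zero, mul_one, one_pow] at h1
  linarith

end States

/-! ### One copy -/

section OneCopy

variable {d : ℕ}

theorem isotropic_eq (α : ℝ) :
    isotropic d α = maxEntCompl d + ((1 + α : ℝ) : ℂ) • maxEnt d := by
  rw [isotropic, maxEntCompl]
  push_cast
  module

theorem posSemidef_isotropic (hd : 3 ≤ d) {α : ℝ} (hα : -1 ≤ α) : (isotropic d α).PosSemidef := by
  rw [isotropic_eq]
  exact (posSemidef_maxEntCompl hd).add (posSemidef_smul (posSemidef_maxEnt hd) (by linarith))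

theorem trace_isotropic_mul_werner (hd : 3 ≤ d) (α β : ℝ) :
    (isotropic d α * partialTranspose (werner d β)).trace =
      ((d ^ 2 - 1 + (1 + α) * (1 + d * β) : ℝ) : ℂ) := by
  rw [isotropic_eq, Matrix.add_mul, Matrix.smul_mul, Matrix.trace_add, Matrix.trace_smul,
    trace_maxEntCompl_mul_werner hd, trace_maxEnt_mul_werner hd]
  push_cast
  rfl

theorem isMixture_isotropic (hd : 3 ≤ d) {k : ℕ} (hk1 : 1 ≤ k) (hk : k < d) {α : ℝ} (hα : -1 ≤ α)
    (h : α ≤ d * (k * d - 1) / (d - k)) : IsMixtureOfSchmidtRank k (isotropic d α) := by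
  have hk' : (0 : ℝ) < k := by exact_mod_cast hk1
  have hdk : (k : ℝ) < d := by exact_mod_cast hk
  rw [le_div_iff₀ (by linarith)] at h
  have hE : ∀ t ≤ k, IsMixtureEnumerator k 1 d (∏ _ : Fin 1, (Polynomial.C ((max 1 t : ℕ) : ℝ) +
      Polynomial.C ((t : ℝ) ^ 2) * Polynomial.X)) := fun t ht =>
    isMixtureEnumerator_pairVec (by omega) hk1 (t := fun _ => t) (fun _ => ht.trans hk.le) 0 ht
      fun i hi => absurd (Subsingleton.elim i 0) hi
  -- the weights of the two generators are found by comparing the coefficients of `1` and `β`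
  have hmix := ((hE k le_rfl).smul (c := d * (1 + α) / k ^ 2)
    (div_nonneg (mul_nonneg (by linarith) (by linarith)) (by positivity))).add
    ((hE 0 k.zero_le).smul (c := d ^ 2 + α - d * (1 + α) / k) (by
      rw [sub_nonneg, div_le_iff₀ hk']
      linarith))
  have hY : IsUUFInvariant (tensorOp fun _ : Fin 1 => isotropic d α) := by
    refine ⟨fun U => ?_, fun σ => permutePairs_tensorOp _ _⟩
    rw [conjLocal_tensorOp]
    refine tensorOp_congr fun i => ?_
    rw [isotropic, Matrix.mul_add, Matrix.add_mul, Matrix.mul_one, localUnitary_mul_conjTranspose,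
      Matrix.mul_smul, Matrix.smul_mul, localUnitary_conj_maxEnt]
  have hres := hmix.isMixture hd hY fun β => by
    rw [witness, tensorOp_mul, trace_tensorOp]
    simp only [Finset.univ_unique, Finset.prod_singleton]
    rw [trace_isotropic_mul_werner hd]
    congr 1
    simp only [Polynomial.eval_add, Polynomial.eval_smul, Polynomial.eval_mul,
      Polynomial.eval_C, Polynomial.eval_X, smul_eq_mul, max_eq_right hk1,
      max_eq_left zero_le_one]
    push_cast
    field_simp
    ring
  convert hres.submatrix (fun x : Fin d => fun _ : Fin 1 => x) (fun x : Fin d => fun _ : Fin 1 => x)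
    using 1
  ext p q
  simp [tensorOp]

theorem schmidtNumber_isotropic_le_iff (hd : 3 ≤ d) {k : ℕ} (hk1 : 1 ≤ k) (hk : k < d) {α : ℝ}
    (hα : -1 ≤ α) :
    schmidtNumber (isotropic d α) ≤ k ↔ α ≤ d * (k * d - 1) / (d - k) := by
  have hdk : (k : ℝ) < d := by exact_mod_cast hk
  rw [schmidtNumber_le_iff (posSemidef_isotropic hd hα)]
  refine ⟨fun h => ?_, isMixture_isotropic hd hk1 hk hα⟩
  have h1 := h.trace_mul_omegaOp_le (by simpa using hk.le)
  have h2 : (isotropic d α * omegaOp (Fin d)).trace = (((1 + α) * d : ℝ) : ℂ) := by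
    rw [isotropic_eq, Matrix.add_mul, Matrix.smul_mul, Matrix.trace_add, Matrix.trace_smul,
      trace_maxEntCompl_mul_omegaOp hd, trace_maxEnt_mul_omegaOp hd]
    push_cast
    simp
  have h3 : (isotropic d α).trace = ((d ^ 2 + α : ℝ) : ℂ) := by
    rw [isotropic_eq, Matrix.trace_add, Matrix.trace_smul, trace_maxEntCompl hd, trace_maxEnt hd]
    push_cast
    ring
  rw [h2, h3, Complex.ofReal_re, Complex.ofReal_re] at h1
  rw [le_div_iff₀ (by linarith)]
  linarith

theorem wernerUndistillable_one (hd : 3 ≤ d) : WernerUndistillable 1 d := by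
  rw [wernerUndistillable_iff hd le_rfl]
  have hw : witness 1 d (-1 / 2) = 1 + ((-1 / 2 : ℝ) : ℂ) • omegaOp (Fin 1 → Fin d) := by
    rw [← tensorOp_omegaOp, ← tensorOp_one]
    ext p q
    simp [witness, tensorOp, partialTranspose_werner]
  intro ψ hψ
  have := dotProduct_omegaOp_le (two_le_card_configurations hd le_rfl) ψ hψ
  rw [hw, Matrix.add_mulVec, Matrix.one_mulVec, Matrix.smul_mulVec, dotProduct_add,
    dotProduct_smul, Complex.add_re, smul_eq_mul, Complex.re_ofReal_mul]
  push_cast at this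
  linarith

theorem nDistillable_one_iff (hd : 3 ≤ d) {β : ℝ} (hβ : β ≤ 1) :
    NDistillable 1 (werner d β) ↔ β < -1 / 2 := by
  constructor
  · intro h
    by_contra! hge
    exact wernerUndistillable_one hd β hge hβ h
  · intro h
    rw [nDistillable_werner_iff hd le_rfl]
    refine ⟨tensorVec fun _ => pairVec d 2, schmidtRank_tensorVec_pairVec_le (fun _ => 2) 0
      fun i hi => absurd (Subsingleton.elim i 0) hi, ?_⟩
    rw [tensorVec_pairVec_dotProduct_witness (by omega) fun _ => (by omega : 2 ≤ d),
      Complex.ofReal_re]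
    simp only [Finset.univ_unique, Finset.prod_singleton, max_eq_right one_le_two]
    push_cast
    linarith

theorem trace_werner_mul_isotropic_neg_iff (hd : 3 ≤ d) (β : ℝ) :
    (partialTranspose (werner d β) *
      isotropic d (d * (2 * d - 1) / (d - 2))).trace.re < 0 ↔ β < -1 / 2 := by
  have h3 := nat_cast_ge_three hd
  have h2 : (0 : ℝ) < d - 2 := by linarith
  rw [Matrix.trace_mul_comm, trace_isotropic_mul_werner hd, Complex.ofReal_re]
  have : (d : ℝ) ^ 2 - 1 + (1 + d * (2 * d - 1) / (d - 2)) * (1 + d * β) =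
      d * (d ^ 2 - 1) / (d - 2) * (1 + 2 * β) := by
    field_simp
    ring
  have hpos : 0 < (d : ℝ) * (d ^ 2 - 1) / (d - 2) :=
    div_pos (mul_pos (by linarith) (by nlinarith)) h2
  rw [this, ← not_le, mul_nonneg_iff_of_pos_left hpos, not_le]
  constructor <;> intro h <;> linarith

end OneCopy

/-! ### Reduction by twirling -/

section Reduction

variable {n d : ℕ}

theorem nDistillable_werner_iff_exists_invariant (hd : 3 ≤ d) (hn : 1 ≤ n) (β : ℝ) :
    NDistillable n (werner d β) ↔
      ∃ σ : Matrix (Idx n d) (Idx n d) ℂ, σ.PosSemidef ∧ IsUUFInvariant σ ∧ schmidtNumber σ ≤ 2 ∧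
        (σ * witness n d β).trace.re < 0 := by
  rw [nDistillable_werner_iff hd hn]
  constructor
  · rintro ⟨ψ, hψ, hneg⟩
    have hmix := isMixture_twirl_proj hψ
    exact ⟨_, hmix.posSemidef, isUUFInvariant_twirl _, hmix.schmidtNumber_le,
      by rwa [trace_twirl_proj_mul_witness]⟩
  · rintro ⟨σ, hpos, -, hσ, hneg⟩
    rw [schmidtNumber_le_iff hpos] at hσ
    by_contra! hcon
    exact absurd (hσ.trace_mul_nonneg hcon) (not_le.mpr hneg)

end Reduction

/-! ### Two copies: separability -/

section Separability

variable {d : ℕ}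

theorem flip_mul_self : flip d * flip d = 1 := by
  ext p q
  rw [Matrix.mul_apply, Finset.sum_eq_single (p.2, p.1)]
  · simp only [flip, Matrix.of_apply, Matrix.one_apply, Prod.ext_iff]
    simp [and_comm]
  · intro r _ hr
    simp only [flip, Matrix.of_apply]
    rw [if_neg, zero_mul]
    rintro ⟨h1, h2⟩
    exact hr (Prod.ext h2.symm h1.symm)
  · simp

theorem flip_conjTranspose : (flip d)ᴴ = flip d := by
  ext p q
  simp only [flip, Matrix.conjTranspose_apply, Matrix.of_apply, apply_ite star, star_one, star_zero]
  refine if_congr ⟨fun h => ⟨h.2.symm, h.1.symm⟩, fun h => ⟨h.2.symm, h.1.symm⟩⟩ rfl rfl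

/-- `1 - F` is twice the projector onto the antisymmetric subspace. -/
theorem posSemidef_werner_neg_one : (werner d (-1)).PosSemidef := by
  have h : werner d (-1) = ((1 / 2 : ℝ) : ℂ) • ((1 - flip d)ᴴ * (1 - flip d)) := by
    rw [Matrix.conjTranspose_sub, flip_conjTranspose, Matrix.conjTranspose_one, sub_mul, mul_sub,
      mul_sub, flip_mul_self, werner]
    simp only [Matrix.one_mul, Matrix.mul_one]
    push_cast
    module
  rw [h]
  exact posSemidef_smul (Matrix.posSemidef_conjTranspose_mul_self _) (by norm_num)

/-- The partial transpose of a positive operator is nonnegative on product vectors: conjugating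
the second factor removes the partial transposition. -/
theorem nonnegOnSchmidtRank_one_partialTranspose {a : Type*} [Fintype a] [Nonempty a]
    {X : Matrix (a × a) (a × a) ℂ} (hX : X.PosSemidef) :
    NonnegOnSchmidtRank 1 (partialTranspose X) := by
  intro ψ hψ
  obtain ⟨u, v, huv⟩ := exists_eq_mul_of_schmidtRank_le_one hψ
  have h : star ψ ⬝ᵥ (partialTranspose X *ᵥ ψ) =
      star (fun p : a × a => u p.1 * star (v p.2)) ⬝ᵥ (X *ᵥ fun p => u p.1 * star (v p.2)) := by
    simp only [dotProduct, Matrix.mulVec, Fintype.sum_prod_type, Finset.mul_sum, Pi.star_apply,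
      partialTranspose, Matrix.of_apply, huv, star_mul', star_star]
    refine Finset.sum_congr rfl fun i _ => ?_
    rw [Finset.sum_congr rfl fun j _ => Finset.sum_comm, Finset.sum_comm]
    refine Finset.sum_congr rfl fun l _ => ?_
    rw [Finset.sum_comm]
    refine Finset.sum_congr rfl fun k _ => Finset.sum_congr rfl fun j _ => ?_
    ring
  rw [h]
  exact (Complex.nonneg_iff.mp (hX.dotProduct_mulVec_nonneg _)).1

open Polynomial in
/-- The enumerator of `twoCopyState d z`. -/
noncomputable def twoCopyEnum (d : ℕ) (z : ℝ × ℝ) : ℝ[X] :=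
  C (((d : ℝ) ^ 2 - 1) ^ 2) + C (2 * z.1 * ((d : ℝ) ^ 2 - 1)) * (1 + C (d : ℝ) * X) +
    C z.2 * (1 + C (d : ℝ) * X) ^ 2

theorem eval_twoCopyEnum (z : ℝ × ℝ) (β : ℝ) : (twoCopyEnum d z).eval β =
    ((d : ℝ) ^ 2 - 1) ^ 2 + 2 * z.1 * ((d : ℝ) ^ 2 - 1) * (1 + d * β) + z.2 * (1 + d * β) ^ 2 := by
  simp [twoCopyEnum]

theorem trace_twoCopyState_mul_witness_eq_eval (hd : 3 ≤ d) (z : ℝ × ℝ) (β : ℝ) :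
    (twoCopyState d z * witness 2 d β).trace = (((twoCopyEnum d z).eval β : ℝ) : ℂ) := by
  rw [trace_twoCopyState_mul_witness hd, eval_twoCopyEnum]

theorem IsMixtureEnumerator.isMixture_twoCopyState (hd : 3 ≤ d) {k : ℕ} {p : Polynomial ℝ}
    (hp : IsMixtureEnumerator k 2 d p) {z : ℝ × ℝ}
    (h : ∀ β, (twoCopyEnum d z).eval β = p.eval β) : IsMixtureOfSchmidtRank k (twoCopyState d z) :=
  hp.isMixture hd (isUUFInvariant_twoCopyState hd z) fun β => by
    rw [trace_twoCopyState_mul_witness_eq_eval hd, h]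

theorem isMixtureEnumerator_pairVec_two (hd : 3 ≤ d) {k s t : ℕ} (hk : 1 ≤ k) (hs : s ≤ 1)
    (ht : t ≤ k) (htd : t ≤ d) : IsMixtureEnumerator k 2 d
      ((Polynomial.C ((max 1 s : ℕ) : ℝ) + Polynomial.C ((s : ℝ) ^ 2) * Polynomial.X) *
        (Polynomial.C ((max 1 t : ℕ) : ℝ) + Polynomial.C ((t : ℝ) ^ 2) * Polynomial.X)) := by
  have := isMixtureEnumerator_pairVec (n := 2) (d := d) (t := ![s, t]) (by omega) hk
    (fun i => by fin_cases i; exacts [hs.trans (by omega), htd]) 1 ht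
    (fun i hi => by fin_cases i; exacts [hs, absurd rfl hi])
  rwa [Fin.prod_univ_two] at this

/-- Product vectors detect both facets of the separable states: one by the overlap with the
maximally entangled state, the other by the positivity of `1 - F`. -/
theorem separable_twoCopyState_necessary (hd : 3 ≤ d) {x y : ℝ}
    (h : IsMixtureOfSchmidtRank 1 (twoCopyState d (x, y))) :
    0 ≤ (d : ℝ) ^ 2 - 2 * d * (x - 1) + (1 - 2 * x + y) ∧
      0 ≤ (d : ℝ) ^ 2 - (1 - 2 * x + y) := by
  have h3 := nat_cast_ge_three hd
  have : Nonempty (Fin 2 → Fin d) := ⟨fun _ => ⟨0, by omega⟩⟩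
  constructor
  · have h1 := h.trace_mul_nonneg (nonnegOnSchmidtRank_one_partialTranspose
      (posSemidef_tensorOp fun _ : Fin 2 => posSemidef_werner_neg_one (d := d)))
    have h2 := trace_twoCopyState_mul_witness hd (x, y) (-1)
    rw [show (partialTranspose (tensorOp fun _ : Fin 2 => werner d (-1))) = witness 2 d (-1) from
      rfl, h2, Complex.ofReal_re] at h1
    have h4 : ((d : ℝ) ^ 2 - 1) ^ 2 + 2 * x * ((d : ℝ) ^ 2 - 1) * (1 + d * (-1)) +
        y * (1 + d * (-1)) ^ 2 =
        (d - 1) ^ 2 * ((d : ℝ) ^ 2 - 2 * d * (x - 1) + (1 - 2 * x + y)) := by ring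
    rw [h4] at h1
    exact nonneg_of_mul_nonneg_right h1 (by nlinarith)
  · have h1 := twoCopyState_overlap_le hd one_le_two h
    have h4 : (0 : ℝ) ≤ (d ^ 2 - 1) * ((d : ℝ) ^ 2 - (1 - 2 * x + y)) := by
      push_cast at h1
      nlinarith
    exact nonneg_of_mul_nonneg_right h4 (by nlinarith)

/-- The separable states are spanned by products of `|00⟩` and `|01⟩` and by the product of two
local GHZ states. The GHZ states are needed exactly when `y > (d + 1) x`. -/
theorem separable_twoCopyState_sufficient (hd : 3 ≤ d) {x y : ℝ} (hx : 0 ≤ x) (hy : 0 ≤ y)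
    (h1 : 0 ≤ (d : ℝ) ^ 2 - 2 * d * (x - 1) + (1 - 2 * x + y))
    (h2 : 0 ≤ (d : ℝ) ^ 2 - (1 - 2 * x + y)) :
    IsMixtureOfSchmidtRank 1 (twoCopyState d (x, y)) := by
  have h3 := nat_cast_ge_three hd
  have hE : ∀ s ≤ 1, ∀ t ≤ 1, _ := fun s hs t ht =>
    isMixtureEnumerator_pairVec_two hd le_rfl hs ht (ht.trans (by omega))
  have hE00 := hE 0 zero_le_one 0 zero_le_one
  have hE01 := hE 0 zero_le_one 1 le_rfl
  have hE11 := hE 1 le_rfl 1 le_rfl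
  have hG := isMixtureEnumerator_ghzVec (n := 2) (d := d) (S := Finset.univ) (t := fun _ => 0)
    (by omega) le_rfl (by simp) (fun _ => d.zero_le) 0 zero_le_one fun _ _ => zero_le_one
  -- the weights of the generators are found by comparing coefficients in powers of `1 + β`
  rcases le_total y ((d + 1) * x) with hxy | hxy
  · refine IsMixtureEnumerator.isMixture_twoCopyState hd (((hE00.smul
      (c := (d - 1) ^ 2 * (d ^ 2 - 2 * d * (x - 1) + (1 - 2 * x + y))) ?_).add
      (hE01.smul (c := 2 * d * (d - 1) * ((d + 1) * x - y)) ?_)).add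
      (hE11.smul (c := y * d ^ 2) ?_)) fun β => ?_
    · exact mul_nonneg (sq_nonneg _) h1
    · exact mul_nonneg (by nlinarith) (by linarith)
    · positivity
    · rw [eval_twoCopyEnum]
      simp
      ring
  · refine IsMixtureEnumerator.isMixture_twoCopyState hd (((hE00.smul
      (c := (d ^ 2 - 1) * (d ^ 2 - (1 - 2 * x + y))) ?_).add
      (hG.smul (c := y - (d + 1) * x) ?_)).add
      (hE11.smul (c := x * d ^ 2 * (d + 1)) ?_)) fun β => ?_
    · exact mul_nonneg (by nlinarith) h2
    · linarith
    · positivity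
    · rw [eval_twoCopyEnum]
      simp
      ring

theorem not_isMixture_zero_of_trace_ne_zero {a b : Type*} [Fintype a] [Fintype b]
    {X : Matrix (a × b) (a × b) ℂ} (h : X.trace ≠ 0) : ¬IsMixtureOfSchmidtRank 0 X := by
  rintro ⟨m, v, hv, rfl⟩
  refine h ?_
  rw [Matrix.trace_sum]
  refine Finset.sum_eq_zero fun i _ => ?_
  obtain ⟨P, -, hP⟩ := exists_coisometry_of_rank_le _ (hv i) (Nat.zero_le _)
  have h0 : Matrix.of (fun a b => v i (a, b)) = 0 := by
    rw [← hP, Subsingleton.elim P 0, Matrix.mul_zero, Matrix.zero_mul]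
  have : v i = 0 := funext fun p => congrFun (congrFun h0 p.1) p.2
  simp [this, proj]

theorem schmidtNumber_twoCopyState_eq_one_iff (hd : 3 ≤ d) {x y : ℝ} (hx : 0 ≤ x) (hy : 0 ≤ y) :
    schmidtNumber (twoCopyState d (x, y)) = 1 ↔
      0 ≤ (d : ℝ) ^ 2 - 2 * d * (x - 1) + (1 - 2 * x + y) ∧
        0 ≤ (d : ℝ) ^ 2 - (1 - 2 * x + y) := by
  have h3 := nat_cast_ge_three hd
  have hpos := posSemidef_twoCopyState (z := (x, y)) hd hx hy
  have htr : (twoCopyState d (x, y)).trace ≠ 0 := by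
    have h := trace_twoCopyState_mul_witness hd (x, y) 0
    rw [witness_zero, Matrix.mul_one] at h
    rw [h, Complex.ofReal_ne_zero]
    have h4 : (0 : ℝ) < d ^ 2 - 1 := by nlinarith
    have h5 : 0 ≤ 2 * x * ((d : ℝ) ^ 2 - 1) := by positivity
    simp only [mul_zero, add_zero, mul_one, one_pow]
    positivity
  have h0 : ¬schmidtNumber (twoCopyState d (x, y)) ≤ 0 := by
    rw [schmidtNumber_le_iff hpos]
    exact not_isMixture_zero_of_trace_ne_zero htr
  have h1 : schmidtNumber (twoCopyState d (x, y)) = 1 ↔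
      schmidtNumber (twoCopyState d (x, y)) ≤ 1 := by omega
  rw [h1, schmidtNumber_le_iff hpos]
  exact ⟨separable_twoCopyState_necessary hd,
    fun h => separable_twoCopyState_sufficient hd hx hy h.1 h.2⟩

end Separability

/-! ### Two copies: the states `A`, `B` and `C` -/

section TwoCopies

variable {d : ℕ}

theorem twirl_proj_eq_smul_twoCopyState (hd : 3 ≤ d) {ψ : Idx 2 d → ℂ} {c : ℝ} {z : ℝ × ℝ}
    (h : ∀ β : ℝ, star ψ ⬝ᵥ (witness 2 d β *ᵥ ψ) = ((c * (twoCopyEnum d z).eval β : ℝ) : ℂ)) :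
    twirl (proj ψ) = (c : ℂ) • twoCopyState d z :=
  (isUUFInvariant_twirl _).eq_of_trace_mul_witness hd ((isUUFInvariant_twoCopyState hd z).smul _)
    fun β => by
      rw [trace_twirl_proj_mul_witness, h, Matrix.smul_mul, Matrix.trace_smul,
        trace_twoCopyState_mul_witness_eq_eval hd, smul_eq_mul, Complex.ofReal_mul]

theorem ket_add_ket_eq : (ket 0 0 + ket 1 1 : Fin d × Fin d → ℂ) = pairVec d 2 := by
  ext ⟨i, j⟩
  rw [Pi.add_apply, ket_apply_eq_mul, ket_apply_eq_mul, pairVec, if_neg two_ne_zero, pairSum]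
  by_cases h0 : i.val = 0
  · by_cases h1 : j.val = 0 <;> simp [h0, h1, Fin.ext_iff, eq_comm]
  · by_cases h2 : i.val = 1
    · by_cases h1 : j.val = 1 <;> simp [h2, h1, Fin.ext_iff, eq_comm]
    · have h3 : ¬i.val < 2 := by omega
      simp [h0, h2, h3]

theorem psiA_eq : psiA d = tensorVec fun i => pairVec d (![1, 2] i) := by
  rw [psiA, ket_add_ket_eq]
  congr 1
  ext i ⟨x, y⟩
  fin_cases i
  · exact (ket_apply_eq_mul _ _ _ _).trans (pairVec_apply_eq_mul le_rfl x y).symm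
  · rfl

theorem psiB_eq : psiB d = tensorVec fun i => pairVec d (![0, 2] i) := by
  rw [psiB, ket_add_ket_eq]
  congr 1
  ext i
  fin_cases i <;> rfl

theorem schmidtRank_tensorVec_pairVec_two_le {s : ℕ} (hs : s ≤ 1) :
    schmidtRank (tensorVec fun i => pairVec d (![s, 2] i)) ≤ 2 :=
  schmidtRank_tensorVec_pairVec_le ![s, 2] 1 fun i hi => by fin_cases i; exacts [hs, absurd rfl hi]

theorem tensorVec_pairVec_two_dotProduct_witness (hd : 3 ≤ d) {s : ℕ} (hs : s ≤ 1) (β : ℝ) :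
    star (tensorVec fun i => pairVec d (![s, 2] i)) ⬝ᵥ
        (witness 2 d β *ᵥ tensorVec fun i => pairVec d (![s, 2] i)) =
      (((1 + β * s ^ 2) * (2 + 4 * β) : ℝ) : ℂ) := by
  rw [tensorVec_pairVec_dotProduct_witness (by omega) fun i => by
    fin_cases i; exacts [hs.trans (by omega), (by omega : 2 ≤ d)], Fin.prod_univ_two]
  congr 1
  simp only [Matrix.cons_val_zero, Matrix.cons_val_one, max_eq_left hs, max_eq_right one_le_two]
  push_cast
  ring

theorem schmidtRank_psiA (hd : 3 ≤ d) : schmidtRank (psiA d) = 2 := by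
  refine le_antisymm (psiA_eq (d := d) ▸ schmidtRank_tensorVec_pairVec_two_le le_rfl) ?_
  let e : Fin 2 → Fin d := Fin.castLE (by omega)
  refine two_le_schmidtRank (fun i => ![e 0, e i]) (fun i => ![e 0, e i]) fun i j => ?_
  fin_cases i <;> fin_cases j <;> simp [psiA, tensorVec, ket, e]

theorem schmidtRank_psiB (hd : 3 ≤ d) : schmidtRank (psiB d) = 2 := by
  refine le_antisymm (psiB_eq (d := d) ▸ schmidtRank_tensorVec_pairVec_two_le zero_le_one) ?_
  let e : Fin 2 → Fin d := Fin.castLE (by omega)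
  refine two_le_schmidtRank (fun i => ![e 0, e i]) (fun i => ![e 1, e i]) fun i j => ?_
  fin_cases i <;> fin_cases j <;> simp [psiB, tensorVec, ket, e]

theorem schmidtRank_psiC (hd : 3 ≤ d) : schmidtRank (psiC d) = 2 := by
  refine le_antisymm ?_ ?_
  · refine (schmidtRank_le_card_of_eq_sum (s := Fin 2)
      (fun r a => if (a 1).val = ((a 0).val + r.val) % d then 1 else 0)
      (fun r a => if (a 1).val = ((a 0).val + r.val) % d then 1 else 0) fun a b => ?_).trans
      (Fintype.card_fin 2).le
    have h : ∀ x y : Fin d, x.val = y.val % d ↔ x = y := fun x y => by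
      rw [Nat.mod_eq_of_lt y.2, Fin.ext_iff]
    simp only [Fin.sum_univ_two, psiC, Fin.val_zero, Fin.val_one, add_zero, h, ite_and,
      ite_mul, one_mul, zero_mul]
  · let e : Fin 2 → Fin d := Fin.castLE (by omega)
    have h1 : 1 % d = 1 := Nat.mod_eq_of_lt (by omega)
    refine two_le_schmidtRank (fun i => ![e 0, e i]) (fun i => ![e 0, e i]) fun i j => ?_
    fin_cases i <;> fin_cases j <;> simp [psiC, e, h1, Fin.ext_iff]

/-- The index `s.1` of a summand of `ψ_C` selects one of the two shifts of the second pair, and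
`s.2` the basis vector of the first pair. -/
theorem psiC_eq [NeZero d] : psiC d = ∑ s : Fin 2 × Fin d × Fin d, tensorVec
    ![Pi.single s.2 1, Pi.single (s.2.1 + Fin.ofNat d s.1, s.2.2 + Fin.ofNat d s.1) 1] := by
  ext p
  rw [Finset.sum_apply, Fintype.sum_prod_type]
  simp only [tensorVec, Fin.prod_univ_two, Matrix.cons_val_zero, Matrix.cons_val_one]
  have h : ∀ r : Fin 2, ∑ s : Fin d × Fin d, (Pi.single s 1 : Fin d × Fin d → ℂ) (p.1 0, p.2 0) *
      (Pi.single (s.1 + Fin.ofNat d r, s.2 + Fin.ofNat d r) 1 : Fin d × Fin d → ℂ)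
        (p.1 1, p.2 1) = if p.1 1 = p.1 0 + Fin.ofNat d r ∧ p.2 1 = p.2 0 + Fin.ofNat d r
          then 1 else 0 := fun r => by
    rw [Finset.sum_eq_single (p.1 0, p.2 0)]
    · simp [Pi.single_apply]
    · intro s _ hs
      rw [Pi.single_eq_of_ne' hs, zero_mul]
    · simp
  simp only [h, Fin.sum_univ_two, psiC]
  congr 1
  · simp [Fin.ext_iff]
  · simp [Fin.ext_iff, Fin.val_add]

theorem psiC_dotProduct_witness (hd : 3 ≤ d) (β : ℝ) :
    star (psiC d) ⬝ᵥ (witness 2 d β *ᵥ psiC d) =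
      ((2 * d ^ 2 + 8 * d * β + 4 * d ^ 2 * β ^ 2 : ℝ) : ℂ) := by
  have : NeZero d := ⟨by omega⟩
  rw [psiC_eq, sum_dotProduct_witness]
  simp only [Fin.prod_univ_two, Matrix.cons_val_zero, Matrix.cons_val_one,
    single_dotProduct_werner, add_left_inj]
  simp only [← Complex.ofReal_mul, ← Complex.ofReal_sum]
  congr 1
  have h : ∀ c c' : Fin d, ∑ p : Fin d × Fin d, ∑ q : Fin d × Fin d,
      ((if p = q then 1 else 0) + β * (if p.1 = p.2 ∧ q.1 = q.2 then 1 else 0)) *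
        ((if (p.1 + c, p.2 + c) = (q.1 + c', q.2 + c') then 1 else 0) +
          β * (if p.1 = p.2 ∧ q.1 = q.2 then 1 else 0)) =
      (if c = c' then (d : ℝ) ^ 2 else 0) + 2 * d * β + d ^ 2 * β ^ 2 := fun c c' => by
    have hpq : ∀ p q : Fin d × Fin d,
        ((if p = q then 1 else 0) + β * (if p.1 = p.2 ∧ q.1 = q.2 then 1 else 0)) *
          ((if (p.1 + c, p.2 + c) = (q.1 + c', q.2 + c') then 1 else 0) +
            β * (if p.1 = p.2 ∧ q.1 = q.2 then 1 else 0)) =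
        (if p = q then (if c = c' then 1 else 0) else 0) +
          β * (if p = q then (if p.1 = p.2 then 1 else 0) else 0) +
          β * (if (p.1 + (c - c'), p.2 + (c - c')) = q then (if p.1 = p.2 then 1 else 0) else 0) +
          β ^ 2 * ((if p.1 = p.2 then 1 else 0) * (if q.1 = q.2 then 1 else 0)) := fun p q => by
      have hT : (p.1 + c, p.2 + c) = (q.1 + c', q.2 + c') ↔
          (p.1 + (c - c'), p.2 + (c - c')) = q := by
        simp only [Prod.ext_iff, ← add_sub_assoc, sub_eq_iff_eq_add]
      have hp : (p.1 + (c - c'), p.2 + (c - c')) = p ↔ c = c' := by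
        simp [Prod.ext_iff, sub_eq_zero]
      have hr : (p.1 + (c - c'), p.2 + (c - c')).1 = (p.1 + (c - c'), p.2 + (c - c')).2 ↔
          p.1 = p.2 := add_left_inj _
      simp only [hT]
      generalize (p.1 + (c - c'), p.2 + (c - c')) = r at hp hr ⊢
      by_cases h1 : p = q
      · subst h1
        by_cases h3 : c = c' <;> by_cases h4 : p.1 = p.2 <;> simp [hp, h3, h4]
        all_goals ring
      · by_cases h2 : r = q
        · subst h2
          by_cases h4 : p.1 = p.2 <;> simp [h1, hr, h4]
          all_goals ring
        · by_cases h4 : p.1 = p.2 <;> by_cases h5 : q.1 = q.2 <;> simp [h1, h2, h4, h5]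
          all_goals ring
    simp only [hpq, Finset.sum_add_distrib, ← Finset.mul_sum, ← Finset.sum_mul, Finset.sum_ite_eq,
      Finset.mem_univ, if_true]
    simp only [Fintype.sum_prod_type, Finset.sum_ite_eq, Finset.mem_univ, if_true,
      Finset.sum_const, Finset.card_univ, Fintype.card_prod, Fintype.card_fin, nsmul_eq_mul,
      mul_ite, mul_zero]
    push_cast
    split_ifs <;> ring
  simp only [Fintype.sum_prod_type (α₁ := Fin 2)]
  rw [Finset.sum_congr rfl fun (r : Fin 2) _ => (Finset.sum_comm.trans
    (Finset.sum_congr rfl fun (r' : Fin 2) _ => h (Fin.ofNat d r) (Fin.ofNat d r')))]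
  have h01 : (Fin.ofNat d 0) ≠ Fin.ofNat d 1 := by
    simp [Fin.ext_iff, Nat.mod_eq_of_lt (show 1 < d by omega)]
  simp only [Fin.sum_univ_two, Fin.val_zero, Fin.val_one, if_true, h01, h01.symm, if_false]
  ring

theorem twirl_psiA (hd : 3 ≤ d) : ∃ c : ℝ, 0 < c ∧
    twirl (proj (psiA d)) = (c : ℂ) • twoCopyState d (pointA d) := by
  have h3 := nat_cast_ge_three hd
  have h1 : (0 : ℝ) < d ^ 2 - 1 := by nlinarith
  have h2 : (0 : ℝ) < d - 2 := by linarith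
  have h4 : (0 : ℝ) < d - 1 := by linarith
  refine ⟨(d - 1) * (2 * (d - 2)) / (d ^ 2 * (d ^ 2 - 1) ^ 2), by positivity,
    twirl_proj_eq_smul_twoCopyState hd fun β => ?_⟩
  rw [psiA_eq, tensorVec_pairVec_two_dotProduct_witness hd le_rfl]
  congr 1
  rw [eval_twoCopyEnum, pointA, show (2 * d - 4 : ℝ) = 2 * (d - 2) by ring]
  field_simp
  push_cast
  ring

theorem twirl_psiB (hd : 3 ≤ d) : ∃ c : ℝ, 0 < c ∧
    twirl (proj (psiB d)) = (c : ℂ) • twoCopyState d (pointB d) := by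
  have h3 := nat_cast_ge_three hd
  have h1 : (0 : ℝ) < d ^ 2 - 1 := by nlinarith
  have h2 : (0 : ℝ) < d - 2 := by linarith
  refine ⟨2 * (d - 2) / (d * (d ^ 2 - 1) ^ 2), by positivity,
    twirl_proj_eq_smul_twoCopyState hd fun β => ?_⟩
  rw [psiB_eq, tensorVec_pairVec_two_dotProduct_witness hd zero_le_one]
  congr 1
  rw [eval_twoCopyEnum, pointB]
  field_simp
  push_cast
  ring

theorem twirl_psiC (hd : 3 ≤ d) : ∃ c : ℝ, 0 < c ∧
    twirl (proj (psiC d)) = (c : ℂ) • twoCopyState d (pointC d) := by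
  have h3 := nat_cast_ge_three hd
  have h1 : (0 : ℝ) < d ^ 2 - 1 := by nlinarith
  have h2 : (0 : ℝ) < d ^ 2 - 2 := by nlinarith
  refine ⟨2 * (d ^ 2 - 2) / (d ^ 2 - 1) ^ 2, by positivity,
    twirl_proj_eq_smul_twoCopyState hd fun β => ?_⟩
  rw [psiC_dotProduct_witness hd]
  congr 1
  rw [eval_twoCopyEnum, pointC]
  field_simp
  ring

theorem isMixture_of_twirl_eq_smul {n : ℕ} {ψ : Idx n d → ℂ} {X : Matrix (Idx n d) (Idx n d) ℂ}
    (hψ : schmidtRank ψ = 2) (h : ∃ c : ℝ, 0 < c ∧ twirl (proj ψ) = (c : ℂ) • X) :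
    IsMixtureOfSchmidtRank 2 X := by
  obtain ⟨c, hc, hX⟩ := h
  have hX' : X = ((c⁻¹ : ℝ) : ℂ) • twirl (proj ψ) := by
    rw [hX, smul_smul, ← Complex.ofReal_mul, inv_mul_cancel₀ hc.ne', Complex.ofReal_one, one_smul]
  rw [hX']
  exact (isMixture_twirl_proj hψ.le).smul (inv_nonneg.mpr hc.le)

theorem isMixture_twoCopyState_of_mem_convexHull (hd : 3 ≤ d) {z : ℝ × ℝ}
    (hz : z ∈ convexHull ℝ {pointA d, pointB d, pointC d}) :
    IsMixtureOfSchmidtRank 2 (twoCopyState d z) := by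
  refine convexHull_min (t := {z | IsMixtureOfSchmidtRank 2 (twoCopyState d z)}) ?_ ?_ hz
  · rintro z (rfl | rfl | rfl)
    · exact isMixture_of_twirl_eq_smul (schmidtRank_psiA hd) (twirl_psiA hd)
    · exact isMixture_of_twirl_eq_smul (schmidtRank_psiB hd) (twirl_psiB hd)
    · exact isMixture_of_twirl_eq_smul (schmidtRank_psiC hd) (twirl_psiC hd)
  · intro z hz w hw a b ha hb hab
    have h : twoCopyState d (a • z + b • w) =
        (a : ℂ) • twoCopyState d z + (b : ℂ) • twoCopyState d w := by
      have hab' : (a : ℂ) + b = 1 := by exact_mod_cast hab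
      have h1 : ∀ T : Matrix (Idx 2 d) (Idx 2 d) ℂ, T = (a : ℂ) • T + (b : ℂ) • T := fun T => by
        rw [← add_smul, hab', one_smul]
      rw [twoCopyState, h1 (tensorOp ![maxEntCompl d, maxEntCompl d]), twoCopyState, twoCopyState]
      simp only [Prod.fst_add, Prod.snd_add, Prod.smul_fst, Prod.smul_snd, smul_eq_mul]
      push_cast
      module
    rw [Set.mem_ofPred_eq, h]
    exact (hz.smul ha).add (hw.smul hb)

theorem three_le_schmidtNumber_of_aboveCA (hd : 3 ≤ d) {z : ℝ × ℝ} (h1 : 0 ≤ z.1) (h2 : 0 ≤ z.2)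
    (h : AboveCA d z) : 3 ≤ schmidtNumber (twoCopyState d z) := by
  have h3 := nat_cast_ge_three hd
  have hd1 : (0 : ℝ) < d ^ 2 - 1 := by nlinarith
  have hd2 : (0 : ℝ) < d ^ 2 - 2 := by nlinarith
  have hd4 : (0 : ℝ) < d - 2 := by linarith
  have hd5 : (0 : ℝ) < 3 * d - 4 := by linarith
  rw [three_le_schmidtNumber_of_not_isMixture (posSemidef_twoCopyState hd h1 h2)]
  intro hmix
  have hle := twoCopyState_overlap_le hd le_rfl hmix
  have hslope : ((pointA d).2 - (pointC d).2) / ((pointA d).1 - (pointC d).1) =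
      4 * ((d : ℝ) ^ 2 - 1) / (d ^ 2 - 2) := by
    simp only [pointA, pointC, sub_zero]
    rw [show (2 * d - 4 : ℝ) = 2 * (d - 2) by ring, div_div_eq_mul_div,
      div_eq_div_iff (by positivity) hd2.ne']
    field_simp
    ring
  rw [AboveCA, hslope, pointC, sub_zero, div_mul_eq_mul_div, ← add_div, div_lt_iff₀ hd2] at h
  push_cast at hle
  linarith

theorem eval_twoCopyEnum_boundary (z : ℝ × ℝ) : (twoCopyEnum d z).eval (-1 / 2) =
    ((d : ℝ) ^ 2 - 1) ^ 2 - z.1 * ((d : ℝ) ^ 2 - 1) * (d - 2) + z.2 * ((d : ℝ) - 2) ^ 2 / 4 := by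
  rw [eval_twoCopyEnum]
  ring

/-- The line `AB` is where the witness at the boundary `β = -1/2` vanishes. -/
theorem rightOfAB_iff (hd : 3 ≤ d) (z : ℝ × ℝ) :
    RightOfAB d z ↔ (twoCopyEnum d z).eval (-1 / 2) < 0 := by
  have h3 := nat_cast_ge_three hd
  have hd1 : (0 : ℝ) < d ^ 2 - 1 := by nlinarith
  have hd2 : (0 : ℝ) < d - 1 := by linarith
  have hd4 : (0 : ℝ) < d - 2 := by linarith
  have hslope : ((pointA d).1 - (pointB d).1) / ((pointA d).2 - (pointB d).2) =
      ((d : ℝ) - 2) / (4 * (d ^ 2 - 1)) := by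
    rw [pointA, pointB, show (2 * d - 4 : ℝ) = 2 * (d - 2) by ring,
      show ((d : ℝ) ^ 2 - 1) = (d - 1) * (d + 1) by ring]
    field_simp
    ring
  have hpos : 0 < ((d : ℝ) ^ 2 - 1) * (d - 2) := mul_pos hd1 hd4
  rw [RightOfAB, hslope, eval_twoCopyEnum_boundary, ← sub_neg,
    ← mul_lt_mul_iff_right₀ hpos, mul_zero]
  refine Iff.of_eq (congrArg (· < 0) ?_)
  rw [pointB]
  field_simp
  ring

theorem natDegree_twoCopyEnum_le (z : ℝ × ℝ) : (twoCopyEnum d z).natDegree ≤ 2 := by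
  rw [twoCopyEnum]
  compute_degree

theorem eval_twoCopyEnum_lineMap (E D : ℝ × ℝ) (δ β : ℝ) :
    (twoCopyEnum d (E + δ • (D - E))).eval β = (twoCopyEnum d E).eval β +
      δ * ((twoCopyEnum d D).eval β - (twoCopyEnum d E).eval β) := by
  simp only [eval_twoCopyEnum, Prod.fst_add, Prod.snd_add, Prod.smul_fst, Prod.smul_snd,
    Prod.fst_sub, Prod.snd_sub, smul_eq_mul]
  ring

theorem WernerUndistillable.three_le_schmidtNumber_twoCopyState (hd : 3 ≤ d)
    (h : WernerUndistillable 2 d) {z : ℝ × ℝ} (h1 : 0 ≤ z.1) (h2 : 0 ≤ z.2) (hz : RightOfAB d z) :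
    3 ≤ schmidtNumber (twoCopyState d z) := by
  refine h.three_le_schmidtNumber hd one_le_two (posSemidef_twoCopyState hd h1 h2) ?_
  rw [trace_twoCopyState_mul_witness_eq_eval hd, Complex.ofReal_re]
  exact (rightOfAB_iff hd z).mp hz

theorem eval_twoCopyEnum_pointA (hd : 3 ≤ d) (β : ℝ) : (twoCopyEnum d (pointA d)).eval β =
    (1 + 2 * β) * (d ^ 2 * (d ^ 2 - 1) ^ 2 / ((d - 1) * (d - 2)) * (1 + β)) := by
  have h3 := nat_cast_ge_three hd
  have hd2 : (0 : ℝ) < d - 1 := by linarith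
  have hd4 : (0 : ℝ) < d - 2 := by linarith
  rw [eval_twoCopyEnum, pointA, show (2 * d - 4 : ℝ) = 2 * (d - 2) by ring]
  field_simp
  ring

theorem eval_twoCopyEnum_pointB (hd : 3 ≤ d) (β : ℝ) : (twoCopyEnum d (pointB d)).eval β =
    (1 + 2 * β) * (d * (d ^ 2 - 1) ^ 2 / (d - 2)) := by
  have h3 := nat_cast_ge_three hd
  have hd4 : (0 : ℝ) < d - 2 := by linarith
  rw [eval_twoCopyEnum, pointB]
  field_simp
  ring

theorem pointA_nonneg (hd : 3 ≤ d) : 0 ≤ pointA d := by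
  have h3 := nat_cast_ge_three hd
  have hd2 : (0 : ℝ) < d - 1 := by linarith
  have hd4 : (0 : ℝ) < d - 2 := by linarith
  have hd5 : (0 : ℝ) < 3 * d - 4 := by linarith
  rw [pointA, show (2 * d - 4 : ℝ) = 2 * (d - 2) by ring, Prod.le_def]
  constructor <;> simp only [Prod.fst_zero, Prod.snd_zero] <;> positivity

theorem pointB_nonneg (hd : 3 ≤ d) : 0 ≤ pointB d := by
  have h3 := nat_cast_ge_three hd
  have hd2 : (0 : ℝ) < d ^ 2 - 1 := by nlinarith
  have hd4 : (0 : ℝ) < d - 2 := by linarith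
  rw [pointB, Prod.le_def]
  constructor <;> simp only [Prod.fst_zero, Prod.snd_zero] <;> positivity

theorem eval_twoCopyEnum_convexCombination {a b : ℝ} (hab : a + b = 1) (z w : ℝ × ℝ) (β : ℝ) :
    (twoCopyEnum d (a • z + b • w)).eval β =
      a * (twoCopyEnum d z).eval β + b * (twoCopyEnum d w).eval β := by
  simp only [eval_twoCopyEnum, Prod.fst_add, Prod.snd_add, Prod.smul_fst, Prod.smul_snd,
    smul_eq_mul, eq_sub_iff_add_eq.mpr hab]
  ring

theorem rightOfAB_of_mem_segment (hd : 3 ≤ d) {E : ℝ × ℝ}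
    (hE : E ∈ openSegment ℝ (pointA d) (pointB d)) {D : ℝ × ℝ} (hD1 : 0 ≤ D.1) (hD2 : 0 ≤ D.2)
    (hD : RightOfAB d D) {z : ℝ × ℝ} (hz : z ∈ segment ℝ E D) (hne : z ≠ E) :
    0 ≤ z.1 ∧ 0 ≤ z.2 ∧ RightOfAB d z := by
  have hE0 : 0 ≤ E := (convex_Ici (𝕜 := ℝ) 0).openSegment_subset (pointA_nonneg hd)
    (pointB_nonneg hd) hE
  have hz0 : 0 ≤ z := (convex_Ici (𝕜 := ℝ) 0).segment_subset hE0
    (Prod.le_def.mpr ⟨hD1, hD2⟩) hz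
  refine ⟨hz0.1, hz0.2, ?_⟩
  obtain ⟨a, b, -, -, hab, rfl⟩ := hE
  obtain ⟨s, t, -, ht, hst, rfl⟩ := hz
  have ht : 0 < t := ht.lt_of_ne fun h => hne (by
    rw [← h, zero_smul, add_zero, show s = 1 by linarith, one_smul])
  rw [rightOfAB_iff hd] at hD ⊢
  rw [eval_twoCopyEnum_convexCombination hst, eval_twoCopyEnum_convexCombination hab,
    eval_twoCopyEnum_pointA hd, eval_twoCopyEnum_pointB hd]
  have := mul_neg_of_pos_of_neg ht hD
  norm_num
  linarith

theorem wernerUndistillable_two_iff_segment (hd : 3 ≤ d) {E : ℝ × ℝ}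
    (hE : E ∈ openSegment ℝ (pointA d) (pointB d)) {D : ℝ × ℝ} (hD1 : 0 ≤ D.1) (hD2 : 0 ≤ D.2)
    (hD : RightOfAB d D) :
    WernerUndistillable 2 d ↔
      ∀ z ∈ segment ℝ E D, z ≠ E → 3 ≤ schmidtNumber (twoCopyState d z) := by
  have h3 := nat_cast_ge_three hd
  have hd1 : (0 : ℝ) < d ^ 2 - 1 := by nlinarith
  have hd2 : (0 : ℝ) < d - 1 := by linarith
  have hd4 : (0 : ℝ) < d - 2 := by linarith
  have hright := fun z => rightOfAB_of_mem_segment hd hE hD1 hD2 hD (z := z)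
  obtain ⟨a, b, ha, hb, hab, hab'⟩ := hE
  let wA : ℝ := d ^ 2 * (d ^ 2 - 1) ^ 2 / ((d - 1) * (d - 2))
  let wB : ℝ := d * (d ^ 2 - 1) ^ 2 / (d - 2)
  have hEeval : ∀ β, (twoCopyEnum d E).eval β =
      (1 + 2 * β) * (b * wB + a * wA * (1 + β)) := fun β => by
    rw [← hab', eval_twoCopyEnum_convexCombination hab, eval_twoCopyEnum_pointA hd,
      eval_twoCopyEnum_pointB hd]
    ring
  have hE0 : (twoCopyEnum d E).eval (-1 / 2) = 0 := by
    rw [hEeval]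
    norm_num
  have hDneg := (rightOfAB_iff hd D).mp hD
  constructor
  · intro h z hz hzE
    obtain ⟨h1, h2, h3⟩ := hright z hz hzE
    exact h.three_le_schmidtNumber_twoCopyState hd h1 h2 h3
  · intro h
    have hseg : ∀ δ : ℝ, 0 < δ → δ < 1 →
        E + δ • (D - E) ∈ segment ℝ E D ∧ E + δ • (D - E) ≠ E := fun δ h0 h1 => by
      refine ⟨segment_eq_image' ℝ E D ▸ ⟨δ, ⟨h0.le, h1.le⟩, rfl⟩, fun h => ?_⟩
      have : D - E = 0 := (smul_eq_zero.mp (left_eq_add.mp h.symm)).resolve_left h0.ne'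
      rw [sub_eq_zero.mp this, hE0] at hDneg
      exact lt_irrefl _ hDneg
    refine (wernerUndistillable_iff_ray hd one_le_two (q := fun j => (1 + Polynomial.X) ^ j)
      (w := fun j => if j = 0 then b * wB else a * wA) (e := twoCopyEnum d D - twoCopyEnum d E)
      (Y := fun δ => twoCopyState d (E + δ • (D - E))) degree_one_add_X_pow
      (fun j hj => isMixtureEnumerator_one_add_X_pow hd hj) (fun j hj => ?_) ?_ ?_ one_pos
      (fun δ h0 h1 => ?_) (fun δ _ _ => isUUFInvariant_twoCopyState hd _)
      fun δ β h0 h1 => ?_).mpr fun δ h0 h1 => h _ (hseg δ h0 h1).1 (hseg δ h0 h1).2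
    · simp only [wA, wB]
      split_ifs <;> positivity
    · exact (Polynomial.natDegree_sub_le _ _).trans
        (max_le (natDegree_twoCopyEnum_le _) (natDegree_twoCopyEnum_le _))
    · rw [Polynomial.eval_sub, hE0, sub_zero]
      exact hDneg
    · obtain ⟨h1, h2, -⟩ := hright _ (hseg δ h0 h1).1 (hseg δ h0 h1).2
      exact posSemidef_twoCopyState hd h1 h2
    · rw [trace_twoCopyState_mul_witness_eq_eval hd, eval_twoCopyEnum_lineMap, hEeval]
      congr 1
      have hsum : ∀ f : ℕ → Polynomial ℝ, ∑ j ∈ Finset.range 2, f j = f 0 + f 1 :=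
        fun f => Finset.sum_range_succ f 1 |>.trans (by rw [Finset.sum_range_one])
      rw [hsum]
      simp only [Polynomial.eval_add, Polynomial.eval_mul, Polynomial.eval_smul,
        Polynomial.eval_one, Polynomial.eval_X, Polynomial.eval_pow, Polynomial.eval_sub, Polynomial.eval_ofNat,
        smul_eq_mul, hEeval, if_true, one_ne_zero, if_false]
      ring

theorem wernerUndistillable_two_iff (hd : 3 ≤ d) :
    WernerUndistillable 2 d ↔ ∀ z : ℝ × ℝ, 0 ≤ z.1 → 0 ≤ z.2 → RightOfAB d z →
      3 ≤ schmidtNumber (twoCopyState d z) := by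
  refine ⟨fun h z h1 h2 hz => h.three_le_schmidtNumber_twoCopyState hd h1 h2 hz, fun h => ?_⟩
  have hE : midpoint ℝ (pointA d) (pointB d) ∈ openSegment ℝ (pointA d) (pointB d) :=
    ⟨1 / 2, 1 / 2, by norm_num, by norm_num, by norm_num, by
      rw [midpoint_eq_smul_add, smul_add, invOf_eq_inv, one_div]⟩
  have hB := pointB_nonneg hd
  have hD : RightOfAB d ((pointB d).1 + 1, 0) := by
    simp [RightOfAB, pointB]
  have hD1 : 0 ≤ (pointB d).1 + 1 := add_nonneg hB.1 zero_le_one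
  refine (wernerUndistillable_two_iff_segment hd hE hD1 le_rfl hD).mpr fun z hz hne => ?_
  obtain ⟨h1, h2, h3⟩ := rightOfAB_of_mem_segment hd hE hD1 le_rfl hD hz hne
  exact h z h1 h2 h3

end TwoCopies

/-! ### The states close to the boundary of the `n`-copy cone -/

section ManyCopies

open Polynomial

variable {n d : ℕ}

theorem choose_mul_div (m j : ℕ) :
    ((m + 1).choose (j + 1) : ℝ) * ((j + 1 : ℕ) / (m + 1 : ℕ)) = m.choose j := by
  have h := Nat.add_one_mul_choose_eq m j
  have h' : ((m + 1 : ℕ) : ℝ) * m.choose j = (m + 1).choose (j + 1) * (j + 1 : ℕ) := by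
    exact_mod_cast h
  field_simp
  linarith

theorem sum_Icc_one_succ (m : ℕ) (f : ℕ → ℝ) :
    ∑ k ∈ Finset.Icc 1 (m + 1), f k = ∑ j ∈ Finset.range (m + 1), f (j + 1) := by
  have h : Finset.Icc 1 (m + 1) = Finset.Ico (0 + 1) (m + 1 + 1) := by
    ext k
    simp only [Finset.mem_Icc, Finset.mem_Ico]
    omega
  rw [h, ← Finset.sum_Ico_add' f 0 (m + 1) 1, Finset.range_eq_Ico]

/-- The enumerator of the state with coordinates `interiorCoords`, in the variable `z`. -/
theorem sum_interiorCoords (hn : 1 ≤ n) (ε δ z : ℝ) :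
    1 + ∑ k ∈ Finset.Icc 1 n, n.choose k * interiorCoords n ε δ k * z ^ k =
      (1 + z) * (1 + ε * z) ^ (n - 1) + n * δ * z := by
  obtain ⟨m, rfl⟩ : ∃ m, n = m + 1 := ⟨n - 1, by omega⟩
  have hterm : ∀ j ∈ Finset.range (m + 1),
      ((m + 1).choose (j + 1) : ℝ) * interiorCoords (m + 1) ε δ (j + 1) * z ^ (j + 1) =
        z * ((ε * z) ^ j * m.choose j) + (ε * z) ^ (j + 1) * m.choose (j + 1) +
          if j = 0 then ((m + 1 : ℕ) : ℝ) * δ * z else 0 := fun j _ => by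
    have h1 := choose_mul_div m j
    have h2 : ((m + 1).choose (j + 1) : ℝ) = m.choose j + m.choose (j + 1) := by
      exact_mod_cast Nat.choose_succ_succ m j
    have h3 : interiorCoords (m + 1) ε δ (j + 1) = ε ^ j * (((j + 1 : ℕ) : ℝ) / (m + 1 : ℕ) +
        ε * (1 - ((j + 1 : ℕ) : ℝ) / (m + 1 : ℕ))) + if j = 0 then δ else 0 := by
      rcases Nat.eq_zero_or_pos j with rfl | hj
      · simp [interiorCoords]
      · simp [interiorCoords, hj.ne']
    have h4 : ((m + 1).choose (j + 1) : ℝ) * interiorCoords (m + 1) ε δ (j + 1) =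
        ε ^ j * (m.choose j + ε * m.choose (j + 1)) +
          if j = 0 then ((m + 1 : ℕ) : ℝ) * δ else 0 := by
      have h5 : ((m + 1).choose (j + 1) : ℝ) * (if j = 0 then δ else 0) =
          if j = 0 then ((m + 1 : ℕ) : ℝ) * δ else 0 := by
        split_ifs with hj
        · simp [hj]
        · simp
      rw [h3, mul_add, h5, ← h1]
      congr 1
      linear_combination (-ε ^ (j + 1)) * h1 + ε ^ (j + 1) * h2
    rw [h4]
    split_ifs with hj
    · subst hj; ring
    · ring
  rw [sum_Icc_one_succ, Finset.sum_congr rfl hterm, Finset.sum_add_distrib, Finset.sum_add_distrib,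
    ← Finset.mul_sum, Finset.sum_ite_eq' (Finset.range (m + 1)), if_pos (by simp)]
  have hb : (1 + ε * z) ^ m = ∑ j ∈ Finset.range (m + 1), (ε * z) ^ j * m.choose j := by
    rw [add_comm, add_pow]
    simp
  have hb' : (1 + ε * z) ^ m =
      ∑ j ∈ Finset.range (m + 1), (ε * z) ^ (j + 1) * m.choose (j + 1) + 1 := by
    have h := Finset.sum_range_succ' (fun j => (ε * z) ^ j * (m.choose j : ℝ)) (m + 1)
    rw [Finset.sum_range_succ, ← hb, Nat.choose_succ_self] at h
    simpa using h
  rw [← hb, Nat.add_sub_cancel]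
  linarith

/-- The enumerator of the state with coordinates `flatCoords`, in the variable `z`. -/
theorem sum_flatCoords (hn : 1 ≤ n) (ε δ z : ℝ) :
    1 + ∑ k ∈ Finset.Icc 1 n, n.choose k * flatCoords n ε δ k * z ^ k =
      (1 + z) * (1 - ε + ε * (1 + z) ^ (n - 1)) + n * δ * z := by
  have h : ∀ k ∈ Finset.Icc 1 n, (n.choose k : ℝ) * flatCoords n ε δ k * z ^ k =
      ε * (z ^ k * n.choose k) + if k = 1 then (1 - ε + n * δ) * z else 0 := fun k hk => by
    have hn' : (n : ℝ) ≠ 0 := by positivity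
    rw [flatCoords]
    split_ifs with h1
    · subst h1
      rw [Nat.choose_one_right]
      field_simp
      ring
    · ring
  have hb : (1 + z) ^ n = 1 + ∑ k ∈ Finset.Icc 1 n, z ^ k * n.choose k := by
    rw [add_comm 1 z, add_pow, Finset.range_eq_Ico, Finset.sum_eq_sum_Ico_succ_bot (by omega)]
    simp
    rfl
  rw [Finset.sum_congr rfl h, Finset.sum_add_distrib, ← Finset.mul_sum, Finset.sum_ite_eq',
    if_pos (Finset.mem_Icc.mpr ⟨le_rfl, hn⟩)]
  have h2 : (1 + z) ^ n = (1 + z) * (1 + z) ^ (n - 1) := by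
    rw [← pow_succ', Nat.sub_add_cancel hn]
  linear_combination ε * (hb - h2) * (-1)

theorem trace_flat_mul_witness (hd : 3 ≤ d) (hn : 1 ≤ n) (ε δ β : ℝ) :
    (invariantState n d (flatCoords n ε δ) * witness n d β).trace =
      (((1 + (1 + d * β) / ((d : ℝ) / 2 - 1)) *
        (1 - ε + ε * (1 + (1 + d * β) / ((d : ℝ) / 2 - 1)) ^ (n - 1)) +
          n * δ * ((1 + d * β) / ((d : ℝ) / 2 - 1)) : ℝ) : ℂ) := by
  rw [trace_invariantState_mul_witness hd, sum_flatCoords hn]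

theorem flatCoords_nonneg {ε δ : ℝ} (hε : 0 ≤ ε) (hδ : 0 ≤ δ) (k : ℕ) (hn : 1 ≤ n) :
    0 ≤ flatCoords n ε δ k := by
  have h1 : 1 / (n : ℝ) ≤ 1 := by
    rw [div_le_one (by positivity)]
    exact_mod_cast hn
  have h2 : 0 ≤ ε * (1 - 1 / (n : ℝ)) := mul_nonneg hε (sub_nonneg.mpr h1)
  rw [flatCoords]
  split_ifs
  · positivity
  · exact hε

theorem interiorCoords_nonneg {ε δ : ℝ} (hε : 0 ≤ ε) (hδ : 0 ≤ δ) {k : ℕ} (hk1 : 1 ≤ k)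
    (hk : k ≤ n) : 0 ≤ interiorCoords n ε δ k := by
  have hn : (0 : ℝ) < n := by exact_mod_cast hk1.trans hk
  have h1 : (k : ℝ) / n ≤ 1 := by
    rw [div_le_one hn]
    exact_mod_cast hk
  have h2 : 0 ≤ ε * (1 - (k : ℝ) / n) := mul_nonneg hε (sub_nonneg.mpr h1)
  rw [interiorCoords]
  split_ifs with h
  · subst h
    rw [Nat.cast_one] at h2
    positivity
  · positivity

theorem WernerUndistillable.three_le_schmidtNumber_flat (hd : 3 ≤ d) (hn : 1 ≤ n)
    (h : WernerUndistillable n d) {ε δ : ℝ} (hε : 0 < ε) (hδ : 0 < δ) :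
    3 ≤ schmidtNumber (invariantState n d (flatCoords n ε δ)) := by
  have h3 := nat_cast_ge_three hd
  have hn' : (0 : ℝ) < n := by exact_mod_cast hn
  refine h.three_le_schmidtNumber hd hn (posSemidef_invariantState hd fun k _ _ =>
    flatCoords_nonneg hε.le hδ.le k hn) ?_
  have hz : (1 + d * (-1 / 2 : ℝ)) / ((d : ℝ) / 2 - 1) = -1 := by
    rw [div_eq_iff (by linarith)]
    ring
  rw [trace_flat_mul_witness hd hn, hz, Complex.ofReal_re]
  have := mul_pos hn' hδ
  linarith

end ManyCopies

section Criterion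

open Polynomial

variable {n d : ℕ}

theorem one_add_shift (hd : 3 ≤ d) (β : ℝ) :
    1 + (1 + d * β) / ((d : ℝ) / 2 - 1) = d / (d - 2) * (1 + 2 * β) := by
  have h3 := nat_cast_ge_three hd
  have h1 : (d : ℝ) / 2 - 1 ≠ 0 := by linarith
  have h2 : (d : ℝ) - 2 ≠ 0 := by linarith
  have h4 : (d : ℝ) / 2 - 1 = (d - 2) / 2 := by ring
  rw [h4]
  field_simp
  ring

/-- The criterion along the direction of the first coordinate: the state at `δ = 0` has to be a
positive combination of the states with enumerators `(1 + 2β) q j`. -/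
theorem wernerUndistillable_iff_coords (hd : 3 ≤ d) (hn : 1 ≤ n) {q : ℕ → ℝ[X]}
    (hq : ∀ j, (q j).degree = j)
    (hmem : ∀ j < n, IsMixtureEnumerator 2 n d ((1 + 2 * X) * q j)) {w : ℕ → ℝ}
    (hw : ∀ j < n, 0 < w j) {x : ℝ → ℕ → ℝ}
    (hx : ∀ δ, 0 < δ → ∀ k, 1 ≤ k → k ≤ n → 0 ≤ x δ k)
    (htr : ∀ δ β : ℝ, 1 + ∑ k ∈ Finset.Icc 1 n,
        n.choose k * x δ k * ((1 + d * β) / ((d : ℝ) / 2 - 1)) ^ k =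
      (1 + 2 * β) * ∑ j ∈ Finset.range n, w j * (q j).eval β +
        n * δ * ((1 + d * β) / ((d : ℝ) / 2 - 1))) :
    WernerUndistillable n d ↔ ∀ δ : ℝ, 0 < δ → 3 ≤ schmidtNumber (invariantState n d (x δ)) := by
  have h3 := nat_cast_ge_three hd
  have hn' : (0 : ℝ) < n := by exact_mod_cast hn
  have hz : (1 + d * (-1 / 2 : ℝ)) / ((d : ℝ) / 2 - 1) = -1 := by
    rw [div_eq_iff (by linarith)]
    ring
  constructor
  · intro h δ hδ
    refine h.three_le_schmidtNumber hd hn (posSemidef_invariantState hd (hx δ hδ)) ?_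
    rw [trace_invariantState_mul_witness hd, htr, hz, Complex.ofReal_re]
    have := mul_pos hn' hδ
    norm_num
    exact this
  · intro h
    refine (wernerUndistillable_iff_ray hd hn hq hmem hw
      (e := C (n / ((d : ℝ) / 2 - 1)) * (1 + C (d : ℝ) * X))
      (Y := fun δ => invariantState n d (x δ)) ?_ ?_ one_pos
      (fun δ h0 _ => posSemidef_invariantState hd (hx δ h0))
      (fun δ _ _ => isUUFInvariant_invariantState _) fun δ β h0 _ => ?_).mpr fun δ h0 _ => h δ h0
    · refine le_trans ?_ hn
      compute_degree
    · have : (C (n / ((d : ℝ) / 2 - 1)) * (1 + C (d : ℝ) * X)).eval (-1 / 2) =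
          n * ((1 + d * (-1 / 2 : ℝ)) / ((d : ℝ) / 2 - 1)) := by
        simp only [eval_mul, eval_C, eval_add, eval_one, eval_X]
        ring
      rw [this, hz]
      linarith
    · rw [trace_invariantState_mul_witness hd, htr]
      congr 1
      simp only [eval_add, eval_mul, eval_smul, eval_one, eval_ofNat, eval_X, eval_C,
        eval_finsetSum, smul_eq_mul]
      ring

theorem wernerUndistillable_iff_interior (hd : 3 ≤ d) (hn : 1 ≤ n) :
    ∃ ε₀ : ℝ, 0 < ε₀ ∧ ∀ ε : ℝ, 0 < ε → ε < ε₀ → (WernerUndistillable n d ↔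
      ∀ δ : ℝ, 0 < δ → 3 ≤ schmidtNumber (invariantState n d (interiorCoords n ε δ))) := by
  have h3 := nat_cast_ge_three hd
  have hc : (0 : ℝ) < d / 2 - 1 := by linarith
  have hd1 : (0 : ℝ) < d - 1 := by linarith
  have hd2 : (0 : ℝ) < d - 2 := by linarith
  refine ⟨(d / 2 - 1) / (d - 1), by positivity, fun ε hε hε' => ?_⟩
  -- `1 + ε z = B + A (1 + β)`, where `z = (1 + d β) / (d / 2 - 1)`
  let A : ℝ := ε * d / (d / 2 - 1)
  let B : ℝ := 1 - ε * (d - 1) / (d / 2 - 1)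
  have hA : 0 < A := by positivity
  have hB : 0 < B := by
    rw [sub_pos, div_lt_one hc]
    rwa [lt_div_iff₀ hd1] at hε'
  refine wernerUndistillable_iff_coords hd hn degree_one_add_X_pow
    (fun j hj => isMixtureEnumerator_one_add_X_pow hd hj)
    (w := fun j => d / (d - 2) * ((n - 1).choose j * A ^ j * B ^ (n - 1 - j))) (fun j hj => ?_)
    (fun δ hδ k hk1 hk => interiorCoords_nonneg hε.le hδ.le hk1 hk) fun δ β => ?_
  · have : (0 : ℝ) < (n - 1).choose j := by
      exact_mod_cast Nat.choose_pos (by omega)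
    positivity
  · have hlin : 1 + ε * ((1 + d * β) / ((d : ℝ) / 2 - 1)) = A * (1 + β) + B := by
      simp only [A, B]
      field_simp
      ring
    rw [sum_interiorCoords hn, one_add_shift hd, hlin, add_pow, Nat.sub_add_cancel hn]
    congr 1
    rw [mul_comm ((d : ℝ) / (d - 2)), mul_assoc, Finset.mul_sum]
    congr 1
    refine Finset.sum_congr rfl fun j _ => ?_
    rw [eval_pow, eval_add, eval_one, eval_X, mul_pow]
    ring

end Criterion

/-! ### The flat coordinates in large dimension -/

section Flat

open Polynomial

variable {n d : ℕ}

/-- The enumerator, up to the factor `2 d² (1 + 2β)`, of the vector that consists of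
`|00⟩ + |11⟩` on one pair and of local GHZ states on `k` further pairs. For `k = 0` there is no GHZ
state, and the polynomial is `1`. -/
noncomputable def ghzPoly (d k : ℕ) : ℝ[X] :=
  if k = 0 then 1 else C (1 - 1 / (d : ℝ)) * (1 + X ^ k) + C (1 / (d : ℝ)) * (1 + X) ^ k

theorem coeff_ghzPoly (hd : 3 ≤ d) (j : ℕ) {k : ℕ} (hk : 1 ≤ k) :
    (ghzPoly d j).coeff k = (if j = k then 1 else 0) +
      if k < j then 1 / d * (j.choose k : ℝ) else 0 := by
  have h3 := nat_cast_ge_three hd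
  rw [ghzPoly]
  split_ifs with h0 h1 h2 h2 h1 h2 h2
  all_goals try omega
  · rw [coeff_one, if_neg (by omega), add_zero]
  all_goals
    rw [coeff_add, coeff_C_mul, coeff_C_mul, coeff_add, coeff_one, if_neg (by omega : k ≠ 0),
      coeff_X_pow, coeff_one_add_X_pow]
  · subst h1
    simp
  · rw [if_neg (by omega)]
    simp
  · rw [if_neg (by omega), Nat.choose_eq_zero_of_lt (by omega)]
    simp

theorem degree_ghzPoly (hd : 3 ≤ d) (k : ℕ) : (ghzPoly d k).degree = k := by
  rcases Nat.eq_zero_or_pos k with rfl | hk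
  · simp [ghzPoly]
  · refine le_antisymm ((degree_le_iff_coeff_zero _ _).mpr fun j hj => ?_)
      (le_degree_of_ne_zero ?_)
    · have hj : k < j := by exact_mod_cast hj
      rw [coeff_ghzPoly hd k (by omega), if_neg (by omega), if_neg (by omega), add_zero]
    · rw [coeff_ghzPoly hd k hk]
      simp

theorem isMixtureEnumerator_ghzPoly (hd : 3 ≤ d) {k : ℕ} (hk : k < n) :
    IsMixtureEnumerator 2 n d ((1 + 2 * X) * ghzPoly d k) := by
  have h3 := nat_cast_ge_three hd
  rcases Nat.eq_zero_or_pos k with rfl | hk0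
  · simpa [ghzPoly] using isMixtureEnumerator_one_add_X_pow hd hk
  · obtain ⟨m, rfl⟩ : ∃ m, n = m + 1 := ⟨n - 1, by omega⟩
    let T : Finset (Fin m) := Finset.univ.filter fun i => i.val < k
    let S : Finset (Fin (m + 1)) := T.map (Fin.succEmb m)
    have hS : S.card = k := by
      rw [Finset.card_map, card_filter_val_lt (by omega)]
    have h := isMixtureEnumerator_ghzVec (n := m + 1) (d := d) (k := 2) (S := S) (by omega)
      one_le_two (by omega) (t := Fin.cons 2 fun _ : Fin m => 0)
      (fun i => by
        cases i using Fin.cases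
        · exact (by omega : 2 ≤ d)
        · exact d.zero_le) 0 le_rfl
      (fun i hi => by
        cases i using Fin.cases
        · exact absurd rfl hi
        · exact zero_le_one)
    have h0 : (0 : Fin (m + 1)) ∈ Sᶜ := by
      simp [S, Fin.succ_ne_zero]
    rw [← Finset.mul_prod_erase _ _ h0, Finset.prod_eq_one fun i hi => by
      cases i using Fin.cases
      · exact absurd rfl (Finset.ne_of_mem_erase hi)
      · simp] at h
    convert h.smul (c := 1 / (2 * d ^ 2)) (by positivity) using 1
    refine polynomial_eq_of_eval_eq fun β => ?_
    simp only [ghzPoly, hk0.ne', if_false, hS, Fin.cons_zero, eval_smul, eval_mul, eval_add, eval_C,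
      eval_X, eval_pow, eval_one, eval_ofNat, smul_eq_mul, max_eq_right one_le_two]
    push_cast
    field_simp

theorem sum_choose_mul_choose {m k : ℕ} (hk : k ≤ m) :
    ∑ j ∈ Finset.Ioc k m, (m.choose j : ℝ) * 2 ^ j * j.choose k =
      m.choose k * 2 ^ k * (3 ^ (m - k) - 1) := by
  have h : ∑ j ∈ Finset.Ico k (m + 1), (m.choose j : ℝ) * 2 ^ j * j.choose k =
      m.choose k * 2 ^ k * 3 ^ (m - k) := by
    rw [Finset.sum_Ico_eq_sum_range, show (3 : ℝ) = 2 + 1 by norm_num, add_pow, Finset.mul_sum,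
      show m + 1 - k = m - k + 1 by omega]
    refine Finset.sum_congr rfl fun i hi => ?_
    have h := Nat.choose_mul (n := m) (k := k + i) (s := k) (by omega)
    have h' : (m.choose (k + i) : ℝ) * (k + i).choose k = m.choose k * (m - k).choose i := by
      rw [Nat.add_sub_cancel_left] at h
      exact_mod_cast h
    rw [one_pow, pow_add]
    linear_combination (2 ^ k * 2 ^ i : ℝ) * h'
  rw [Finset.sum_eq_sum_Ico_succ_bot (by omega)] at h
  have h2 : Finset.Ioc k m = Finset.Ico (k + 1) (m + 1) := by
    ext i
    simp only [Finset.mem_Ioc, Finset.mem_Ico]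
    omega
  rw [h2, mul_sub, ← h, Nat.choose_self]
  push_cast
  ring

/-- The triangular system for the coefficients of `(1 + 2β)^m` in the basis `ghzPoly d k`: its
off-diagonal part has weight `1 / d`, so that the solution is positive in large dimension. -/
theorem coeff_pos_of_triangular {m d : ℕ} (hd0 : 0 < d) (hd : 3 ^ (m - 1) ≤ d) {a : ℕ → ℝ}
    (ha : ∀ k, 1 ≤ k → k ≤ m →
      (m.choose k : ℝ) * 2 ^ k = a k + 1 / d * ∑ j ∈ Finset.Ioc k m, a j * j.choose k) :
    ∀ k, 1 ≤ k → k ≤ m → 0 < a k ∧ a k ≤ m.choose k * 2 ^ k := by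
  intro k
  induction hs : m - k using Nat.strong_induction_on generalizing k with
  | _ s ih =>
    intro hk1 hk
    have hd' : (0 : ℝ) < d := by exact_mod_cast hd0
    have hpos : ∀ j ∈ Finset.Ioc k m, 0 < a j ∧ a j ≤ m.choose j * 2 ^ j := fun j hj => by
      obtain ⟨h1, h2⟩ := Finset.mem_Ioc.mp hj
      exact ih (m - j) (by omega) j rfl (by omega) h2
    have hle : ∑ j ∈ Finset.Ioc k m, a j * j.choose k ≤
        m.choose k * 2 ^ k * (3 ^ (m - k) - 1) := by
      rw [← sum_choose_mul_choose hk]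
      exact Finset.sum_le_sum fun j hj =>
        mul_le_mul_of_nonneg_right (hpos j hj).2 (Nat.cast_nonneg _)
    have hnn : 0 ≤ ∑ j ∈ Finset.Ioc k m, a j * (j.choose k : ℝ) :=
      Finset.sum_nonneg fun j hj => mul_nonneg (hpos j hj).1.le (Nat.cast_nonneg _)
    have hM : (0 : ℝ) < m.choose k * 2 ^ k :=
      mul_pos (by exact_mod_cast Nat.choose_pos hk) (by positivity)
    have h3 : (3 : ℝ) ^ (m - k) ≤ d := by
      exact_mod_cast (Nat.pow_le_pow_right (by norm_num) (by omega)).trans hd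
    have hlt : 1 / (d : ℝ) * ∑ j ∈ Finset.Ioc k m, a j * (j.choose k : ℝ) <
        m.choose k * 2 ^ k := by
      rw [one_div_mul_eq_div, div_lt_iff₀ hd']
      exact hle.trans_lt (mul_lt_mul_of_pos_left (by linarith) hM)
    have hnn' := mul_nonneg (one_div_nonneg.mpr hd'.le) hnn
    constructor <;> linarith [ha k hk1 hk]

theorem coeff_one_add_two_mul_X_pow (m k : ℕ) :
    ((1 + 2 * X : ℝ[X]) ^ m).coeff k = m.choose k * 2 ^ k := by
  have h : (1 + 2 * X : ℝ[X]) ^ m = ((1 + X) ^ m).comp (C 2 * X) := by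
    simp only [pow_comp, add_comp, one_comp, X_comp]
    rfl
  rw [h, comp_C_mul_X_coeff, coeff_one_add_X_pow]

theorem wernerUndistillable_iff_flat (hd : 3 ≤ d) (hn : 1 ≤ n) (hdn : 3 ^ (n - 2) ≤ d) :
    ∃ ε₀ : ℝ, 0 < ε₀ ∧ ∀ ε : ℝ, 0 < ε → ε < ε₀ → (WernerUndistillable n d ↔
      ∀ δ : ℝ, 0 < δ → 3 ≤ schmidtNumber (invariantState n d (flatCoords n ε δ))) := by
  have h3 := nat_cast_ge_three hd
  have hd2 : (0 : ℝ) < d - 2 := by linarith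
  obtain ⟨m, rfl⟩ : ∃ m, n = m + 1 := ⟨n - 1, by omega⟩
  obtain ⟨a, ha⟩ := exists_sum_smul_eq (degree_ghzPoly hd) (m + 1) ((1 + 2 * X) ^ m) (by
    refine (degree_lt_iff_coeff_zero _ _).mpr fun k hk => ?_
    rw [coeff_one_add_two_mul_X_pow, Nat.choose_eq_zero_of_lt (by omega)]
    simp)
  have hpos := coeff_pos_of_triangular (m := m) (d := d) (by omega) hdn (a := a) fun k hk1 hk => by
    rw [← coeff_one_add_two_mul_X_pow, ha, finsetSum_coeff]
    simp only [coeff_smul, coeff_ghzPoly hd _ hk1, smul_eq_mul, mul_add, Finset.sum_add_distrib,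
      mul_ite, mul_one, mul_zero]
    rw [Finset.sum_ite_eq' (Finset.range (m + 1)) k a, if_pos (Finset.mem_range.mpr (by omega)),
      Finset.mul_sum, ← Finset.sum_filter]
    congr 1
    refine Finset.sum_congr ?_ fun j _ => by ring
    ext j
    simp only [Finset.mem_filter, Finset.mem_range, Finset.mem_Ioc]
    omega
  -- `1 + z = κ (1 + 2 β)`; nothing is known about the sign of `a 0`, but its weight is `O(ε)`
  let κ : ℝ := d / (d - 2)
  have hκ : 0 < κ := by positivity
  refine ⟨1 / (1 + κ ^ m * |a 0|), by positivity, fun ε hε hε' => ?_⟩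
  rw [lt_div_iff₀ (by positivity)] at hε'
  refine wernerUndistillable_iff_coords hd hn (degree_ghzPoly hd)
    (fun j hj => isMixtureEnumerator_ghzPoly hd hj)
    (w := fun j => κ * ((if j = 0 then 1 - ε else 0) + ε * κ ^ m * a j)) (fun j hj => ?_)
    (fun δ hδ k _ _ => flatCoords_nonneg hε.le hδ.le k hn) fun δ β => ?_
  · refine mul_pos hκ ?_
    split_ifs with h
    · subst h
      have := neg_abs_le (a 0)
      have := mul_le_mul_of_nonneg_left this (by positivity : 0 ≤ ε * κ ^ m)
      linarith
    · rw [zero_add]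
      exact mul_pos (by positivity) (hpos j (by omega) (by omega)).1
  · have hev : (1 + 2 * β) ^ m = ∑ j ∈ Finset.range (m + 1), a j * (ghzPoly d j).eval β := by
      have := congrArg (Polynomial.eval β) ha
      simpa [eval_finsetSum] using this
    rw [sum_flatCoords hn, one_add_shift hd, Nat.add_sub_cancel]
    congr 1
    have hsum : ∑ j ∈ Finset.range (m + 1),
        κ * ((if j = 0 then 1 - ε else 0) + ε * κ ^ m * a j) * (ghzPoly d j).eval β =
        κ * (1 - ε + ε * (κ * (1 + 2 * β)) ^ m) := by
      rw [mul_pow, hev]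
      simp only [mul_assoc, ← Finset.mul_sum, add_mul, Finset.sum_add_distrib, ite_mul, zero_mul]
      rw [Finset.sum_ite_eq' (Finset.range (m + 1)), if_pos (by simp)]
      simp [ghzPoly]
    rw [hsum]
    ring

/-- Undistillability in all dimensions is decided in large dimensions. -/
theorem forall_wernerUndistillable_iff_flat (hn : 1 ≤ n) :
    (∀ d : ℕ, 3 ≤ d → WernerUndistillable n d) ↔
      ∀ d : ℕ, 3 ≤ d → ∃ ε₀ : ℝ, 0 < ε₀ ∧ ∀ ε : ℝ, 0 < ε → ε < ε₀ → ∀ δ : ℝ, 0 < δ →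
        3 ≤ schmidtNumber (invariantState n d (flatCoords n ε δ)) := by
  refine ⟨fun h d hd => ⟨1, one_pos, fun ε hε _ δ hδ =>
    (h d hd).three_le_schmidtNumber_flat hd hn hε hδ⟩, fun h d hd => ?_⟩
  have hd' : 3 ≤ max d (3 ^ (n - 2)) := hd.trans (le_max_left _ _)
  refine WernerUndistillable.of_le hd hn (le_max_left d (3 ^ (n - 2))) ?_
  obtain ⟨ε₁, hε₁, H₁⟩ := h _ hd'
  obtain ⟨ε₂, hε₂, H₂⟩ := wernerUndistillable_iff_flat hd' hn (le_max_right _ _)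
  have hm := lt_min hε₁ hε₂
  have hlt := half_lt_self hm
  exact (H₂ _ (half_pos hm) (hlt.trans_le (min_le_right _ _))).mpr
    (H₁ _ (half_pos hm) (hlt.trans_le (min_le_left _ _)))

end Flat

end Distill

theorem mainTheorem2 :
    -- twirling Schmidt-rank-two projectors into the invariant family reduces the question
    (∀ d n : ℕ, 3 ≤ d → 1 ≤ n →
      (∀ X : Matrix (Distill.Idx n d) (Distill.Idx n d) ℂ, Distill.IsUUFInvariant X ↔
        ∃ c : ℕ → ℂ, X = ∑ k ∈ Finset.range (n + 1), c k • Distill.levelOp n d k) ∧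
      (∀ ψ : Distill.Idx n d → ℂ, Distill.schmidtRank ψ ≤ 2 →
        Distill.IsUUFInvariant (Distill.twirl (Distill.proj ψ)) ∧
        (Distill.twirl (Distill.proj ψ)).PosSemidef ∧
        Distill.schmidtNumber (Distill.twirl (Distill.proj ψ)) ≤ 2 ∧
        ∀ β : ℝ,
          star ψ ⬝ᵥ (Distill.tensorOp
              (fun _ : Fin n => Distill.partialTranspose (Distill.werner d β)) *ᵥ ψ) =
            (Distill.twirl (Distill.proj ψ) * Distill.tensorOp
              (fun _ : Fin n => Distill.partialTranspose (Distill.werner d β))).trace) ∧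
      (∀ β : ℝ, -1 ≤ β → β ≤ 1 →
        (Distill.NDistillable n (Distill.werner d β) ↔
          ∃ σ : Matrix (Distill.Idx n d) (Distill.Idx n d) ℂ, σ.PosSemidef ∧
            Distill.IsUUFInvariant σ ∧ Distill.schmidtNumber σ ≤ 2 ∧
            (σ * Distill.tensorOp
              (fun _ : Fin n => Distill.partialTranspose (Distill.werner d β))).trace.re < 0))) ∧
    -- one copy
    (∀ d : ℕ, 3 ≤ d →
      (∀ k : ℕ, 1 ≤ k → k < d → ∀ α : ℝ, -1 ≤ α →
        (Distill.schmidtNumber (Distill.isotropic d α) ≤ k ↔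
          α ≤ d * (k * d - 1) / (d - k))) ∧
      (∀ β : ℝ, -1 ≤ β → β ≤ 1 →
        (Distill.NDistillable 1 (Distill.werner d β) ↔
          (Distill.partialTranspose (Distill.werner d β) *
            Distill.isotropic d (d * (2 * d - 1) / (d - 2))).trace.re < 0) ∧
        (Distill.NDistillable 1 (Distill.werner d β) ↔ β < -1 / 2))) ∧
    -- two copies
    (∀ d : ℕ, 3 ≤ d →
      (∀ x y : ℝ, 0 ≤ x → 0 ≤ y →
        (Distill.schmidtNumber (Distill.twoCopyState d (x, y)) = 1 ↔
          0 ≤ (d : ℝ) ^ 2 - 2 * d * (x - 1) + (1 - 2 * x + y) ∧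
          0 ≤ (d : ℝ) ^ 2 - (1 - 2 * x + y))) ∧
      (Distill.schmidtRank (Distill.psiA d) = 2 ∧ ∃ c : ℝ, 0 < c ∧
        Distill.twirl (Distill.proj (Distill.psiA d)) =
          (c : ℂ) • Distill.twoCopyState d (Distill.pointA d)) ∧
      (Distill.schmidtRank (Distill.psiB d) = 2 ∧ ∃ c : ℝ, 0 < c ∧
        Distill.twirl (Distill.proj (Distill.psiB d)) =
          (c : ℂ) • Distill.twoCopyState d (Distill.pointB d)) ∧
      (Distill.schmidtRank (Distill.psiC d) = 2 ∧ ∃ c : ℝ, 0 < c ∧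
        Distill.twirl (Distill.proj (Distill.psiC d)) =
          (c : ℂ) • Distill.twoCopyState d (Distill.pointC d)) ∧
      (∀ z ∈ convexHull ℝ {Distill.pointA d, Distill.pointB d, Distill.pointC d},
        Distill.schmidtNumber (Distill.twoCopyState d z) ≤ 2) ∧
      (∀ z : ℝ × ℝ, 0 ≤ z.1 → 0 ≤ z.2 → Distill.AboveCA d z →
        3 ≤ Distill.schmidtNumber (Distill.twoCopyState d z)) ∧
      (Distill.WernerUndistillable 2 d ↔
        ∀ z : ℝ × ℝ, 0 ≤ z.1 → 0 ≤ z.2 → Distill.RightOfAB d z →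
          3 ≤ Distill.schmidtNumber (Distill.twoCopyState d z)) ∧
      (∀ E ∈ openSegment ℝ (Distill.pointA d) (Distill.pointB d),
        ∀ D : ℝ × ℝ, 0 ≤ D.1 → 0 ≤ D.2 → Distill.RightOfAB d D →
          (Distill.WernerUndistillable 2 d ↔
            ∀ z ∈ segment ℝ E D, z ≠ E →
              3 ≤ Distill.schmidtNumber (Distill.twoCopyState d z)))) ∧
    -- `n` copies, for every dimension and every number of copies
    (∀ d n : ℕ, 3 ≤ d → 1 ≤ n →
      ∃ ε₀ : ℝ, 0 < ε₀ ∧ ∀ ε : ℝ, 0 < ε → ε < ε₀ →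
        (Distill.WernerUndistillable n d ↔
          ∀ δ : ℝ, 0 < δ →
            3 ≤ Distill.schmidtNumber
              (Distill.invariantState n d (Distill.interiorCoords n ε δ)))) ∧
    -- `n` copies, the coordinates `(1/n + ε(1 - 1/n) + δ, ε, …, ε)`
    (∀ d n : ℕ, 3 ≤ d → 1 ≤ n → Distill.WernerUndistillable n d →
      ∀ ε δ : ℝ, 0 < ε → 0 < δ →
        3 ≤ Distill.schmidtNumber
          (Distill.invariantState n d (Distill.flatCoords n ε δ))) ∧
    (∃ D : ℕ → ℕ, (∀ n : ℕ, n ≤ 3 → D n = 3) ∧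
      ∀ d n : ℕ, 3 ≤ d → 1 ≤ n → D n ≤ d →
        ∃ ε₀ : ℝ, 0 < ε₀ ∧ ∀ ε : ℝ, 0 < ε → ε < ε₀ →
          (Distill.WernerUndistillable n d ↔
            ∀ δ : ℝ, 0 < δ →
              3 ≤ Distill.schmidtNumber
                (Distill.invariantState n d (Distill.flatCoords n ε δ)))) ∧
    (∀ n : ℕ, 1 ≤ n →
      ((∀ d : ℕ, 3 ≤ d → Distill.WernerUndistillable n d) ↔
        ∀ d : ℕ, 3 ≤ d → ∃ ε₀ : ℝ, 0 < ε₀ ∧ ∀ ε : ℝ, 0 < ε → ε < ε₀ → ∀ δ : ℝ, 0 < δ →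
          3 ≤ Distill.schmidtNumber
            (Distill.invariantState n d (Distill.flatCoords n ε δ)))) := by
  refine ⟨fun d n hd hn => ⟨Distill.isUUFInvariant_iff hd, fun ψ hψ => ?_, fun β _ _ =>
    Distill.nDistillable_werner_iff_exists_invariant hd hn β⟩, fun d hd =>
    ⟨fun k hk1 hk α hα => Distill.schmidtNumber_isotropic_le_iff hd hk1 hk hα, fun β _ hβ =>
      ⟨(Distill.nDistillable_one_iff hd hβ).trans
        (Distill.trace_werner_mul_isotropic_neg_iff hd β).symm,
        Distill.nDistillable_one_iff hd hβ⟩⟩, fun d hd =>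
    ⟨fun x y hx hy => Distill.schmidtNumber_twoCopyState_eq_one_iff hd hx hy,
      ⟨Distill.schmidtRank_psiA hd, Distill.twirl_psiA hd⟩,
      ⟨Distill.schmidtRank_psiB hd, Distill.twirl_psiB hd⟩,
      ⟨Distill.schmidtRank_psiC hd, Distill.twirl_psiC hd⟩,
      fun z hz => (Distill.isMixture_twoCopyState_of_mem_convexHull hd hz).schmidtNumber_le,
      fun z h1 h2 hz => Distill.three_le_schmidtNumber_of_aboveCA hd h1 h2 hz,
      Distill.wernerUndistillable_two_iff hd,
      fun E hE D hD1 hD2 hD => Distill.wernerUndistillable_two_iff_segment hd hE hD1 hD2 hD⟩,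
    fun d n hd hn => Distill.wernerUndistillable_iff_interior hd hn,
    fun d n hd hn h ε δ hε hδ => h.three_le_schmidtNumber_flat hd hn hε hδ,
    ⟨fun n => max 3 (3 ^ (n - 2)), fun n hn => ?_, fun d n hd hn hD =>
      Distill.wernerUndistillable_iff_flat hd hn ((le_max_right _ _).trans hD)⟩,
    fun n hn => Distill.forall_wernerUndistillable_iff_flat hn⟩
  · have hmix := Distill.isMixture_twirl_proj hψ
    exact ⟨Distill.isUUFInvariant_twirl _, hmix.posSemidef, hmix.schmidtNumber_le,
      fun β => (Distill.trace_twirl_proj_mul_witness ψ β).symm⟩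
  -- the truncated exponent `n - 2` is at most one for `n ≤ 3`
  · exact max_eq_left (Nat.pow_le_pow_right (n := 3) (by norm_num) (by omega : n - 2 ≤ 1))
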